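/- Let $d$ be a natural number, $\delta\in(0,1)$, and let $a^{ij}:\mathbb R\to\mathbb R$, $i,j=1,\dots,d$, be bounded measurable functions such that $$\delta|\xi|^2\le \sum_{i,j=1}^d a^{ij}(t)\xi_i\xi_j\le\delta^{-1}|\xi|^2\qquad\text{for all } t\in\mathbb R,\ \xi\in\mathbb R^d .$$ For $T\in(-\infty,\infty]$ let $\mathbb R^{1+3d}_T=(-\infty,T)\times\mathbb R^{3d}$, with points $X=(t,x,y,z)$, $x,y,z\in\mathbb R^d$. Let $S^2(\mathbb R^{1+3d}_T)$ be the space of real-valued functions $u\in L^2(\mathbb R^{1+3d}_T)$ whose distributional derivatives $\nabla_xu$, $\nabla_x^2u$ and $\partial_tu-x\cdot\nabla_yu-y\cdot\nabla_zu$ also belong to $L^2(\mathbb R^{1+3d}_T)$, and put $$P_0u=\partial_tu-x\cdot\nabla_yu-y\cdot\nabla_zu-\sum_{i,j=1}^da^{ij}(t)\,\partial_{x_ix_j}u .$$ Then for every $\lambda>0$, every $T\in(-\infty,\infty]$ and every $f\in L^2(\mathbb R^{1+3d}_T)$ there is exactly one $u\in S^2(\mathbb R^{1+3d}_T)$ (up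 to equality almost everywhere) with $$P_0u+\lambda u=f\quad\text{a.e. in }\mathbb R^{1+3d}_T .$$ -/

import Mathlib

open MeasureTheory
open scoped ENNReal ContDiff

noncomputable section

namespace KFP

/-- Points `X = (t, x, y, z)` of `ℝ^{1+3d}`, with Lebesgue (product) measure as `volume`. -/
abbrev Pt (d : ℕ) : Type :=
  ℝ × EuclideanSpace ℝ (Fin d) × EuclideanSpace ℝ (Fin d) × EuclideanSpace ℝ (Fin d)

/-- The open set `ℝ^{1+3d}_T = (-∞, T) × ℝ^{3d}`; for `T = ⊤` this is the whole space. -/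
def slab (d : ℕ) (T : EReal) : Set (Pt d) := {X | (X.1 : EReal) < T}

/-- Classical partial derivative `∂_{x_i} φ`. -/
def dx {d : ℕ} (i : Fin d) (φ : Pt d → ℝ) (X : Pt d) : ℝ :=
  fderiv ℝ φ X (0, EuclideanSpace.single i 1, 0, 0)

/-- Classical transport derivative `∂_t φ - x · ∇_y φ - y · ∇_z φ`. -/
def transport {d : ℕ} (φ : Pt d → ℝ) (X : Pt d) : ℝ :=
  fderiv ℝ φ X (1, 0, 0, 0) - fderiv ℝ φ X (0, 0, X.2.1, 0) - fderiv ℝ φ X (0, 0, 0, X.2.2.1)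

/-- `φ ∈ C_0^∞(G)`. -/
structure IsTest {d : ℕ} (G : Set (Pt d)) (φ : Pt d → ℝ) : Prop where
  contDiff : ContDiff ℝ ∞ φ
  hasCompactSupport : HasCompactSupport φ
  tsupport_subset : tsupport φ ⊆ G

/-- `g = ∂_{x_i} u` in the sense of distributions on the open set `G`. -/
structure HasWeakDx {d : ℕ} (G : Set (Pt d)) (i : Fin d) (u g : Pt d → ℝ) : Prop where
  locInt : LocallyIntegrableOn u G
  locInt_deriv : LocallyIntegrableOn g G
  integral_eq : ∀ φ, IsTest G φ → ∫ X in G, u X * dx i φ X = - ∫ X in G, g X * φ X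

/-- `g = ∂_{x_i x_j} u` in the sense of distributions on the open set `G`. -/
structure HasWeakDxx {d : ℕ} (G : Set (Pt d)) (i j : Fin d) (u g : Pt d → ℝ) : Prop where
  locInt : LocallyIntegrableOn u G
  locInt_deriv : LocallyIntegrableOn g G
  integral_eq : ∀ φ, IsTest G φ → ∫ X in G, u X * dx i (dx j φ) X = ∫ X in G, g X * φ X

/-- `g = ∂_t u - x · ∇_y u - y · ∇_z u` in the sense of distributions on the open set `G`.
The vector field `(1, 0, -x, -y)` is divergence free, so the formal adjoint of the transport
operator is its negative. -/
structure HasWeakTransport {d : ℕ} (G : Set (Pt d)) (u g : Pt d → ℝ) : Prop where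
  locInt : LocallyIntegrableOn u G
  locInt_deriv : LocallyIntegrableOn g G
  integral_eq : ∀ φ, IsTest G φ → ∫ X in G, u X * transport φ X = - ∫ X in G, g X * φ X

/-- `u ∈ S^p(G)`: `u`, `∇_x u`, `∇_x² u` and `∂_t u - x · ∇_y u - y · ∇_z u` belong to `L^p(G)`. -/
structure MemS {d : ℕ} (p : ℝ≥0∞) (G : Set (Pt d)) (u : Pt d → ℝ) : Prop where
  memLp : MemLp u p (volume.restrict G)
  grad : ∀ i, ∃ g, HasWeakDx G i u g ∧ MemLp g p (volume.restrict G)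
  hess : ∀ i j, ∃ g, HasWeakDxx G i j u g ∧ MemLp g p (volume.restrict G)
  transport : ∃ g, HasWeakTransport G u g ∧ MemLp g p (volume.restrict G)

/-- The coefficients `a^{ij}(t)` are bounded, measurable and satisfy
`δ |ξ|² ≤ a^{ij}(t) ξ_i ξ_j ≤ δ⁻¹ |ξ|²`. No symmetry is required. -/
structure IsElliptic {d : ℕ} (δ : ℝ) (a : Fin d → Fin d → ℝ → ℝ) : Prop where
  measurable : ∀ i j, Measurable (a i j)
  bounded : ∃ K : ℝ, ∀ i j t, |a i j t| ≤ K
  lower : ∀ (t : ℝ) (ξ : EuclideanSpace ℝ (Fin d)),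
    δ * ‖ξ‖ ^ 2 ≤ ∑ i, ∑ j, a i j t * ξ i * ξ j
  upper : ∀ (t : ℝ) (ξ : EuclideanSpace ℝ (Fin d)),
    ∑ i, ∑ j, a i j t * ξ i * ξ j ≤ δ⁻¹ * ‖ξ‖ ^ 2

/-- `u ∈ S²(G)` solves `P₀ u + lam u = f` almost everywhere in the open set `G`, where
`P₀ u = ∂_t u - x · ∇_y u - y · ∇_z u - ∑ a^{ij}(t) ∂_{x_i x_j} u`.
Here `Yu` and `H i j` are the (a.e. unique) distributional derivatives of `u`. -/
def IsSolution {d : ℕ} (a : Fin d → Fin d → ℝ → ℝ) (lam : ℝ) (G : Set (Pt d))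
    (f u : Pt d → ℝ) : Prop :=
  MemS 2 G u ∧
    ∃ (Yu : Pt d → ℝ) (H : Fin d → Fin d → Pt d → ℝ),
      HasWeakTransport G u Yu ∧ (∀ i j, HasWeakDxx G i j u (H i j)) ∧
        ∀ᵐ X ∂(volume.restrict G),
          (Yu X - ∑ i, ∑ j, a i j X.1 * H i j X) + lam * u X = f X

end KFP

end

noncomputable section

namespace KFP

/-! The integral curves of the field `(1, 0, -x, -y)` are `t ↦ (t, x, y - t x, z - t y + t²/2 x)`,
and `shear` sends `(t, q)` to the position at time `t` of the curve issued from `q` at time `0`. It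
preserves volume and every slab. For `U = u ∘ shear` the transport derivative becomes `∂_t U`, and
`∂_{x_i}` becomes `D_i`, the derivative along `(e_i, t e_i, t²/2 e_i)`. The equation is then `∂_t U
- ∑ a^{ij}(t) D_i D_j U + lam U = f ∘ shear`, whose coefficients depend on time only.

Existence. The Fourier transform in space yields, for each frequency `p = (p₁, p₂, p₃)`, the scalar
equation `v' + m v = g` with `m = lam + 4π² ∑ a^{ij} P_i P_j` and `P_i(t) = p₁ᵢ + t p₂ᵢ + t²/2 p₃ᵢ`.
What has to be shown is that `w v` is square integrable for `w = lam + |P|²`, with a bound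
independent of `p`. The solution is an integral against `exp (-∫_s^t m)`, and Schur's test applies
to `w(t) exp (-∫_s^t m)`. The integral in `t` is bounded because `m ≥ δ w`. The integral in `s` is
bounded because a quadratic polynomial satisfies `(t - s) P(t)² ≤ 9 ∫_s^t P²`
(`sq_quadratic_le_integral`), so that `w(t)` is controlled by the mean of `w` over any earlier
interval ending at `t`. This is `Damping.lintegral_sq_le`. Parseval's identity then turns `v`, `P_i
v` and `P_i P_j v` into `U` and its weak derivatives (`exists_lagrangian_solution`). For finite `T`
the datum is extended by zero.

Uniqueness. The difference `U` of two solutions is mollified in space only, which commutes with an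
operator whose coefficients depend on time. Ellipticity and integration by parts show that the
energy `E(t) = ∫ (ρ * U)²` satisfies `E' ≤ -2 lam E` weakly on `(-∞, T)`. Since `E` is nonnegative
and integrable, it vanishes (`ae_eq_zero_of_decay`): integrability at `-∞` replaces an initial
condition. As `ρ` is arbitrary, `U = 0`. -/

/-- The space variables `(x, y, z)`. -/
abbrev Sp (d : ℕ) : Type :=
  EuclideanSpace ℝ (Fin d) × EuclideanSpace ℝ (Fin d) × EuclideanSpace ℝ (Fin d)

/-! ### Coordinates moving with the transport field. -/

/-- The vector `(e_i, t e_i, t²/2 e_i)` along which `∂_{x_i}` differentiates in the coordinates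
moving with the transport field. -/
def lagVec {d : ℕ} (t : ℝ) (i : Fin d) : Sp d :=
  (EuclideanSpace.single i 1, t • EuclideanSpace.single i 1,
    (t ^ 2 / 2) • EuclideanSpace.single i 1)

/-- Coordinates straightening the transport field `(1, 0, -x, -y)`. -/
def shear {d : ℕ} (X : Pt d) : Pt d :=
  (X.1, X.2.1, X.2.2.1 - X.1 • X.2.1, X.2.2.2 - X.1 • X.2.2.1 + (X.1 ^ 2 / 2) • X.2.1)

/-- The inverse of `shear`. -/
def unshear {d : ℕ} (X : Pt d) : Pt d :=
  (X.1, X.2.1, X.2.2.1 + X.1 • X.2.1, X.2.2.2 + X.1 • X.2.2.1 + (X.1 ^ 2 / 2) • X.2.1)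

lemma unshear_shear {d : ℕ} (X : Pt d) : unshear (shear X) = X := by
  obtain ⟨t, x, y, z⟩ := X
  simp only [shear, unshear, Prod.mk.injEq, true_and]
  constructor <;> module

lemma shear_unshear {d : ℕ} (X : Pt d) : shear (unshear X) = X := by
  obtain ⟨t, x, y, z⟩ := X
  simp only [shear, unshear, Prod.mk.injEq, true_and]
  constructor <;> module

lemma contDiff_shear {d : ℕ} : ContDiff ℝ ∞ (shear (d := d)) := by
  unfold shear; fun_prop

lemma contDiff_unshear {d : ℕ} : ContDiff ℝ ∞ (unshear (d := d)) := by
  unfold unshear; fun_prop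

/-- `shear` as a homeomorphism. -/
def shearHomeo (d : ℕ) : Pt d ≃ₜ Pt d where
  toFun := shear
  invFun := unshear
  left_inv := unshear_shear
  right_inv := shear_unshear
  continuous_toFun := contDiff_shear.continuous
  continuous_invFun := contDiff_unshear.continuous

/-- The map is triangular: with the preceding coordinates frozen, each further one is only
translated. Nested skew products therefore suffice and no Jacobian is computed. -/
lemma measurePreserving_shear (d : ℕ) : MeasurePreserving (shear (d := d)) := by
  have h1 : ∀ (t : ℝ) (x : EuclideanSpace ℝ (Fin d)), MeasurePreserving
      (fun q : EuclideanSpace ℝ (Fin d) × EuclideanSpace ℝ (Fin d) =>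
        (q.1 - t • x, q.2 - t • q.1 + (t ^ 2 / 2) • x)) := by
    intro t x
    refine MeasurePreserving.skew_product (f := fun y => y - t • x)
      (g := fun y z => z - t • y + (t ^ 2 / 2) • x) ?_ ?_ ?_
    · exact measurePreserving_sub_right _ _
    · fun_prop
    · refine .of_forall fun y => ?_
      have := measurePreserving_add_right
        (volume : Measure (EuclideanSpace ℝ (Fin d))) (- (t • y) + (t ^ 2 / 2) • x)
      refine Eq.trans ?_ this.map_eq
      congr 1; ext z : 1; module
  have h2 : ∀ t : ℝ, MeasurePreserving
      (fun q : Sp d =>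
        (q.1, q.2.1 - t • q.1, q.2.2 - t • q.2.1 + (t ^ 2 / 2) • q.1)) := by
    intro t
    refine MeasurePreserving.skew_product (f := fun x => x)
      (g := fun x (q : EuclideanSpace ℝ (Fin d) × EuclideanSpace ℝ (Fin d)) =>
        (q.1 - t • x, q.2 - t • q.1 + (t ^ 2 / 2) • x)) (MeasurePreserving.id _) ?_ ?_
    · fun_prop
    · exact .of_forall fun x => (h1 t x).map_eq
  refine MeasurePreserving.skew_product (f := fun t => t)
      (g := fun t (q : Sp d) =>
        (q.1, q.2.1 - t • q.1, q.2.2 - t • q.2.1 + (t ^ 2 / 2) • q.1))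
      (MeasurePreserving.id _) ?_ ?_
  · fun_prop
  · exact .of_forall fun x => (h2 x).map_eq

lemma measurableEmbedding_shear (d : ℕ) : MeasurableEmbedding (shear (d := d)) :=
  (shearHomeo d).measurableEmbedding

lemma measurePreserving_unshear (d : ℕ) : MeasurePreserving (unshear (d := d)) :=
  (measurePreserving_shear d).symm (shearHomeo d).toMeasurableEquiv

lemma isOpen_slab (d : ℕ) (T : EReal) : IsOpen (slab d T) :=
  isOpen_Iio.preimage (continuous_coe_real_ereal.comp continuous_fst)

/-- Derivative along `lagVec`. -/
def lagDx {d : ℕ} (i : Fin d) (ψ : Pt d → ℝ) (X : Pt d) : ℝ :=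
  fderiv ℝ ψ X (0, lagVec X.1 i)

/-- Time derivative. -/
def lagDt {d : ℕ} (ψ : Pt d → ℝ) (X : Pt d) : ℝ := fderiv ℝ ψ X (1, 0)

/-- The chain rule in an arbitrary direction, so that the space and time identities below are both
special cases of it. -/
lemma fderiv_comp_shear {d : ℕ} {φ : Pt d → ℝ} (hφ : Differentiable ℝ φ) (X v : Pt d) :
    fderiv ℝ (φ ∘ shear) X v = fderiv ℝ φ (shear X)
      (v.1, v.2.1, v.2.2.1 - (X.1 • v.2.1 + v.1 • X.2.1),
        v.2.2.2 - (X.1 • v.2.2.1 + v.1 • X.2.2.1)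
          + ((X.1 ^ 2 / 2) • v.2.1 + (X.1 * v.1) • X.2.1)) := by
  have h1 : HasFDerivAt (fun X : Pt d => X.1) (.fst ℝ _ _) X := hasFDerivAt_fst
  have h2 : HasFDerivAt (fun X : Pt d => X.2.1) ((ContinuousLinearMap.fst ℝ _ _).comp (.snd ℝ _ _)) X :=
    hasFDerivAt_fst.comp X hasFDerivAt_snd
  have h3 : HasFDerivAt (fun X : Pt d => X.2.2.1) ((ContinuousLinearMap.fst ℝ _ _).comp
    ((ContinuousLinearMap.snd ℝ _ _).comp (.snd ℝ _ _))) X :=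
    hasFDerivAt_fst.comp X (hasFDerivAt_snd.comp X hasFDerivAt_snd)
  have h4 : HasFDerivAt (fun X : Pt d => X.2.2.2) ((ContinuousLinearMap.snd ℝ _ _).comp
    ((ContinuousLinearMap.snd ℝ _ _).comp (.snd ℝ _ _))) X :=
    hasFDerivAt_snd.comp X (hasFDerivAt_snd.comp X hasFDerivAt_snd)
  have h5 := h1.prodMk (h2.prodMk ((h3.sub (h1.smul h2)).prodMk
    ((h4.sub (h1.smul h3)).add (((h1.pow 2).mul_const (2⁻¹ : ℝ)).smul h2))))
  have h6 : HasFDerivAt (shear (d := d)) _ X := h5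
  rw [((hφ (shear X)).hasFDerivAt.comp X h6).fderiv]
  simp only [ContinuousLinearMap.comp_apply]
  congr 1
  simp
  module

/-- The differential of `shear` sends `(0, lagVec t i)` to `∂_{x_i}`: the contributions to `y` are
`t - t`, those to `z` are `t²/2 - t² + t²/2`. -/
lemma lagDx_comp_shear {d : ℕ} {φ : Pt d → ℝ} (hφ : Differentiable ℝ φ) (i : Fin d) :
    lagDx i (φ ∘ shear) = dx i φ ∘ shear := by
  ext X
  simp only [lagDx, dx, Function.comp_apply, fderiv_comp_shear hφ, lagVec]
  congr 1
  simp only [Prod.mk.injEq, true_and]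
  constructor <;> module

/-- For fixed `q`, the curve `t ↦ shear (t, q)` has velocity `(1, 0, -x, -y)` at the point it passes
through. -/
lemma lagDt_comp_shear {d : ℕ} {φ : Pt d → ℝ} (hφ : Differentiable ℝ φ) :
    lagDt (φ ∘ shear) = transport φ ∘ shear := by
  ext X
  simp only [lagDt, transport, Function.comp_apply, fderiv_comp_shear hφ, ← map_sub]
  congr 1
  simp only [shear, Prod.mk.injEq, Prod.mk_sub_mk, Prod.fst_zero, Prod.snd_zero]
  refine ⟨by simp, by simp, by module, by module⟩

/-- The time coordinate is unchanged, hence the slab is invariant and test functions on it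
correspond to test functions on it. -/
lemma IsTest.comp_shear {d : ℕ} {T : EReal} {φ : Pt d → ℝ} (h : IsTest (slab d T) φ) :
    IsTest (slab d T) (φ ∘ shear) where
  contDiff := h.contDiff.comp contDiff_shear
  hasCompactSupport := h.hasCompactSupport.comp_homeomorph (shearHomeo d)
  tsupport_subset := by
    have := tsupport_comp_eq_preimage φ (shearHomeo d)
    change tsupport (φ ∘ shear) = _ at this
    rw [this]
    intro X hX
    have hX' := h.tsupport_subset (Set.mem_preimage.1 hX)
    exact hX'

lemma IsTest.comp_unshear {d : ℕ} {T : EReal} {φ : Pt d → ℝ} (h : IsTest (slab d T) φ) :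
    IsTest (slab d T) (φ ∘ unshear) where
  contDiff := h.contDiff.comp contDiff_unshear
  hasCompactSupport := h.hasCompactSupport.comp_homeomorph (shearHomeo d).symm
  tsupport_subset := by
    have := tsupport_comp_eq_preimage φ (shearHomeo d).symm
    change tsupport (φ ∘ unshear) = _ at this
    rw [this]
    intro X hX
    have hX' := h.tsupport_subset (Set.mem_preimage.1 hX)
    exact hX'

/-! ### Plancherel's theorem for the Fourier transform in the space variables. -/

open FourierTransform in
/-- The Fourier transform on `L²` is given by the Fourier integral on `L¹ ∩ L²`. -/
lemma fourier_toLp_ae_eq {W : Type*} [NormedAddCommGroup W] [InnerProductSpace ℝ W]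
    [MeasurableSpace W] [BorelSpace W] [FiniteDimensional ℝ W] {h : W → ℂ}
    (h1 : Integrable h) (h2 : MemLp h 2 volume) :
    ((𝓕 (h2.toLp h) : Lp ℂ 2 (volume : Measure W)) : W → ℂ) =ᵐ[volume] 𝓕 h := by
  refine ae_eq_of_integral_contDiff_smul_eq ((Lp.memLp _).locallyIntegrable (by norm_num)) ?_ ?_
  · refine Continuous.locallyIntegrable ?_
    exact VectorFourier.fourierIntegral_continuous Real.continuous_fourierChar
      (by exact continuous_inner) h1
  intro g hg hgc
  have hg' : ContDiff ℝ ∞ (fun x => (g x : ℂ)) := Complex.ofRealCLM.contDiff.comp hg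
  have hgc' : HasCompactSupport (fun x => (g x : ℂ)) := hgc.comp_left Complex.ofReal_zero
  set G : SchwartzMap W ℂ := hgc'.toSchwartzMap hg' with hG
  -- Both sides are tested against a Schwartz function. The `L²` transform agrees with that of
  -- tempered distributions, which moves it onto `G`; the multiplication formula for the integrable
  -- functions `G` and `h` moves it back onto `h`.
  have e1 := congrArg (fun F => F G) (Lp.fourier_toTemperedDistribution_eq (h2.toLp h))
  rw [Lp.toTemperedDistribution_apply] at e1
  have e2 : 𝓕 (Lp.toTemperedDistribution (h2.toLp h)) G
      = Lp.toTemperedDistribution (h2.toLp h) (𝓕 G) := by simp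
  rw [e2, Lp.toTemperedDistribution_apply] at e1
  have e3 : ∀ x, G x = (g x : ℂ) := fun x => rfl
  have e4 : ∫ x, g x • (𝓕 (h2.toLp h) : Lp ℂ 2 (volume : Measure W)) x
      = ∫ x, G x • (𝓕 (h2.toLp h) : Lp ℂ 2 (volume : Measure W)) x := by
    simp [e3]
  rw [e4, ← e1]
  have e5 : ∫ x, (𝓕 G) x • (h2.toLp h) x = ∫ x, (𝓕 G) x • h x := by
    refine integral_congr_ae ?_
    filter_upwards [h2.coeFn_toLp] with x hx
    rw [hx]
  rw [e5]
  have e6 := VectorFourier.integral_fourierIntegral_smul_eq_flip (μ := (volume : Measure W))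
    (ν := (volume : Measure W)) (L := innerₗ W) (f := G) (g := h) Real.continuous_fourierChar
    (by exact continuous_inner) G.integrable h1
  rw [flip_innerₗ] at e6
  refine Eq.trans ?_ (e6.trans ?_)
  · refine integral_congr_ae (.of_forall fun x => ?_)
    simp only [SchwartzMap.fourier_coe]
    rfl
  · simp only [e3, Complex.real_smul, smul_eq_mul]
    rfl

open FourierTransform in
lemma eLpNorm_fourier_eq {W : Type*} [NormedAddCommGroup W] [InnerProductSpace ℝ W]
    [MeasurableSpace W] [BorelSpace W] [FiniteDimensional ℝ W] {h : W → ℂ}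
    (h1 : Integrable h) (h2 : MemLp h 2 volume) :
    eLpNorm (𝓕 h) 2 (volume : Measure W) = eLpNorm h 2 volume := by
  rw [← eLpNorm_congr_ae (fourier_toLp_ae_eq h1 h2), ← eLpNorm_congr_ae h2.coeFn_toLp]
  have := Lp.norm_fourier_eq (h2.toLp h)
  rw [Lp.norm_def, Lp.norm_def] at this
  exact (ENNReal.toReal_eq_toReal_iff' (Lp.eLpNorm_ne_top _) (Lp.eLpNorm_ne_top _)).1 this

/-- The Euclidean inner product on the space variables. -/
def dot {d : ℕ} (p q : Sp d) : ℝ :=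
  inner ℝ p.1 q.1 + (inner ℝ p.2.1 q.2.1 + inner ℝ p.2.2 q.2.2)

/-- The space variables as a Euclidean space. -/
def toEucl {d : ℕ} (q : Sp d) :
    WithLp 2 (EuclideanSpace ℝ (Fin d) ×
      WithLp 2 (EuclideanSpace ℝ (Fin d) × EuclideanSpace ℝ (Fin d))) :=
  WithLp.toLp 2 (q.1, WithLp.toLp 2 q.2)

/-- The product `Sp d` carries the sup norm, whereas Plancherel's theorem lives on an inner product
space. The passage between the two changes the norm only, not the volume. -/
lemma measurePreserving_toEucl (d : ℕ) : MeasurePreserving (toEucl (d := d)) := by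
  have h1 : MeasurePreserving (Prod.map id (WithLp.toLp 2) : Sp d → EuclideanSpace ℝ (Fin d) ×
      WithLp 2 (EuclideanSpace ℝ (Fin d) × EuclideanSpace ℝ (Fin d))) :=
    (MeasurePreserving.id _).prod (WithLp.volume_preserving_toLp _ _)
  exact (WithLp.volume_preserving_toLp _ _).comp h1

lemma measurableEmbedding_toEucl (d : ℕ) : MeasurableEmbedding (toEucl (d := d)) := by
  refine Continuous.measurableEmbedding ?_ ?_
  · unfold toEucl; fun_prop
  · intro p q h
    have h1 := congrArg WithLp.ofLp h
    simp only [toEucl, Prod.mk.injEq] at h1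
    exact Prod.ext h1.1 (congrArg WithLp.ofLp h1.2)

lemma inner_toEucl {d : ℕ} (p q : Sp d) : inner ℝ (toEucl p) (toEucl q) = dot p q := by
  simp [toEucl, dot, WithLp.prod_inner_apply]

/-- The character with frequency `p`. -/
def chr {d : ℕ} (p q : Sp d) : ℂ := Complex.exp (((-2 * Real.pi * dot p q : ℝ) : ℂ) * Complex.I)

lemma norm_chr {d : ℕ} (p q : Sp d) : ‖chr p q‖ = 1 := Complex.norm_exp_ofReal_mul_I _

lemma continuous_dot {d : ℕ} : Continuous fun x : Sp d × Sp d => dot x.1 x.2 := by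
  unfold dot; fun_prop

lemma continuous_chr {d : ℕ} : Continuous fun x : Sp d × Sp d => chr x.1 x.2 := by
  have := continuous_dot (d := d)
  unfold chr; fun_prop

lemma continuous_chr_comp {α : Type*} [TopologicalSpace α] {d : ℕ} {f g : α → Sp d}
    (hf : Continuous f) (hg : Continuous g) : Continuous fun x => chr (f x) (g x) := by
  unfold chr dot; fun_prop

lemma isAddHaarMeasure_prod {F G : Type*} [NormedAddCommGroup F] [NormedSpace ℝ F]
    [MeasurableSpace F] [BorelSpace F] [FiniteDimensional ℝ F] [NormedAddCommGroup G]
    [NormedSpace ℝ G] [MeasurableSpace G] [BorelSpace G] [FiniteDimensional ℝ G]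
    (μ : Measure F) (ν : Measure G) [μ.IsAddHaarMeasure] [ν.IsAddHaarMeasure] :
    (μ.prod ν).IsAddHaarMeasure :=
  Measure.prod.instIsAddHaarMeasure μ ν

instance isAddHaarMeasure_volume_sp (d : ℕ) : (volume : Measure (Sp d)).IsAddHaarMeasure :=
  have := isAddHaarMeasure_prod (volume : Measure (EuclideanSpace ℝ (Fin d)))
    (volume : Measure (EuclideanSpace ℝ (Fin d)))
  isAddHaarMeasure_prod (volume : Measure (EuclideanSpace ℝ (Fin d)))
    ((volume : Measure (EuclideanSpace ℝ (Fin d))).prod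
      (volume : Measure (EuclideanSpace ℝ (Fin d))))

open FourierTransform in
-- Plancherel's theorem on the Euclidean copy of the space, pulled back along `toEucl`.
lemma eLpNorm_integral_chr_mul {d : ℕ} {h : Sp d → ℂ} (h1 : Integrable h) (h2 : MemLp h 2 volume) :
    eLpNorm (fun p => ∫ q, chr p q * h q) 2 volume = eLpNorm h 2 volume := by
  set of : WithLp 2 (EuclideanSpace ℝ (Fin d) ×
      WithLp 2 (EuclideanSpace ℝ (Fin d) × EuclideanSpace ℝ (Fin d))) → Sp d :=
    fun w => (w.ofLp.1, w.ofLp.2.ofLp) with hof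
  have hl : ∀ q : Sp d, of (toEucl q) = q := fun q => rfl
  have mp := measurePreserving_toEucl d
  have me := measurableEmbedding_toEucl d
  have h1' : Integrable (h ∘ of) := by
    rw [← mp.integrable_comp_emb me]; exact h1
  have e : (h ∘ of) ∘ toEucl = h := rfl
  have h2' : MemLp (h ∘ of) 2 volume := by
    have := mp.map_eq ▸ (me.memLp_map_measure_iff (g := h ∘ of) (p := 2) (μ := volume)).2
      (by rw [e]; exact h2)
    exact this
  have key := eLpNorm_fourier_eq h1' h2'
  rw [← mp.map_eq, me.eLpNorm_map_measure, me.eLpNorm_map_measure, e] at key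
  rw [← key]
  congr 1
  ext p
  rw [Function.comp_apply, Real.fourier_eq', ← mp.integral_comp me]
  refine integral_congr_ae (.of_forall fun q => ?_)
  simp only [Function.comp_apply, hl, smul_eq_mul, real_inner_comm (toEucl p), inner_toEucl, chr]

lemma eLpNorm_two_sq {α F : Type*} [MeasurableSpace α] [NormedAddCommGroup F] (μ : Measure α)
    (f : α → F) : eLpNorm f 2 μ ^ 2 = ∫⁻ x, ‖f x‖ₑ ^ 2 ∂μ := by
  have := eLpNorm_nnreal_pow_eq_lintegral (f := f) (μ := μ) (p := 2) two_ne_zero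
  simpa using this

lemma memLp_two_of_lintegral {α F : Type*} [MeasurableSpace α] [NormedAddCommGroup F]
    {μ : Measure α} {f : α → F} (hf : AEStronglyMeasurable f μ)
    (h : ∫⁻ x, ‖f x‖ₑ ^ 2 ∂μ < ⊤) : MemLp f 2 μ := by
  refine ⟨hf, ?_⟩
  rw [← eLpNorm_two_sq] at h
  exact (ENNReal.pow_lt_top_iff (n := 2)).1 h |>.resolve_right two_ne_zero

lemma lintegral_sq_lt_top {α F : Type*} [MeasurableSpace α] [NormedAddCommGroup F]
    {μ : Measure α} {f : α → F} (hf : MemLp f 2 μ) : ∫⁻ x, ‖f x‖ₑ ^ 2 ∂μ < ⊤ := by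
  rw [← eLpNorm_two_sq]
  exact ENNReal.pow_lt_top hf.2

lemma memLp_two_prod_right_ae {α β F : Type*} [MeasurableSpace α] [MeasurableSpace β]
    [NormedAddCommGroup F] {μ : Measure α} {ν : Measure β} [SFinite μ] [SFinite ν] {f : α × β → F}
    (hf : MemLp f 2 (μ.prod ν)) : ∀ᵐ a ∂μ, MemLp (fun b => f (a, b)) 2 ν := by
  have h := lintegral_sq_lt_top hf
  rw [lintegral_prod _ (hf.1.enorm.pow_const 2)] at h
  filter_upwards [hf.1.prodMk_left, ae_lt_top' (hf.1.enorm.pow_const 2).lintegral_prod_right' h.ne]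
    with a h1 h2
  exact memLp_two_of_lintegral h1 h2

lemma memLp_two_prod_left_ae {α β F : Type*} [MeasurableSpace α] [MeasurableSpace β]
    [NormedAddCommGroup F] {μ : Measure α} {ν : Measure β} [SFinite μ] [SFinite ν] {f : α × β → F}
    (hf : MemLp f 2 (μ.prod ν)) : ∀ᵐ b ∂ν, MemLp (fun a => f (a, b)) 2 μ := by
  have h : MemLp (f ∘ Prod.swap) 2 (ν.prod μ) := hf.comp_measurePreserving Measure.measurePreserving_swap
  exact memLp_two_prod_right_ae h

/-- The Fourier transform in the space variables. -/
def pF {d : ℕ} (f : Pt d → ℂ) (X : Pt d) : ℂ := ∫ q, chr X.2 q * f (X.1, q)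

lemma pF_congr {d : ℕ} {f g : Pt d → ℂ} (h : f =ᵐ[volume] g) : pF f =ᵐ[volume] pF g := by
  have h1 : ∀ᵐ t : ℝ, ∀ᵐ q : Sp d, f (t, q) = g (t, q) := Measure.ae_ae_of_ae_prod h
  filter_upwards [Measure.quasiMeasurePreserving_fst.ae h1] with X hX
  refine integral_congr_ae ?_
  filter_upwards [hX] with q hq
  rw [hq]

lemma stronglyMeasurable_integral_mul {α β : Type*} [MeasurableSpace α] [MeasurableSpace β]
    {ν : Measure β} [SFinite ν] {c : β × β → ℂ} (hc : Measurable c) {f : α × β → ℂ}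
    (hf : StronglyMeasurable f) :
    StronglyMeasurable fun X : α × β => ∫ q, c (X.2, q) * f (X.1, q) ∂ν := by
  have h1 : Measurable fun y : (α × β) × β => (y.1.1, y.2) := by fun_prop
  have h2 : Measurable fun y : (α × β) × β => (y.1.2, y.2) := by fun_prop
  exact StronglyMeasurable.integral_prod_right'
    (f := fun y : (α × β) × β => c (y.1.2, y.2) * f (y.1.1, y.2))
    ((hc.comp h2).stronglyMeasurable.mul (hf.comp_measurable h1))

lemma measurable_chr {d : ℕ} : Measurable fun x : Sp d × Sp d => chr x.1 x.2 :=
  continuous_chr.measurable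

lemma stronglyMeasurable_pF {d : ℕ} {f : Pt d → ℂ} (hf : StronglyMeasurable f) :
    StronglyMeasurable (pF f) :=
  stronglyMeasurable_integral_mul measurable_chr hf

lemma aestronglyMeasurable_pF {d : ℕ} {f : Pt d → ℂ} (hf : AEStronglyMeasurable f volume) :
    AEStronglyMeasurable (pF f) volume :=
  (stronglyMeasurable_pF hf.stronglyMeasurable_mk).aestronglyMeasurable.congr
    (pF_congr hf.ae_eq_mk).symm

/-- Plancherel's theorem on almost every time slice, integrated in time by Tonelli's theorem. -/
lemma lintegral_pF {d : ℕ} {f : Pt d → ℂ} (h1 : Integrable f) (h2 : MemLp f 2 volume) :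
    ∫⁻ X, ‖pF f X‖ₑ ^ 2 = ∫⁻ X, ‖f X‖ₑ ^ 2 := by
  have e1 := lintegral_prod (μ := (volume : Measure ℝ)) (ν := (volume : Measure (Sp d)))
    (fun X => ‖pF f X‖ₑ ^ 2) ((aestronglyMeasurable_pF h1.1).enorm.pow_const 2)
  have e2 := lintegral_prod (μ := (volume : Measure ℝ)) (ν := (volume : Measure (Sp d)))
    (fun X => ‖f X‖ₑ ^ 2) (h1.1.enorm.pow_const 2)
  refine e1.trans (Eq.trans ?_ e2.symm)
  refine lintegral_congr_ae ?_
  filter_upwards [Integrable.prod_right_ae h1, memLp_two_prod_right_ae h2] with t h3 h4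
  rw [← eLpNorm_two_sq, ← eLpNorm_two_sq, ← eLpNorm_integral_chr_mul h3 h4]
  rfl

lemma memLp_pF {d : ℕ} {f : Pt d → ℂ} (h1 : Integrable f) (h2 : MemLp f 2 volume) :
    MemLp (pF f) 2 volume :=
  memLp_two_of_lintegral (aestronglyMeasurable_pF h1.1)
    (by rw [lintegral_pF h1 h2]; exact lintegral_sq_lt_top h2)

lemma eLpNorm_pF {d : ℕ} {f : Pt d → ℂ} (h1 : Integrable f) (h2 : MemLp f 2 volume) :
    eLpNorm (pF f) 2 volume = eLpNorm f 2 volume := by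
  have := lintegral_pF h1 h2
  rw [← eLpNorm_two_sq, ← eLpNorm_two_sq] at this
  exact (ENNReal.pow_right_strictMono two_ne_zero).injective this

lemma pF_add {d : ℕ} {f g : Pt d → ℂ} (hf : Integrable f) (hg : Integrable g) :
    pF (f + g) =ᵐ[volume] pF f + pF g := by
  have h := (Integrable.prod_right_ae hf).and (Integrable.prod_right_ae hg)
  filter_upwards [Measure.quasiMeasurePreserving_fst.ae h] with X hX
  have hb : ∀ f : Sp d → ℂ, Integrable f → Integrable fun q => chr X.2 q * f q := by
    intro f hf
    refine hf.bdd_mul (c := 1) ?_ (.of_forall fun q => (norm_chr _ _).le)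
    exact (measurable_chr.comp measurable_prodMk_left).aestronglyMeasurable
  simp only [pF, Pi.add_apply, mul_add]
  exact integral_add (hb _ hX.1) (hb _ hX.2)

lemma pF_smul {d : ℕ} (c : ℂ) (f : Pt d → ℂ) : pF (c • f) = c • pF f := by
  ext X
  simp only [pF, Pi.smul_apply, smul_eq_mul, ← integral_const_mul]
  congr 1; ext q; ring

/-! ### Extension to `L²` and Parseval's identities. -/

/-- `L¹ ∩ L²` as a subspace of `L²`. -/
def integrableL2 {α : Type*} [MeasurableSpace α] (μ : Measure α) : Submodule ℂ (Lp ℂ 2 μ) where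
  carrier := {f | Integrable f μ}
  add_mem' {f g} hf hg := by
    rw [Set.mem_ofPred_eq] at *
    exact (Integrable.add hf hg).congr (Lp.coeFn_add f g).symm
  zero_mem' := by
    rw [Set.mem_ofPred_eq]
    exact (integrable_zero _ _ _).congr (Lp.coeFn_zero _ _ _).symm
  smul_mem' c f hf := by
    rw [Set.mem_ofPred_eq] at *
    exact (Integrable.smul c hf).congr (Lp.coeFn_smul c f).symm

/-- Simple functions are dense in `L²`, and those that lie in `L²` are integrable. -/
lemma denseRange_integrableL2 {α : Type*} [MeasurableSpace α] (μ : Measure α) :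
    DenseRange (integrableL2 μ).subtype := by
  refine (Lp.simpleFunc.denseRange (E := ℂ) (μ := μ) (p := 2) (by norm_num)).mono ?_
  rintro _ ⟨f, rfl⟩
  refine ⟨⟨f.1, ?_⟩, rfl⟩
  have h1 : MemLp (Lp.simpleFunc.toSimpleFunc f) 2 μ := Lp.simpleFunc.memLp f
  have h2 : Integrable (Lp.simpleFunc.toSimpleFunc f) μ := by
    rw [← SimpleFunc.memLp_iff_integrable (p := 2) (by norm_num) (by norm_num)]
    exact h1
  exact h2.congr (Lp.simpleFunc.toSimpleFunc_eq_toFun f)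

/-- An `L²`-isometric linear map on `L¹ ∩ L²` extends to an isometry of `L²`. -/
lemma exists_isometry_extension {α : Type*} [MeasurableSpace α] {μ : Measure α}
    (S : (α → ℂ) → α → ℂ)
    (hcongr : ∀ f g, f =ᵐ[μ] g → S f =ᵐ[μ] S g)
    (hadd : ∀ f g, Integrable f μ → Integrable g μ → S (f + g) =ᵐ[μ] S f + S g)
    (hsmul : ∀ (c : ℂ) f, S (c • f) = c • S f)
    (hmem : ∀ f, Integrable f μ → MemLp f 2 μ → MemLp (S f) 2 μ)
    (hnorm : ∀ f, Integrable f μ → MemLp f 2 μ → eLpNorm (S f) 2 μ = eLpNorm f 2 μ) :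
    ∃ A : Lp ℂ 2 μ →L[ℂ] Lp ℂ 2 μ, (∀ f, ‖A f‖ = ‖f‖) ∧
      ∀ f (h1 : Integrable f μ) (h2 : MemLp f 2 μ), A (h2.toLp f) = (hmem f h1 h2).toLp (S f) := by
  let L : integrableL2 μ →ₗ[ℂ] Lp ℂ 2 μ :=
    { toFun := fun f => (hmem f.1 f.2 (Lp.memLp f.1)).toLp _
      map_add' := fun f g => by
        rw [← MemLp.toLp_add]
        refine (MemLp.toLp_eq_toLp_iff _ _).2 ?_
        exact (hcongr _ _ (Lp.coeFn_add f.1 g.1)).trans (hadd _ _ f.2 g.2)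
      map_smul' := fun c f => by
        rw [RingHom.id_apply, ← MemLp.toLp_const_smul]
        refine (MemLp.toLp_eq_toLp_iff _ _).2 ?_
        exact (hcongr _ _ (Lp.coeFn_smul c f.1)).trans (.of_eq (hsmul c _)) }
  have hL : ∀ f, ‖L f‖ = ‖(integrableL2 μ).subtype f‖ := fun f => by
    change ‖(hmem f.1 f.2 (Lp.memLp f.1)).toLp _‖ = ‖f.1‖
    rw [Lp.norm_toLp, hnorm _ f.2 (Lp.memLp f.1), Lp.norm_def]
  have hA : ∀ f, L.extendOfNorm (integrableL2 μ).subtype ((integrableL2 μ).subtype f) = L f :=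
    LinearMap.extendOfNorm_eq (denseRange_integrableL2 μ)
      ⟨1, fun f => by rw [one_mul]; exact (hL f).le⟩
  refine ⟨L.extendOfNorm (integrableL2 μ).subtype, fun f => ?_, fun f h1 h2 => ?_⟩
  · refine (denseRange_integrableL2 μ).induction_on
      (p := fun f => ‖L.extendOfNorm (integrableL2 μ).subtype f‖ = ‖f‖) f ?_ ?_
    · exact isClosed_eq (ContinuousLinearMap.continuous _).norm continuous_norm
    · intro f
      rw [hA, hL]
  · have h : h2.toLp f ∈ integrableL2 μ := h1.congr h2.coeFn_toLp.symm
    refine (hA ⟨_, h⟩).trans ?_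
    exact (MemLp.toLp_eq_toLp_iff (hmem _ h (Lp.memLp _)) _).2 (hcongr _ _ h2.coeFn_toLp)

open ComplexConjugate in
/-- Parseval's identities for an `L²`-isometric linear map on `L¹ ∩ L²`. -/
lemma exists_parseval {α : Type*} [MeasurableSpace α] {μ : Measure α}
    (S : (α → ℂ) → α → ℂ)
    (hcongr : ∀ f g, f =ᵐ[μ] g → S f =ᵐ[μ] S g)
    (hadd : ∀ f g, Integrable f μ → Integrable g μ → S (f + g) =ᵐ[μ] S f + S g)
    (hsmul : ∀ (c : ℂ) f, S (c • f) = c • S f)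
    (hmem : ∀ f, Integrable f μ → MemLp f 2 μ → MemLp (S f) 2 μ)
    (hnorm : ∀ f, Integrable f μ → MemLp f 2 μ → eLpNorm (S f) 2 μ = eLpNorm f 2 μ) :
    (∀ W, MemLp W 2 μ → ∃ U, MemLp U 2 μ ∧ ∀ ψ, Integrable ψ μ → MemLp ψ 2 μ →
      ∫ x, conj (ψ x) * U x ∂μ = ∫ x, conj (S ψ x) * W x ∂μ) ∧
    (∀ U, MemLp U 2 μ → ∃ W, MemLp W 2 μ ∧ ∀ ψ, Integrable ψ μ → MemLp ψ 2 μ →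
      ∫ x, conj (ψ x) * U x ∂μ = ∫ x, conj (S ψ x) * W x ∂μ) := by
  obtain ⟨A, hA, hAS⟩ := exists_isometry_extension S hcongr hadd hsmul hmem hnorm
  have hAA : ∀ f, ContinuousLinearMap.adjoint A (A f) = f := fun f =>
    congrArg (fun F => F f) ((ContinuousLinearMap.norm_map_iff_adjoint_comp_self A).1 hA)
  have key : ∀ ψ, Integrable ψ μ → MemLp ψ 2 μ → ∀ W : Lp ℂ 2 μ,
      ∫ x, conj (ψ x) * ContinuousLinearMap.adjoint A W x ∂μ = ∫ x, conj (S ψ x) * W x ∂μ := by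
    intro ψ h1 h2 W
    have e := ContinuousLinearMap.adjoint_inner_right A (h2.toLp ψ) W
    rw [hAS ψ h1 h2, L2.inner_def, L2.inner_def] at e
    refine Eq.trans ?_ (e.trans ?_)
    · refine integral_congr_ae ?_
      filter_upwards [h2.coeFn_toLp] with X hX
      rw [hX, RCLike.inner_apply, mul_comm]
    · refine integral_congr_ae ?_
      filter_upwards [(hmem ψ h1 h2).coeFn_toLp] with X hX
      rw [hX, RCLike.inner_apply, mul_comm]
  -- With `A` the isometric extension of `S`, the first identity takes `U = A* W`. The second takes
  -- `W = A U` and uses `A* A = 1`. Surjectivity of `A` is not needed.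
  refine ⟨fun W hW => ⟨_, Lp.memLp (ContinuousLinearMap.adjoint A (hW.toLp W)), ?_⟩,
    fun U hU => ⟨_, Lp.memLp (A (hU.toLp U)), ?_⟩⟩
  · intro ψ h1 h2
    rw [key ψ h1 h2]
    refine integral_congr_ae ?_
    filter_upwards [hW.coeFn_toLp] with X hX
    rw [hX]
  · intro ψ h1 h2
    rw [← key ψ h1 h2, hAA]
    refine integral_congr_ae ?_
    filter_upwards [hU.coeFn_toLp] with X hX
    rw [hX]

open ComplexConjugate in
/-- Parseval's identities for the partial Fourier transform. -/
lemma exists_parseval_pF (d : ℕ) :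
    (∀ W : Pt d → ℂ, MemLp W 2 volume → ∃ U : Pt d → ℂ, MemLp U 2 volume ∧
      ∀ ψ, Integrable ψ → MemLp ψ 2 volume →
        ∫ X, conj (ψ X) * U X = ∫ X, conj (pF ψ X) * W X) ∧
    (∀ U : Pt d → ℂ, MemLp U 2 volume → ∃ W : Pt d → ℂ, MemLp W 2 volume ∧
      ∀ ψ, Integrable ψ → MemLp ψ 2 volume →
        ∫ X, conj (ψ X) * U X = ∫ X, conj (pF ψ X) * W X) :=
  exists_parseval (μ := (volume : Measure (Pt d))) pF (fun _ _ h => pF_congr h)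
    (fun _ _ hf hg => pF_add hf hg) pF_smul (fun _ h1 h2 => memLp_pF h1 h2)
    (fun _ h1 h2 => eLpNorm_pF h1 h2)

/-! ### The scalar equation `v' + m v = g` and its maximal regularity. -/

/-- Mean value bound for quadratic polynomials:
`(t - s) P(t)² ≤ 9 ∫_s^t P²`. -/
lemma sq_quadratic_le_integral {A B C s t : ℝ} (hst : s < t) :
    (t - s) * (A + t * B + t ^ 2 / 2 * C) ^ 2 / 9
      ≤ ∫ r in s..t, (A + r * B + r ^ 2 / 2 * C) ^ 2 := by
  have hint : ∫ r in s..t, (A + r * B + r ^ 2 / 2 * C) ^ 2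
      = (A ^ 2 * t + A * B * t ^ 2 + (B ^ 2 + A * C) * t ^ 3 / 3 + B * C * t ^ 4 / 4
          + C ^ 2 / 4 * t ^ 5 / 5)
        - (A ^ 2 * s + A * B * s ^ 2 + (B ^ 2 + A * C) * s ^ 3 / 3 + B * C * s ^ 4 / 4
          + C ^ 2 / 4 * s ^ 5 / 5) := by
    refine intervalIntegral.integral_eq_sub_of_hasDerivAt
      (f := fun r => A ^ 2 * r + A * B * r ^ 2 + (B ^ 2 + A * C) * r ^ 3 / 3 + B * C * r ^ 4 / 4
          + C ^ 2 / 4 * r ^ 5 / 5) ?_ ?_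
    · intro r _
      have h := (((((hasDerivAt_id r).const_mul (A ^ 2)).add
        (((hasDerivAt_id r).pow 2).const_mul (A * B))).add
        ((((hasDerivAt_id r).pow 3).const_mul (B ^ 2 + A * C)).div_const 3)).add
        ((((hasDerivAt_id r).pow 4).const_mul (B * C)).div_const 4)).add
        ((((hasDerivAt_id r).pow 5).const_mul (C ^ 2 / 4)).div_const 5)
      refine h.congr_deriv ?_
      simp only [id]
      push_cast
      ring
    · exact Continuous.intervalIntegrable (by fun_prop) _ _
  rw [hint]
  set h := t - s with hh
  have hpos : 0 < h := sub_pos.2 hst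
  have hs : s = t - h := by rw [hh]; ring
  set α := A + t * B + t ^ 2 / 2 * C with hα
  set β := -(B + t * C) * h with hβ
  set γ := C / 2 * h ^ 2 with hγ
  -- For `τ ∈ [0, 1]` the polynomial at `t - h τ` equals `α + β τ + γ τ²`, and the form is `∫₀¹ (α +
  -- β τ + γ τ²)² dτ - α²/9`. It is exactly a combination of the two squares below with weights
  -- `9/8` and `5/96`. It is therefore degenerate, and the constant `9` is optimal.
  have key : 0 ≤ 8 / 9 * α ^ 2 + α * β + (β ^ 2 + 2 * α * γ) / 3 + β * γ / 2 + γ ^ 2 / 5 := by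
    nlinarith [sq_nonneg (8 / 9 * α + β / 2 + γ / 3), sq_nonneg (β + 6 / 5 * γ)]
  have := mul_nonneg hpos.le key
  rw [← sub_nonneg]
  refine this.trans (le_of_eq ?_)
  rw [hs, hα, hβ, hγ]
  ring

/-- The resolving kernel `exp (-∫_s^t m)` for `s < t` of the equation `v' + m v = g`. -/
def kern (m : ℝ → ℝ) (t s : ℝ) : ℝ :=
  if s < t then Real.exp (-∫ r in s..t, m r) else 0

lemma kern_nonneg (m : ℝ → ℝ) (t s : ℝ) : 0 ≤ kern m t s := by
  unfold kern; split_ifs <;> positivity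

/-- Joint measurability in both times and the frequency, as needed for Tonelli's theorem. The
interval integral with moving endpoints is rewritten as an integral over the line of a jointly
measurable truncation. -/
lemma measurable_kern {β : Type*} [MeasurableSpace β] {M : ℝ × β → ℝ} (hM : Measurable M) :
    Measurable fun x : ℝ × ℝ × β => kern (fun r => M (r, x.2.2)) x.1 x.2.1 := by
  have h1 : Measurable fun y : (ℝ × ℝ × β) × ℝ =>
      if y.1.2.1 < y.2 ∧ y.2 ≤ y.1.1 then M (y.2, y.1.2.2) else 0 := by
    refine Measurable.ite ?_ (by fun_prop) measurable_const
    exact (measurableSet_lt (f := fun y : (ℝ × ℝ × β) × ℝ => y.1.2.1) (g := fun y => y.2)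
      (by fun_prop) (by fun_prop)).inter (measurableSet_le
      (f := fun y : (ℝ × ℝ × β) × ℝ => y.2) (g := fun y => y.1.1) (by fun_prop) (by fun_prop))
  have h2 := (h1.stronglyMeasurable.integral_prod_right' (ν := (volume : Measure ℝ))).measurable
  have h3 : Measurable fun x : ℝ × ℝ × β => if x.2.1 < x.1 then
      Real.exp (-∫ r, (if x.2.1 < r ∧ r ≤ x.1 then M (r, x.2.2) else 0)) else 0 :=
    Measurable.ite (measurableSet_lt (by fun_prop) (by fun_prop)) h2.neg.exp measurable_const
  convert h3 using 2 with x
  unfold kern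
  split_ifs with h
  · congr 2
    rw [intervalIntegral.integral_of_le h.le, ← integral_indicator measurableSet_Ioc]
    refine integral_congr_ae (.of_forall fun r => ?_)
    simp only [Set.indicator_apply, Set.mem_Ioc]
  · rfl

/-- The Cauchy–Schwarz inequality for the measure with density `k`, applied to `1` and `g`. -/
lemma lintegral_mul_sq_le {α : Type*} [MeasurableSpace α] {μ : Measure α} {k g : α → ℝ≥0∞}
    (hk : AEMeasurable k μ) (hg : AEMeasurable g μ) :
    (∫⁻ x, k x * g x ∂μ) ^ 2 ≤ (∫⁻ x, k x ∂μ) * ∫⁻ x, k x * g x ^ 2 ∂μ := by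
  have h := ENNReal.lintegral_mul_norm_pow_le (μ := μ) (f := k) (g := fun x => k x * g x ^ 2)
    hk (hk.mul (hg.pow_const 2)) (p := 1 / 2) (q := 1 / 2) (by norm_num) (by norm_num) (by norm_num)
  have e : ∀ x, k x ^ (1 / 2 : ℝ) * (k x * g x ^ 2) ^ (1 / 2 : ℝ) = k x * g x := by
    intro x
    rw [ENNReal.mul_rpow_of_nonneg _ _ (by norm_num), ← mul_assoc,
      ← ENNReal.rpow_add_of_nonneg _ _ (by norm_num) (by norm_num), ← ENNReal.rpow_natCast,
      ← ENNReal.rpow_mul]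
    norm_num
  simp_rw [e] at h
  calc (∫⁻ x, k x * g x ∂μ) ^ 2
      ≤ ((∫⁻ x, k x ∂μ) ^ (1 / 2 : ℝ) * (∫⁻ x, k x * g x ^ 2 ∂μ) ^ (1 / 2 : ℝ)) ^ 2 := by gcongr
    _ = _ := by
      rw [mul_pow, ← ENNReal.rpow_natCast, ← ENNReal.rpow_natCast, ← ENNReal.rpow_mul,
        ← ENNReal.rpow_mul]
      norm_num

/-- Assumptions on the damping `m`, relative to a continuous weight `w`, under which
`v' + m v = g` has maximal regularity with constants depending only on `c` and `κ`. -/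
structure Damping (m w : ℝ → ℝ) (c κ w₀ : ℝ) : Prop where
  c_pos : 0 < c
  κ_pos : 0 < κ
  w₀_pos : 0 < w₀
  measurable : Measurable m
  bdd : ∀ R, ∃ C, ∀ t ∈ Set.Icc (-R) R, |m t| ≤ C
  continuous : Continuous w
  w_ge : ∀ t, w₀ ≤ w t
  m_ge : ∀ t, c * w t ≤ m t
  doubling : ∀ s t, s < t → κ * ((t - s) * w t) ≤ ∫ r in s..t, w r

namespace Damping

variable {m w : ℝ → ℝ} {c κ w₀ : ℝ}

lemma intervalIntegrable (h : Damping m w c κ w₀) (s t : ℝ) : IntervalIntegrable m volume s t := by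
  obtain ⟨C, hC⟩ := h.bdd (max |s| |t|)
  refine (intervalIntegrable_const (c := C)).mono_fun h.measurable.aestronglyMeasurable ?_
  refine (ae_restrict_iff' measurableSet_uIoc).2 (.of_forall fun r hr => ?_)
  have hr' := Set.uIoc_subset_uIcc hr
  change |m r| ≤ |C|
  refine (hC r ?_).trans (le_abs_self C)
  rcases Set.mem_uIcc.1 hr' with h1 | h1
  · exact ⟨(neg_le_neg (le_max_left _ _)).trans ((neg_abs_le s).trans h1.1),
      h1.2.trans ((le_abs_self t).trans (le_max_right _ _))⟩
  · exact ⟨(neg_le_neg (le_max_right _ _)).trans ((neg_abs_le t).trans h1.1),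
      h1.2.trans ((le_abs_self s).trans (le_max_left _ _))⟩

lemma kern_le (h : Damping m w c κ w₀) {s t : ℝ} (hst : s < t) :
    kern m t s ≤ Real.exp (-(c * ∫ r in s..t, w r)) := by
  rw [kern, if_pos hst, ← intervalIntegral.integral_const_mul]
  refine Real.exp_le_exp.2 (neg_le_neg ?_)
  exact intervalIntegral.integral_mono_on hst.le
    ((h.continuous.const_mul c).intervalIntegrable _ _) (h.intervalIntegrable _ _)
    fun r _ => h.m_ge r

/-- Doubling bounds the exponent by `-c κ w(t) (t - s)`, with `w` frozen at the final time. What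
remains is the integral of an exponential over a half-line. -/
lemma lintegral_kern_right (h : Damping m w c κ w₀) (t : ℝ) :
    ∫⁻ s, ENNReal.ofReal (kern m t s) ≤ ENNReal.ofReal (1 / (c * κ * w t)) := by
  have hw : 0 < w t := h.w₀_pos.trans_le (h.w_ge t)
  have hb : 0 < c * κ * w t := by have := h.c_pos; have := h.κ_pos; positivity
  set b := c * κ * w t with hbdef
  have h1 : ∀ s, ENNReal.ofReal (kern m t s) ≤
      (Set.Iic t).indicator (fun s => ENNReal.ofReal (Real.exp (b * s) * Real.exp (-(b * t)))) s := by
    intro s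
    by_cases hst : s < t
    · rw [Set.indicator_of_mem (by exact hst.le), ← Real.exp_add]
      refine ENNReal.ofReal_le_ofReal ((h.kern_le hst).trans (Real.exp_le_exp.2 ?_))
      have := mul_le_mul_of_nonneg_left (h.doubling s t hst) h.c_pos.le
      rw [hbdef]; nlinarith
    · rw [kern, if_neg hst]; simp
  refine (lintegral_mono h1).trans ?_
  rw [lintegral_indicator measurableSet_Iic, ← ofReal_integral_eq_lintegral_ofReal]
  · rw [integral_mul_const, integral_exp_mul_Iic hb]
    refine ENNReal.ofReal_le_ofReal (le_of_eq ?_)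
    rw [div_mul_eq_mul_div, ← Real.exp_add]
    simp
  · exact (integrableOn_exp_mul_Iic hb t).mul_const _
  · exact .of_forall fun s => by positivity

/-- After `m` is replaced by `c w`, the integrand is the exact `t`-derivative of `-exp (-c ∫_s^t w)
/ c`. This runs from `-1/c` to `0`, the limit being `0` because `w` is bounded below by `w₀ > 0`.
Doubling plays no role here. -/
lemma lintegral_kern_left (h : Damping m w c κ w₀) (s : ℝ) :
    ∫⁻ t, ENNReal.ofReal (w t * kern m t s) ≤ ENNReal.ofReal (1 / c) := by
  have hc := h.c_pos
  have hw : ∀ t, 0 < w t := fun t => h.w₀_pos.trans_le (h.w_ge t)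
  set g : ℝ → ℝ := fun t => -(Real.exp (-(c * ∫ r in s..t, w r)) / c) with hg
  have hder : ∀ t, HasDerivAt g (w t * Real.exp (-(c * ∫ r in s..t, w r))) t := by
    intro t
    have h1 := h.continuous.integral_hasStrictDerivAt s t
    have h2 := (((h1.hasDerivAt.const_mul c).neg).exp.div_const c).neg
    refine h2.congr_deriv ?_
    simp only [Pi.neg_apply]
    field_simp
  have hlim : Filter.Tendsto g Filter.atTop (nhds 0) := by
    have h1 : Filter.Tendsto (fun t => c * ∫ r in s..t, w r) Filter.atTop Filter.atTop := by
      refine Filter.Tendsto.const_mul_atTop hc ?_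
      refine Filter.tendsto_atTop_mono' _ ?_
        (Filter.Tendsto.const_mul_atTop h.w₀_pos (Filter.tendsto_atTop_add_const_right _ (-s) Filter.tendsto_id))
      filter_upwards [Filter.eventually_ge_atTop s] with t ht
      have := intervalIntegral.integral_mono_on (μ := volume) (f := fun _ => w₀) (g := w) (a := s) (b := t) ht
        intervalIntegrable_const (h.continuous.intervalIntegrable _ _) fun r _ => h.w_ge r
      rw [intervalIntegral.integral_const, smul_eq_mul] at this
      simp only [id]
      linarith
    have h2 := ((Real.tendsto_exp_neg_atTop_nhds_zero.comp h1).div_const c).neg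
    simpa using h2
  have hnn : ∀ t ∈ Set.Ioi s, 0 ≤ w t * Real.exp (-(c * ∫ r in s..t, w r)) := fun t _ => by
    have := hw t; positivity
  have e1 := integral_Ioi_of_hasDerivAt_of_nonneg (a := s)
    (hder s).continuousAt.continuousWithinAt (fun t _ => hder t) hnn hlim
  have e2 := integrableOn_Ioi_deriv_of_nonneg (a := s)
    (hder s).continuousAt.continuousWithinAt (fun t _ => hder t) hnn hlim
  have h1 : ∀ t, ENNReal.ofReal (w t * kern m t s) ≤
      (Set.Ioi s).indicator
        (fun t => ENNReal.ofReal (w t * Real.exp (-(c * ∫ r in s..t, w r)))) t := by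
    intro t
    by_cases hst : s < t
    · rw [Set.indicator_of_mem (by exact hst)]
      exact ENNReal.ofReal_le_ofReal (mul_le_mul_of_nonneg_left (h.kern_le hst) (hw t).le)
    · rw [kern, if_neg hst]; simp
  refine (lintegral_mono h1).trans ?_
  rw [lintegral_indicator measurableSet_Ioi, ← ofReal_integral_eq_lintegral_ofReal e2
    ((ae_restrict_iff' measurableSet_Ioi).2 (.of_forall hnn)), e1]
  simp [hg]

lemma measurable_kern_uncurry (hm : Measurable m) :
    Measurable fun x : ℝ × ℝ => kern m x.1 x.2 := by
  have := measurable_kern (β := Unit) (M := fun y => m y.1) (hm.comp measurable_fst)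
  exact this.comp (by fun_prop : Measurable fun x : ℝ × ℝ => (x.1, x.2, ()))

/-- Maximal regularity. -/
lemma lintegral_sq_le (h : Damping m w c κ w₀) {G : ℝ → ℝ≥0∞} (hG : Measurable G) :
    ∫⁻ t, (ENNReal.ofReal (w t) * ∫⁻ s, ENNReal.ofReal (kern m t s) * G s) ^ 2
      ≤ ENNReal.ofReal (1 / (c * κ)) * ENNReal.ofReal (1 / c) * ∫⁻ s, G s ^ 2 := by
  have hc := h.c_pos
  have hκ := h.κ_pos
  have hw : ∀ t, 0 < w t := fun t => h.w₀_pos.trans_le (h.w_ge t)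
  have hk := measurable_kern_uncurry h.measurable
  have hkt : ∀ t, Measurable fun s => ENNReal.ofReal (kern m t s) := fun t =>
    (hk.comp measurable_prodMk_left).ennreal_ofReal
  -- Schur's test. Cauchy–Schwarz against the kernel costs its mass `1 / (c κ w(t))`, which cancels
  -- one of the two factors `w(t)`. The other one is kept for the integration in `t`, after the
  -- order of integration is exchanged.
  have step : ∀ t, (ENNReal.ofReal (w t) * ∫⁻ s, ENNReal.ofReal (kern m t s) * G s) ^ 2
      ≤ ENNReal.ofReal (1 / (c * κ)) *
        ∫⁻ s, ENNReal.ofReal (w t * kern m t s) * G s ^ 2 := by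
    intro t
    calc (ENNReal.ofReal (w t) * ∫⁻ s, ENNReal.ofReal (kern m t s) * G s) ^ 2
        = ENNReal.ofReal (w t) ^ 2 * (∫⁻ s, ENNReal.ofReal (kern m t s) * G s) ^ 2 := mul_pow _ _ _
      _ ≤ ENNReal.ofReal (w t) ^ 2 * (ENNReal.ofReal (1 / (c * κ * w t)) *
            ∫⁻ s, ENNReal.ofReal (kern m t s) * G s ^ 2) := by
          gcongr
          refine (lintegral_mul_sq_le (hkt t).aemeasurable hG.aemeasurable).trans ?_
          gcongr
          exact h.lintegral_kern_right t
      _ = ENNReal.ofReal (1 / (c * κ)) * (ENNReal.ofReal (w t) *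
            ∫⁻ s, ENNReal.ofReal (kern m t s) * G s ^ 2) := by
          rw [← mul_assoc, ← mul_assoc]
          congr 1
          rw [← ENNReal.ofReal_pow (hw t).le, ← ENNReal.ofReal_mul (by have := hw t; positivity),
            ← ENNReal.ofReal_mul (by positivity)]
          congr 1
          have := (hw t).ne'
          field_simp
      _ = _ := by
          rw [← lintegral_const_mul (f := fun s => ENNReal.ofReal (kern m t s) * G s ^ 2) _
            ((hkt t).mul (hG.pow_const 2))]
          congr 1
          refine lintegral_congr fun s => ?_
          rw [← mul_assoc, ENNReal.ofReal_mul (hw t).le]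
  refine (lintegral_mono step).trans ?_
  have hmeas : Measurable (Function.uncurry fun t s =>
      ENNReal.ofReal (w t * kern m t s) * G s ^ 2) :=
    ((h.continuous.measurable.comp measurable_fst).mul hk).ennreal_ofReal.mul
      ((hG.comp measurable_snd).pow_const 2)
  rw [lintegral_const_mul (f := fun t => ∫⁻ s, ENNReal.ofReal (w t * kern m t s) * G s ^ 2) _
    hmeas.lintegral_prod_right', mul_assoc,
    lintegral_lintegral_swap hmeas.aemeasurable, ← lintegral_const_mul _ (hG.pow_const 2)]
  gcongr with s
  rw [lintegral_mul_const]
  · gcongr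
    exact h.lintegral_kern_left s
  · exact ((h.continuous.measurable).mul (hk.comp measurable_prodMk_right)).ennreal_ofReal

end Damping

/-- The function `exp (-x)` is `1`-Lipschitz on the half-line `x ≥ 0`. This makes the kernel
Lipschitz wherever `m` is bounded. -/
lemma abs_exp_neg_sub_le {x y : ℝ} (hx : 0 ≤ x) (hy : 0 ≤ y) :
    |Real.exp (-x) - Real.exp (-y)| ≤ |x - y| := by
  wlog h : x ≤ y generalizing x y
  · rw [abs_sub_comm, abs_sub_comm x]
    exact this hy hx (le_of_not_ge h)
  rw [abs_of_nonneg (sub_nonneg.2 (Real.exp_le_exp.2 (neg_le_neg h))), abs_sub_comm,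
    abs_of_nonneg (sub_nonneg.2 h)]
  have h1 : Real.exp (-y) = Real.exp (-x) * Real.exp (-(y - x)) := by
    rw [← Real.exp_add]; ring_nf
  have h2 := Real.add_one_le_exp (-(y - x))
  have h3 : Real.exp (-x) ≤ 1 := Real.exp_le_one_iff.2 (by linarith)
  rw [h1]
  nlinarith [Real.exp_pos (-x), Real.exp_pos (-(y - x))]

namespace Damping

variable {m w : ℝ → ℝ} {c κ w₀ : ℝ}

lemma m_nonneg (h : Damping m w c κ w₀) (t : ℝ) : 0 ≤ m t :=
  (mul_nonneg h.c_pos.le (h.w₀_pos.le.trans (h.w_ge t))).trans (h.m_ge t)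

/-- Since `m` is only measurable and locally bounded, the exponential need not be `C¹`. Absolute
continuity is the regularity that integration by parts requires. -/
lemma absolutelyContinuous_exp (h : Damping m w c κ w₀) {s b : ℝ} (hsb : s ≤ b) :
    AbsolutelyContinuousOnInterval (fun t => Real.exp (-∫ r in s..t, m r)) s b := by
  obtain ⟨C, hC⟩ := h.bdd (max |s| |b|)
  have hC' : ∀ r ∈ Set.Icc s b, |m r| ≤ C := fun r hr => hC r
    ⟨(neg_le_neg (le_max_left _ _)).trans ((neg_abs_le s).trans hr.1),
      hr.2.trans ((le_abs_self b).trans (le_max_right _ _))⟩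
  refine LipschitzOnWith.absolutelyContinuousOnInterval (K := C.toNNReal) ?_
  rw [Set.uIcc_of_le hsb]
  refine LipschitzOnWith.of_dist_le_mul fun x hx y hy => ?_
  have hpos : ∀ t ∈ Set.Icc s b, 0 ≤ ∫ r in s..t, m r := fun t ht =>
    intervalIntegral.integral_nonneg ht.1 fun r _ => h.m_nonneg r
  rw [Real.dist_eq, Real.dist_eq]
  refine (abs_exp_neg_sub_le (hpos x hx) (hpos y hy)).trans ?_
  rw [intervalIntegral.integral_interval_sub_left (h.intervalIntegrable _ _)
    (h.intervalIntegrable _ _)]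
  refine (intervalIntegral.norm_integral_le_of_norm_le_const (f := m) (C := (C.toNNReal : ℝ)) ?_)
  intro r hr
  refine (hC' r ?_).trans (Real.le_coe_toNNReal C)
  have := Set.uIoc_subset_uIcc hr
  rcases Set.mem_uIcc.1 this with h1 | h1
  · exact ⟨hy.1.trans h1.1, h1.2.trans hx.2⟩
  · exact ⟨hx.1.trans h1.1, h1.2.trans hy.2⟩

/-- The kernel inverts the formal adjoint of `v ↦ v' + m v`. -/
lemma integral_adjoint_mul_kern (h : Damping m w c κ w₀) {ψ ψ' : ℝ → ℝ}
    (hψ : ∀ t, HasDerivAt ψ (ψ' t) t) (hψ' : Continuous ψ') {R : ℝ}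
    (hR : ∀ t, R ≤ t → ψ t = 0 ∧ ψ' t = 0) (s : ℝ) :
    ∫ t, (ψ' t - m t * ψ t) * kern m t s = -ψ s := by
  -- Beyond `b` the test function vanishes and before `s` the kernel does, so everything happens on
  -- `(s, b]`. The boundary term vanishes at `b`, and at `s` the exponential equals `1`: this
  -- produces `-ψ s`.
  set b := max R s with hb
  have hsb : s ≤ b := le_max_right _ _
  have hψc : Continuous ψ := continuous_iff_continuousAt.2 fun t => (hψ t).continuousAt
  have hac := h.absolutelyContinuous_exp hsb
  have hloc : LocallyIntegrable m volume := by
    rw [locallyIntegrable_iff]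
    intro k hk
    obtain ⟨B, hB⟩ := hk.isBounded.subset_closedBall 0
    rw [Real.closedBall_eq_Icc] at hB
    rcases le_or_gt (0 - B) (0 + B) with h0 | h0
    · exact (((intervalIntegrable_iff_integrableOn_Icc_of_le h0).1
        (h.intervalIntegrable _ _))).mono_set hB
    · rw [Set.Icc_eq_empty (not_le.2 h0)] at hB
      rw [Set.subset_empty_iff.1 hB]; exact integrableOn_empty
  have hacψ : AbsolutelyContinuousOnInterval ψ s b := by
    refine ContDiffOn.absolutelyContinuousOnInterval (ContDiff.contDiffOn ?_)
    refine contDiff_one_iff_deriv.2 ⟨fun t => (hψ t).differentiableAt, ?_⟩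
    rwa [funext fun t => (hψ t).deriv]
  have ibp := hac.integral_mul_deriv_eq_deriv_mul hacψ
  rw [(hR b (le_max_left _ _)).1] at ibp
  have e1 : ∫ t in s..b, deriv (fun t => Real.exp (-∫ r in s..t, m r)) t * ψ t
      = ∫ t in s..b, -(m t * ψ t * Real.exp (-∫ r in s..t, m r)) := by
    -- By Lebesgue's differentiation theorem, `∫_s^t m` has derivative `m t` for almost every `t`
    -- only.
    refine intervalIntegral.integral_congr_ae ?_
    filter_upwards [_root_.LocallyIntegrable.ae_hasDerivAt_integral hloc] with t ht _
    have : deriv (fun t => Real.exp (-∫ r in s..t, m r)) t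
        = Real.exp (-∫ r in s..t, m r) * -m t := ((ht s).neg.exp).deriv
    rw [this]; ring
  have e2 : ∫ t, (ψ' t - m t * ψ t) * kern m t s
      = ∫ t in s..b, (ψ' t - m t * ψ t) * Real.exp (-∫ r in s..t, m r) := by
    rw [intervalIntegral.integral_of_le hsb, ← integral_indicator measurableSet_Ioc]
    refine integral_congr_ae (.of_forall fun t => ?_)
    simp only [Set.indicator_apply, Set.mem_Ioc, kern]
    by_cases h1 : s < t
    · by_cases h2 : t ≤ b
      · simp [h1, h2]
      · have := hR t ((le_max_left _ _).trans (not_le.1 h2).le)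
        simp [this.1, this.2]
    · simp [h1]
  have hcont : ContinuousOn (fun t => Real.exp (-∫ r in s..t, m r)) (Set.uIcc s b) :=
    hac.continuousOn
  have i1 : IntervalIntegrable (fun t => Real.exp (-∫ r in s..t, m r) * ψ' t) volume s b :=
    (hcont.mul hψ'.continuousOn).intervalIntegrable
  have i2 : IntervalIntegrable (fun t => m t * ψ t * Real.exp (-∫ r in s..t, m r)) volume s b :=
    ((h.intervalIntegrable s b).mul_continuousOn hψc.continuousOn).mul_continuousOn hcont
  rw [e2]
  have e3 : ∀ t, (ψ' t - m t * ψ t) * Real.exp (-∫ r in s..t, m r)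
      = Real.exp (-∫ r in s..t, m r) * ψ' t - m t * ψ t * Real.exp (-∫ r in s..t, m r) := by
    intro t; ring
  simp_rw [e3]
  rw [intervalIntegral.integral_sub i1 i2]
  simp_rw [(hψ _).deriv] at ibp
  rw [ibp, e1, intervalIntegral.integral_neg]
  simp

/-- The solution `∫_{s<t} exp (-∫_s^t m) G(s) ds` of `v' + m v = G`. -/
def sol (m : ℝ → ℝ) (G : ℝ → ℂ) (t : ℝ) : ℂ := ∫ s, (kern m t s : ℂ) * G s

lemma lintegral_sol_sq_le (h : Damping m w c κ w₀) {G : ℝ → ℂ} (hG : Measurable G) :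
    ∫⁻ t, ‖(w t : ℂ) * sol m G t‖ₑ ^ 2
      ≤ ENNReal.ofReal (1 / (c * κ)) * ENNReal.ofReal (1 / c) * ∫⁻ s, ‖G s‖ₑ ^ 2 := by
  refine le_trans (lintegral_mono fun t => ?_) (h.lintegral_sq_le hG.enorm)
  have hw : 0 ≤ w t := (h.w₀_pos.le).trans (h.w_ge t)
  rw [enorm_mul]
  gcongr
  · rw [← ofReal_norm, Complex.norm_real, Real.norm_of_nonneg hw]
  · refine (enorm_integral_le_lintegral_enorm _).trans (le_of_eq (lintegral_congr fun s => ?_))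
    rw [enorm_mul, ← ofReal_norm, Complex.norm_real,
      Real.norm_of_nonneg (kern_nonneg _ _ _)]

/-- This justifies Fubini's theorem below. The integral of `|θ| I`, where `I(t) = ∫ kern |G| ds`, is
bounded by those of `|θ|²` and `I²`, and `I` is square integrable because `w₀ I ≤ w I` and maximal
regularity applies. -/
lemma integrable_mul_kern_mul (h : Damping m w c κ w₀) {G : ℝ → ℂ} (hG : Measurable G)
    (hG2 : MemLp G 2 volume) {θ : ℝ → ℂ} (hθ : Measurable θ) (hθ2 : MemLp θ 2 volume) :
    Integrable (Function.uncurry fun t s => θ t * ((kern m t s : ℂ) * G s))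
      (volume.prod volume) := by
  have hk := measurable_kern_uncurry h.measurable
  have hmeas : Measurable (Function.uncurry fun t s => θ t * ((kern m t s : ℂ) * G s)) :=
    (hθ.comp measurable_fst).mul ((Complex.measurable_ofReal.comp hk).mul (hG.comp measurable_snd))
  refine ⟨hmeas.aestronglyMeasurable, ?_⟩
  rw [hasFiniteIntegral_iff_enorm, lintegral_prod _ hmeas.enorm.aemeasurable]
  have e : ∀ t, ∫⁻ s, ‖Function.uncurry (fun t s => θ t * ((kern m t s : ℂ) * G s)) (t, s)‖ₑ
      = ‖θ t‖ₑ * ∫⁻ s, ENNReal.ofReal (kern m t s) * ‖G s‖ₑ := by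
    intro t
    rw [← lintegral_const_mul']
    · refine lintegral_congr fun s => ?_
      rw [Function.uncurry_apply_pair, enorm_mul, enorm_mul, ← ofReal_norm (kern m t s : ℂ),
        Complex.norm_real, Real.norm_of_nonneg (kern_nonneg _ _ _)]
    · exact enorm_ne_top
  simp_rw [e]
  set I : ℝ → ℝ≥0∞ := fun t => ∫⁻ s, ENNReal.ofReal (kern m t s) * ‖G s‖ₑ with hI
  have hkG : Measurable fun x : ℝ × ℝ => ENNReal.ofReal (kern m x.1 x.2) * ‖G x.2‖ₑ :=
    hk.ennreal_ofReal.mul (hG.comp measurable_snd).enorm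
  have hIm : Measurable I := hkG.lintegral_prod_right'
  have hle : ∀ t, ‖θ t‖ₑ * I t ≤ ‖θ t‖ₑ ^ 2 + I t ^ 2 := by
    intro t
    rcases le_total ‖θ t‖ₑ (I t) with h1 | h1
    · exact (mul_le_mul_left h1 _).trans (by rw [← sq]; exact le_add_self)
    · exact (mul_le_mul_right h1 _).trans (by rw [← sq]; exact le_self_add)
  refine (lintegral_mono hle).trans_lt ?_
  rw [lintegral_add_left (hθ.enorm.pow_const 2)]
  refine ENNReal.add_lt_top.2 ⟨lintegral_sq_lt_top hθ2, ?_⟩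
  have h1 : ENNReal.ofReal w₀ ^ 2 * ∫⁻ t, I t ^ 2 < ⊤ := by
    rw [← lintegral_const_mul _ (hIm.pow_const 2)]
    refine lt_of_le_of_lt (lintegral_mono fun t => ?_)
      ((h.lintegral_sq_le hG.enorm).trans_lt (ENNReal.mul_lt_top
        (ENNReal.mul_lt_top ENNReal.ofReal_lt_top ENNReal.ofReal_lt_top)
        (lintegral_sq_lt_top hG2)))
    rw [← mul_pow]
    gcongr
    exact h.w_ge t
  have h2 : ENNReal.ofReal w₀ ^ 2 ≠ 0 := by
    simp [h.w₀_pos]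
  by_contra hcon
  rw [not_lt, top_le_iff] at hcon
  rw [hcon, ENNReal.mul_top h2] at h1
  exact lt_irrefl _ h1

/-- `sol m G` is a weak solution of `v' + m v = G`. -/
lemma integral_adjoint_mul_sol (h : Damping m w c κ w₀) {G : ℝ → ℂ} (hG : Measurable G)
    (hG2 : MemLp G 2 volume) {ψ ψ' : ℝ → ℂ} (hψ : ∀ t, HasDerivAt ψ (ψ' t) t)
    (hψ' : Continuous ψ') {R : ℝ} (hR : ∀ t, R ≤ |t| → ψ t = 0 ∧ ψ' t = 0) :
    ∫ t, (ψ' t - m t * ψ t) * sol m G t = -∫ t, ψ t * G t := by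
  have hψc : Continuous ψ := continuous_iff_continuousAt.2 fun t => (hψ t).continuousAt
  set θ : ℝ → ℂ := fun t => ψ' t - m t * ψ t with hθdef
  have hθ : Measurable θ :=
    hψ'.measurable.sub ((Complex.measurable_ofReal.comp h.measurable).mul hψc.measurable)
  have hsupp : ∀ f : ℝ → ℂ, (∀ t, R ≤ |t| → f t = 0) → HasCompactSupport f := by
    intro f hf
    refine HasCompactSupport.intro (isCompact_Icc (a := -R) (b := R)) fun t ht => hf t ?_
    by_contra hlt
    exact ht ⟨(abs_lt.1 (not_le.1 hlt)).1.le, (abs_lt.1 (not_le.1 hlt)).2.le⟩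
  obtain ⟨C1, hC1⟩ := (hsupp ψ fun t ht => (hR t ht).1).exists_bound_of_continuous hψc
  obtain ⟨C2, hC2⟩ := (hsupp ψ' fun t ht => (hR t ht).2).exists_bound_of_continuous hψ'
  obtain ⟨C3, hC3⟩ := h.bdd R
  have hθp : ∀ p : ℝ≥0∞, MemLp θ p volume := by
    intro p
    have hind : θ = (Set.Icc (-R) R).indicator θ := by
      ext t
      by_cases ht : t ∈ Set.Icc (-R) R
      · rw [Set.indicator_of_mem ht]
      · rw [Set.indicator_of_notMem ht]
        have : R ≤ |t| := by
          by_contra hlt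
          exact ht ⟨(abs_lt.1 (not_le.1 hlt)).1.le, (abs_lt.1 (not_le.1 hlt)).2.le⟩
        simp [hθdef, hR t this]
    rw [hind, memLp_indicator_iff_restrict measurableSet_Icc]
    refine MemLp.of_bound hθ.aestronglyMeasurable (C2 + C3 * C1) ?_
    refine (ae_restrict_iff' measurableSet_Icc).2 (.of_forall fun t ht => ?_)
    refine (norm_sub_le _ _).trans (add_le_add (hC2 t) ?_)
    rw [norm_mul, Complex.norm_real]
    exact mul_le_mul (hC3 t ht) (hC1 t) (norm_nonneg _) ((abs_nonneg _).trans (hC3 t ht))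
  have hint := h.integrable_mul_kern_mul hG hG2 hθ (hθp 2)
  have e1 : ∫ t, θ t * sol m G t = ∫ s, ∫ t, θ t * ((kern m t s : ℂ) * G s) := by
    rw [← integral_integral_swap hint]
    refine integral_congr_ae (.of_forall fun t => ?_)
    simp only [sol, ← integral_const_mul]
  -- The kernel identity is real, so it is applied to the real and imaginary parts of the test
  -- function.
  have hkerC : ∀ s, ∫ t, θ t * (kern m t s : ℂ) = -ψ s := by
    intro s
    have hre := h.integral_adjoint_mul_kern (ψ := fun t => (ψ t).re) (ψ' := fun t => (ψ' t).re)
      (fun t => Complex.reCLM.hasFDerivAt.comp_hasDerivAt t (hψ t))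
      (Complex.continuous_re.comp hψ') (R := |R|)
      (fun t ht => by
        have := hR t ((le_abs_self R).trans (ht.trans (le_abs_self t)))
        simp [this.1, this.2]) s
    have him := h.integral_adjoint_mul_kern (ψ := fun t => (ψ t).im) (ψ' := fun t => (ψ' t).im)
      (fun t => Complex.imCLM.hasFDerivAt.comp_hasDerivAt t (hψ t))
      (Complex.continuous_im.comp hψ') (R := |R|)
      (fun t ht => by
        have := hR t ((le_abs_self R).trans (ht.trans (le_abs_self t)))
        simp [this.1, this.2]) s
    have hks : Measurable fun t => (kern m t s : ℂ) := Complex.measurable_ofReal.comp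
      ((measurable_kern_uncurry h.measurable).comp measurable_prodMk_right)
    have hi : Integrable fun t => θ t * (kern m t s : ℂ) := by
      have hθ1 : Integrable θ := memLp_one_iff_integrable.1 (hθp 1)
      refine hθ1.mul_bdd (c := 1) hks.aestronglyMeasurable (.of_forall fun t => ?_)
      rw [Complex.norm_real, Real.norm_of_nonneg (kern_nonneg _ _ _), kern]
      split_ifs with hst
      · refine Real.exp_le_one_iff.2 (neg_nonpos.2 ?_)
        exact intervalIntegral.integral_nonneg hst.le fun r _ => h.m_nonneg r
      · exact zero_le_one
    refine Complex.ext ?_ ?_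
    · refine (integral_re hi).symm.trans (Eq.trans ?_ hre)
      refine integral_congr_ae (.of_forall fun t => ?_)
      simp [hθdef]
    · refine (integral_im hi).symm.trans (Eq.trans ?_ him)
      refine integral_congr_ae (.of_forall fun t => ?_)
      simp [hθdef]
  rw [e1, ← integral_neg]
  refine integral_congr_ae (.of_forall fun s => ?_)
  simp only [← mul_assoc]
  rw [integral_mul_const, hkerC]
  ring

end Damping

/-! ### The equation on the Fourier side. -/

/-- The symbol of `∂_{x_i}`, up to the factor `2πi`, in the moving coordinates. -/
def symb {d : ℕ} (i : Fin d) (X : Pt d) : ℝ := dot X.2 (lagVec X.1 i)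

lemma symb_eq {d : ℕ} (i : Fin d) (X : Pt d) :
    symb i X = X.2.1 i + X.1 * X.2.2.1 i + X.1 ^ 2 / 2 * X.2.2.2 i := by
  simp [symb, dot, lagVec, inner_smul_right, EuclideanSpace.inner_single_right, add_assoc]

lemma continuous_symb {d : ℕ} (i : Fin d) : Continuous (symb (d := d) i) := by
  have : symb (d := d) i = fun X => X.2.1 i + X.1 * X.2.2.1 i + X.1 ^ 2 / 2 * X.2.2.2 i :=
    funext (symb_eq i)
  rw [this]; fun_prop

/-- The weight `lam + |P|²`. -/
def wt {d : ℕ} (lam : ℝ) (X : Pt d) : ℝ := lam + ∑ i, symb i X ^ 2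

lemma continuous_wt {d : ℕ} (lam : ℝ) : Continuous (wt (d := d) lam) := by
  have := continuous_symb (d := d)
  unfold wt; fun_prop

/-- The symbol of `lam - a^{ij} ∂_{x_i x_j}`. -/
def damp {d : ℕ} (a : Fin d → Fin d → ℝ → ℝ) (lam : ℝ) (X : Pt d) : ℝ :=
  4 * Real.pi ^ 2 * (∑ i, ∑ j, a i j X.1 * symb i X * symb j X) + lam

lemma measurable_damp {d : ℕ} {δ : ℝ} {a : Fin d → Fin d → ℝ → ℝ} (ha : IsElliptic δ a) (lam : ℝ) :
    Measurable (damp a lam) := by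
  have h1 := fun i : Fin d => (continuous_symb i).measurable
  have h2 := ha.measurable
  have h3 : ∀ i j, Measurable fun X : Pt d => a i j X.1 := fun i j => (h2 i j).comp measurable_fst
  unfold damp
  refine ((Finset.measurable_sum _ fun i _ => Finset.measurable_sum _ fun j _ =>
    ((h3 i j).mul (h1 i)).mul (h1 j)).const_mul _).add_const _

/-- The second-order part loses nothing because `4π² ≥ 1`, and `lam` absorbs `δ lam` because `δ <
1`. -/
lemma damp_lower {d : ℕ} {δ : ℝ} (hδ : 0 < δ) (hδ1 : δ < 1) {a : Fin d → Fin d → ℝ → ℝ}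
    (ha : IsElliptic δ a) {lam : ℝ} (hlam : 0 < lam) (X : Pt d) :
    δ * wt lam X ≤ damp a lam X := by
  have h := ha.lower X.1 (WithLp.toLp 2 fun i => symb i X)
  simp only [EuclideanSpace.norm_sq_eq, Real.norm_eq_abs, sq_abs] at h
  unfold wt damp
  have hπ : 1 ≤ 4 * Real.pi ^ 2 := by nlinarith [Real.pi_gt_three]
  have hs : 0 ≤ ∑ i, symb i X ^ 2 := Finset.sum_nonneg fun i _ => sq_nonneg _
  have h0 := mul_nonneg hδ.le hs
  nlinarith [mul_le_mul_of_nonneg_left h (by linarith : (0 : ℝ) ≤ 4 * Real.pi ^ 2)]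

lemma damp_upper {d : ℕ} {δ : ℝ} (hδ : 0 < δ) {a : Fin d → Fin d → ℝ → ℝ}
    (ha : IsElliptic δ a) {lam : ℝ} (hlam : 0 < lam) (X : Pt d) :
    damp a lam X ≤ (4 * Real.pi ^ 2 * δ⁻¹ + 1) * wt lam X := by
  have h := ha.upper X.1 (WithLp.toLp 2 fun i => symb i X)
  simp only [EuclideanSpace.norm_sq_eq, Real.norm_eq_abs, sq_abs] at h
  unfold wt damp
  have hs : 0 ≤ ∑ i, symb i X ^ 2 := Finset.sum_nonneg fun i _ => sq_nonneg _
  have h1 : 0 ≤ 4 * Real.pi ^ 2 * δ⁻¹ * lam := by positivity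
  nlinarith [mul_le_mul_of_nonneg_left h (by positivity : (0 : ℝ) ≤ 4 * Real.pi ^ 2)]

lemma le_wt {d : ℕ} {lam : ℝ} (X : Pt d) : lam ≤ wt lam X :=
  le_add_of_nonneg_right (Finset.sum_nonneg fun _ _ => sq_nonneg _)

lemma sq_symb_le_wt {d : ℕ} {lam : ℝ} (i : Fin d) (X : Pt d) :
    lam + symb i X ^ 2 ≤ wt lam X :=
  add_le_add_right (Finset.single_le_sum (f := fun i => symb i X ^ 2)
    (fun _ _ => sq_nonneg _) (Finset.mem_univ i)) _

/-- For each frequency the symbols are quadratic polynomials in time, so the doubling constant is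
`1/9` for each of their squares and for the constant `lam`. None of the constants `δ`, `1/9`, `lam`
depends on `p`, which makes the estimates integrable over all frequencies. -/
lemma damping {d : ℕ} {δ : ℝ} (hδ : 0 < δ) (hδ1 : δ < 1) {a : Fin d → Fin d → ℝ → ℝ}
    (ha : IsElliptic δ a) {lam : ℝ} (hlam : 0 < lam) (p : Sp d) :
    Damping (fun t => damp a lam (t, p)) (fun t => wt lam (t, p)) δ (1 / 9) lam where
  c_pos := hδ
  κ_pos := by norm_num
  w₀_pos := hlam
  measurable := (measurable_damp ha lam).comp measurable_prodMk_right
  bdd R := by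
    have hc : Continuous fun t => (4 * Real.pi ^ 2 * δ⁻¹ + 1) * wt lam (t, p) :=
      continuous_const.mul ((continuous_wt lam).comp (by fun_prop))
    obtain ⟨C, hC⟩ := isCompact_Icc.exists_bound_of_continuousOn (s := Set.Icc (-R) R) hc.continuousOn
    refine ⟨C, fun t ht => ?_⟩
    have h0 : 0 ≤ damp a lam (t, p) :=
      (mul_nonneg hδ.le (hlam.le.trans (le_wt _))).trans (damp_lower hδ hδ1 ha hlam _)
    rw [abs_of_nonneg h0]
    exact (damp_upper hδ ha hlam _).trans ((le_abs_self _).trans (hC t ht))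
  continuous := (continuous_wt lam).comp (by fun_prop)
  w_ge t := le_wt _
  m_ge t := damp_lower hδ hδ1 ha hlam _
  doubling s t hst := by
    have hi : ∀ i : Fin d, Continuous fun r => symb i (r, p) ^ 2 := fun i =>
      ((continuous_symb i).comp (by fun_prop)).pow 2
    have e : ∫ r in s..t, wt lam (r, p) = (t - s) * lam + ∑ i, ∫ r in s..t, symb i (r, p) ^ 2 := by
      unfold wt
      rw [intervalIntegral.integral_add intervalIntegrable_const
        ((continuous_finsetSum _ fun i _ => hi i).intervalIntegrable _ _),
        intervalIntegral.integral_finsetSum fun i _ => (hi i).intervalIntegrable _ _]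
      simp
    rw [e]
    have h1 : ∀ i : Fin d, (t - s) * symb i (t, p) ^ 2 / 9 ≤ ∫ r in s..t, symb i (r, p) ^ 2 := by
      intro i
      have := sq_quadratic_le_integral (A := p.1 i) (B := p.2.1 i) (C := p.2.2 i) hst
      simpa only [symb_eq] using this
    have h2 := Finset.sum_le_sum fun (i : Fin d) (_ : i ∈ Finset.univ) => h1 i
    rw [← Finset.sum_div, ← Finset.mul_sum] at h2
    unfold wt
    have : 0 < (t - s) * lam := mul_pos (sub_pos.2 hst) hlam
    nlinarith

/-- The Fourier transform of the solution with right-hand side `G`. -/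
def solF {d : ℕ} (a : Fin d → Fin d → ℝ → ℝ) (lam : ℝ) (G : Pt d → ℂ) (X : Pt d) : ℂ :=
  Damping.sol (fun t => damp a lam (t, X.2)) (fun t => G (t, X.2)) X.1

lemma measurable_integral_kern {β : Type*} [MeasurableSpace β] {M : ℝ × β → ℝ} (hM : Measurable M)
    {G : ℝ × β → ℂ} (hG : Measurable G) :
    Measurable fun X : ℝ × β => Damping.sol (fun t => M (t, X.2)) (fun t => G (t, X.2)) X.1 := by
  have h1 : Measurable fun y : (ℝ × β) × ℝ => (y.1.1, y.2, y.1.2) := by fun_prop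
  have h2 : Measurable fun y : (ℝ × β) × ℝ => (y.2, y.1.2) := by fun_prop
  have h3 : Measurable fun y : (ℝ × β) × ℝ =>
      (kern (fun r => M (r, y.1.2)) y.1.1 y.2 : ℂ) * G (y.2, y.1.2) :=
    (Complex.measurable_ofReal.comp ((measurable_kern hM).comp h1)).mul (hG.comp h2)
  exact (h3.stronglyMeasurable.integral_prod_right' (ν := (volume : Measure ℝ))).measurable

lemma measurable_solF {d : ℕ} {δ : ℝ} {a : Fin d → Fin d → ℝ → ℝ} (ha : IsElliptic δ a)
    (lam : ℝ) {G : Pt d → ℂ} (hG : Measurable G) : Measurable (solF a lam G) :=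
  measurable_integral_kern (measurable_damp ha lam) hG

/-- Maximal regularity holds at each frequency with the same constant, so Tonelli's theorem sums it
over frequencies. -/
lemma memLp_mul_sol {β : Type*} [MeasurableSpace β] {ν : Measure β} [SFinite ν] {M W : ℝ × β → ℝ}
    {c κ w₀ : ℝ} (hM : Measurable M) (hW : Measurable W)
    (h : ∀ p, Damping (fun t => M (t, p)) (fun t => W (t, p)) c κ w₀) {G : ℝ × β → ℂ}
    (hG : Measurable G) (hG2 : MemLp G 2 ((volume : Measure ℝ).prod ν)) :
    MemLp (fun X => (W X : ℂ) * Damping.sol (fun t => M (t, X.2)) (fun t => G (t, X.2)) X.1) 2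
      ((volume : Measure ℝ).prod ν) := by
  have hm : Measurable fun X : ℝ × β =>
      (W X : ℂ) * Damping.sol (fun t => M (t, X.2)) (fun t => G (t, X.2)) X.1 :=
    (Complex.measurable_ofReal.comp hW).mul (measurable_integral_kern hM hG)
  refine memLp_two_of_lintegral hm.aestronglyMeasurable ?_
  have h2 := lintegral_sq_lt_top hG2
  rw [lintegral_prod_symm _ (hG.enorm.pow_const 2).aemeasurable] at h2
  rw [lintegral_prod_symm _ (hm.enorm.pow_const 2).aemeasurable]
  refine (lintegral_mono fun p =>
    (h p).lintegral_sol_sq_le (hG.comp measurable_prodMk_right)).trans_lt ?_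
  rw [lintegral_const_mul' _ _ (ENNReal.mul_lt_top ENNReal.ofReal_lt_top ENNReal.ofReal_lt_top).ne]
  exact ENNReal.mul_lt_top (ENNReal.mul_lt_top ENNReal.ofReal_lt_top ENNReal.ofReal_lt_top) h2

/-- Maximal regularity on the Fourier side. -/
lemma memLp_wt_mul_solF {d : ℕ} {δ : ℝ} (hδ : 0 < δ) (hδ1 : δ < 1) {a : Fin d → Fin d → ℝ → ℝ}
    (ha : IsElliptic δ a) {lam : ℝ} (hlam : 0 < lam) {G : Pt d → ℂ} (hG : Measurable G)
    (hG2 : MemLp G 2 volume) : MemLp (fun X => (wt lam X : ℂ) * solF a lam G X) 2 volume :=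
  memLp_mul_sol (measurable_damp ha lam) (continuous_wt lam).measurable
    (damping hδ hδ1 ha hlam) hG hG2

/-- All multipliers that occur below (`1`, `2πi P_i`, `-4π² P_i P_j` and `damp`) are dominated by
the weight. -/
lemma memLp_mul_solF {d : ℕ} {δ : ℝ} (hδ : 0 < δ) (hδ1 : δ < 1) {a : Fin d → Fin d → ℝ → ℝ}
    (ha : IsElliptic δ a) {lam : ℝ} (hlam : 0 < lam) {G : Pt d → ℂ} (hG : Measurable G)
    (hG2 : MemLp G 2 volume) {b : Pt d → ℂ} (hb : Measurable b) {C : ℝ}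
    (hbC : ∀ X, ‖b X‖ ≤ C * wt lam X) : MemLp (fun X => b X * solF a lam G X) 2 volume := by
  refine (memLp_wt_mul_solF hδ hδ1 ha hlam hG hG2).of_le_mul (c := C)
    (hb.mul (measurable_solF ha lam hG)).aestronglyMeasurable (.of_forall fun X => ?_)
  rw [norm_mul, norm_mul, Complex.norm_real, Real.norm_of_nonneg (hlam.le.trans (le_wt X)),
    ← mul_assoc]
  exact mul_le_mul_of_nonneg_right (hbC X) (norm_nonneg _)

lemma contDiff_lagVec {d : ℕ} (i : Fin d) : ContDiff ℝ ∞ fun t : ℝ => lagVec t i := by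
  unfold lagVec; fun_prop

lemma contDiff_lagDx {d : ℕ} (i : Fin d) {ψ : Pt d → ℝ} (hψ : ContDiff ℝ ∞ ψ) :
    ContDiff ℝ ∞ (lagDx i ψ) := by
  have h1 : ContDiff ℝ ∞ (fderiv ℝ ψ) := hψ.fderiv_right (by simp)
  have h2 : ContDiff ℝ ∞ fun X : Pt d => ((0 : ℝ), lagVec X.1 i) :=
    contDiff_const.prodMk ((contDiff_lagVec i).comp contDiff_fst)
  exact h1.clm_apply h2

lemma contDiff_lagDt {d : ℕ} {ψ : Pt d → ℝ} (hψ : ContDiff ℝ ∞ ψ) :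
    ContDiff ℝ ∞ (lagDt ψ) :=
  (hψ.fderiv_right (by simp)).clm_apply contDiff_const

lemma tsupport_lagDx_subset {d : ℕ} (i : Fin d) (ψ : Pt d → ℝ) :
    tsupport (lagDx i ψ) ⊆ tsupport ψ := by
  refine (closure_mono fun X hX => ?_).trans (tsupport_fderiv_subset ℝ (f := ψ))
  rw [Function.mem_support] at hX ⊢
  intro h
  exact hX (by rw [lagDx, h]; rfl)

lemma tsupport_lagDt_subset {d : ℕ} (ψ : Pt d → ℝ) :
    tsupport (lagDt ψ) ⊆ tsupport ψ := by
  refine (closure_mono fun X hX => ?_).trans (tsupport_fderiv_subset ℝ (f := ψ))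
  rw [Function.mem_support] at hX ⊢
  intro h
  exact hX (by rw [lagDt, h]; rfl)

/-- Complexification of a real function. -/
def cplx {α : Type*} (ψ : α → ℝ) (X : α) : ℂ := ψ X

lemma memLp_cplx_of_test {d : ℕ} {ψ : Pt d → ℝ} (hψ : Continuous ψ) (hc : HasCompactSupport ψ)
    (p : ℝ≥0∞) : MemLp (cplx ψ) p volume :=
  (Complex.continuous_ofReal.comp hψ).memLp_of_hasCompactSupport (hc.comp_left Complex.ofReal_zero)

/-- At a fixed time `lagVec t i` is a constant vector, so this is integration by parts against the
character. The frequency is paired with a direction that depends on time, which is why the symbol is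
a polynomial in `t`. -/
lemma pF_cplx_lagDx {d : ℕ} (i : Fin d) {ψ : Pt d → ℝ} (hψ : ContDiff ℝ ∞ ψ)
    (hc : HasCompactSupport ψ) (X : Pt d) :
    pF (cplx (lagDx i ψ)) X = 2 * Real.pi * Complex.I * symb i X * pF (cplx ψ) X := by
  obtain ⟨t, p⟩ := X
  have hsl : ContDiff ℝ ∞ fun q : Sp d => (ψ (t, q) : ℂ) :=
    Complex.ofRealCLM.contDiff.comp (hψ.comp (contDiff_const.prodMk contDiff_id))
  have hslc : HasCompactSupport fun q : Sp d => (ψ (t, q) : ℂ) := by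
    have hcK : IsCompact (Prod.snd '' tsupport ψ) := hc.isCompact.image continuous_snd
    refine HasCompactSupport.intro hcK fun q hq => ?_
    have : (t, q) ∉ tsupport ψ := fun h => hq ⟨_, h, rfl⟩
    simp [image_eq_zero_of_notMem_tsupport this]
  have hder : ∀ q : Sp d, fderiv ℝ (fun q : Sp d => (ψ (t, q) : ℂ)) q (lagVec t i)
      = (lagDx i ψ (t, q) : ℂ) := by
    intro q
    have h1 : HasFDerivAt (fun q : Sp d => (t, q)) (ContinuousLinearMap.inr ℝ ℝ (Sp d)) q :=
      hasFDerivAt_prodMk_right t q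
    have h2 := Complex.ofRealCLM.hasFDerivAt.comp q
      (((hψ.differentiable (by simp)) (t, q)).hasFDerivAt.comp q h1)
    exact (congrArg (fun F => F (lagVec t i)) h2.fderiv)
  have hchr : ∀ q : Sp d, HasFDerivAt (fun q => chr p q) ((chr p q * (-2 * Real.pi * Complex.I)) •
      (Complex.ofRealCLM.comp ((innerSL ℝ p.1).comp (.fst ℝ _ _) +
        ((innerSL ℝ p.2.1).comp ((ContinuousLinearMap.fst ℝ _ _).comp (.snd ℝ _ _)) +
          (innerSL ℝ p.2.2).comp ((ContinuousLinearMap.snd ℝ _ _).comp (.snd ℝ _ _)))))) q := by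
    intro q
    set ℓ : Sp d →L[ℝ] ℝ := ((innerSL ℝ p.1).comp (.fst ℝ _ _) +
        ((innerSL ℝ p.2.1).comp ((ContinuousLinearMap.fst ℝ _ _).comp (.snd ℝ _ _)) +
          (innerSL ℝ p.2.2).comp ((ContinuousLinearMap.snd ℝ _ _).comp (.snd ℝ _ _)))) with hℓ
    have h1 : HasFDerivAt (fun q : Sp d => dot p q) ℓ q := ℓ.hasFDerivAt
    have h2 := (Complex.ofRealCLM.hasFDerivAt.comp q h1).const_mul (-2 * Real.pi * Complex.I)
    have h3 := h2.cexp
    have e : (fun q : Sp d => chr p q) = fun q : Sp d =>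
        Complex.exp (-2 * Real.pi * Complex.I * (Complex.ofRealCLM ∘ fun q => dot p q) q) := by
      ext q
      simp only [chr, Function.comp_apply, Complex.ofRealCLM_apply]
      congr 1
      push_cast
      ring
    have e' := congrFun e q
    rw [e]
    refine h3.congr_fderiv ?_
    rw [← e', smul_smul]
  have hchrv : ∀ q : Sp d, fderiv ℝ (fun q => chr p q) q (lagVec t i)
      = -(2 * Real.pi * Complex.I * symb i (t, p)) * chr p q := by
    intro q
    rw [(hchr q).fderiv]
    simp only [smul_apply, ContinuousLinearMap.comp_apply,
      Complex.ofRealCLM_apply, smul_eq_mul, symb, dot, add_apply,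
      innerSL_apply_apply, ContinuousLinearMap.coe_fst', ContinuousLinearMap.coe_snd']
    push_cast
    ring
  have hchrc : Continuous fun q : Sp d => chr p q :=
    continuous_iff_continuousAt.2 fun q => (hchr q).continuousAt
  have ibp := integral_mul_fderiv_eq_neg_fderiv_mul_of_integrable (μ := (volume : Measure (Sp d)))
    (f := fun q => chr p q) (g := fun q => (ψ (t, q) : ℂ)) (v := lagVec t i)
    (by
      simp_rw [hchrv]
      exact (((continuous_const.mul hchrc).mul hsl.continuous)).integrable_of_hasCompactSupport
        hslc.mul_left)
    (by
      refine (hchrc.mul ?_).integrable_of_hasCompactSupport (HasCompactSupport.mul_left ?_)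
      · exact (hsl.continuous_fderiv (by simp)).clm_apply continuous_const
      · exact hslc.fderiv_apply ℝ _)
    (by exact (hchrc.mul hsl.continuous).integrable_of_hasCompactSupport hslc.mul_left)
    (fun q _ => (hchr q).differentiableAt) (fun q _ => hsl.differentiable (by simp) q)
  simp_rw [hder, hchrv] at ibp
  refine ibp.trans ?_
  rw [← integral_neg]
  simp only [pF, cplx, ← integral_const_mul]
  refine integral_congr_ae (.of_forall fun q => ?_)
  simp only
  ring

/-- Differentiation under the integral sign. The derivative is dominated, uniformly in time, by a
constant on the compact projection of the support to the space variables. -/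
lemma hasDerivAt_pF {d : ℕ} {ψ : Pt d → ℝ} (hψ : ContDiff ℝ ∞ ψ) (hc : HasCompactSupport ψ)
    (p : Sp d) (t : ℝ) :
    HasDerivAt (fun t => pF (cplx ψ) (t, p)) (pF (cplx (lagDt ψ)) (t, p)) t := by
  have hcK : IsCompact (Prod.snd '' tsupport ψ) := hc.isCompact.image continuous_snd
  have hDc : HasCompactSupport (lagDt ψ) :=
    hc.of_isClosed_subset (isClosed_tsupport _) (tsupport_lagDt_subset ψ)
  obtain ⟨C, hC⟩ := hDc.exists_bound_of_continuous (contDiff_lagDt hψ).continuous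
  have hchrc : Continuous fun q : Sp d => chr p q :=
    continuous_chr_comp continuous_const continuous_id
  have hcont : ∀ {φ : Pt d → ℝ}, Continuous φ → ∀ t, Continuous fun q : Sp d =>
      chr p q * cplx φ (t, q) := fun hφ t =>
    hchrc.mul (Complex.continuous_ofReal.comp (hφ.comp (by fun_prop)))
  refine (hasDerivAt_integral_of_dominated_loc_of_deriv_le (μ := (volume : Measure (Sp d)))
    (F := fun t q => chr p q * cplx ψ (t, q)) (F' := fun t q => chr p q * cplx (lagDt ψ) (t, q))
    (s := Set.univ) (bound := (Prod.snd '' tsupport ψ).indicator fun _ => C)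
    Filter.univ_mem ?_ ?_ ?_ ?_ ?_ ?_).2
  · exact .of_forall fun t => (hcont hψ.continuous t).aestronglyMeasurable
  · refine (hcont hψ.continuous t).integrable_of_hasCompactSupport ?_
    refine HasCompactSupport.intro hcK fun q hq => ?_
    have : (t, q) ∉ tsupport ψ := fun h => hq ⟨_, h, rfl⟩
    simp [cplx, image_eq_zero_of_notMem_tsupport this]
  · exact (hcont (contDiff_lagDt hψ).continuous t).aestronglyMeasurable
  · refine .of_forall fun q t _ => ?_
    rw [norm_mul, norm_chr, one_mul, cplx, Complex.norm_real]
    by_cases hq : q ∈ Prod.snd '' tsupport ψ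
    · rw [Set.indicator_of_mem hq]
      exact hC _
    · rw [Set.indicator_of_notMem hq]
      have : (t, q) ∉ tsupport (lagDt ψ) := fun h => hq ⟨_, tsupport_lagDt_subset ψ h, rfl⟩
      simp [image_eq_zero_of_notMem_tsupport this]
  · refine (integrable_indicator_iff hcK.measurableSet).2 ?_
    exact integrableOn_const hcK.measure_lt_top.ne
  · refine .of_forall fun q t _ => ?_
    have h1 : HasFDerivAt (fun t : ℝ => (t, q)) (ContinuousLinearMap.inl ℝ ℝ (Sp d)) t :=
      hasFDerivAt_prodMk_left t q
    have h2 := ((hψ.differentiable (by simp)) (t, q)).hasFDerivAt.comp t h1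
    exact (h2.hasDerivAt.ofReal_comp).const_mul (chr p q)

lemma continuous_pF {d : ℕ} {ψ : Pt d → ℝ} (hψ : Continuous ψ) (hc : HasCompactSupport ψ)
    (p : Sp d) : Continuous fun t => pF (cplx ψ) (t, p) := by
  have hcK : IsCompact (Prod.snd '' tsupport ψ) := hc.isCompact.image continuous_snd
  have e : (fun t => pF (cplx ψ) (t, p))
      = fun t => ∫ q in Prod.snd '' tsupport ψ, chr p q * cplx ψ (t, q) := by
    ext t
    refine (setIntegral_eq_integral_of_forall_compl_eq_zero fun q hq => ?_).symm
    have : (t, q) ∉ tsupport ψ := fun h => hq ⟨_, h, rfl⟩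
    simp [cplx, image_eq_zero_of_notMem_tsupport this]
  rw [e]
  refine continuous_parametric_integral_of_continuous ?_ hcK
  have h1 : Continuous fun x : ℝ × Sp d => chr p x.2 :=
    continuous_chr_comp continuous_const continuous_snd
  exact h1.mul (Complex.continuous_ofReal.comp hψ)

lemma exists_pF_eq_zero {d : ℕ} {ψ : Pt d → ℝ} (hc : HasCompactSupport ψ) :
    ∃ R, ∀ t, R ≤ |t| → ∀ p, pF (cplx ψ) (t, p) = 0 := by
  obtain ⟨R, hR⟩ := hc.isCompact.isBounded.subset_closedBall 0
  refine ⟨R + 1, fun t ht p => ?_⟩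
  have h0 : ∀ q, ψ (t, q) = 0 := fun q => by
    refine image_eq_zero_of_notMem_tsupport fun h => ?_
    have := hR h
    rw [mem_closedBall_zero_iff] at this
    have h2 := (norm_fst_le (t, q)).trans this
    rw [Real.norm_eq_abs] at h2
    linarith
  simp [pF, cplx, h0]

/-! ### Existence in the moving coordinates. -/

open ComplexConjugate

lemma memLp_conj {α : Type*} [MeasurableSpace α] {μ : Measure α} {p : ℝ≥0∞} {f : α → ℂ}
    (hf : MemLp f p μ) : MemLp (fun x => conj (f x)) p μ :=
  hf.of_le (Complex.continuous_conj.comp_aestronglyMeasurable hf.1)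
    (.of_forall fun x => by simp)

lemma memLp_re {α : Type*} [MeasurableSpace α] {μ : Measure α} {p : ℝ≥0∞} {f : α → ℂ}
    (hf : MemLp f p μ) : MemLp (fun x => (f x).re) p μ :=
  hf.of_le (Complex.continuous_re.comp_aestronglyMeasurable hf.1)
    (.of_forall fun _ => Complex.abs_re_le_norm _)

lemma memLp_cplx {α : Type*} [MeasurableSpace α] {μ : Measure α} {p : ℝ≥0∞} {f : α → ℝ}
    (hf : MemLp f p μ) : MemLp (cplx f) p μ :=
  hf.of_le (Complex.continuous_ofReal.comp_aestronglyMeasurable hf.1)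
    (.of_forall fun x => by simp [cplx])

lemma integrable_mul_of_memLp {α : Type*} [MeasurableSpace α] {μ : Measure α} {f g : α → ℂ}
    (hf : MemLp f 2 μ) (hg : MemLp g 2 μ) : Integrable (fun x => f x * g x) μ :=
  hf.integrable_mul hg

lemma integral_eq_of_ae_slices {α β : Type*} [MeasurableSpace α] [MeasurableSpace β]
    {μ : Measure α} {ν : Measure β} [SFinite μ] [SFinite ν] {F₁ F₂ : α × β → ℂ}
    (h1 : Integrable F₁ (μ.prod ν)) (h2 : Integrable F₂ (μ.prod ν))
    (h : ∀ᵐ p ∂ν, ∫ t, F₁ (t, p) ∂μ = ∫ t, F₂ (t, p) ∂μ) :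
    ∫ X, F₁ X ∂(μ.prod ν) = ∫ X, F₂ X ∂(μ.prod ν) := by
  rw [integral_prod_symm _ h1, integral_prod_symm _ h2]
  exact integral_congr_ae h

/-- Test functions are real, so taking real parts of the complex Parseval identities gives
identities for real functions. -/
lemma integral_re_mul {α : Type*} [MeasurableSpace α] {μ : Measure α} {U : α → ℂ} {φ : α → ℝ}
    (hU : MemLp U 2 μ) (hφ : MemLp φ 2 μ) :
    ∫ X, (U X).re * φ X ∂μ = (∫ X, cplx φ X * U X ∂μ).re := by
  have h := integrable_mul_of_memLp (memLp_cplx hφ) hU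
  refine Eq.trans (integral_congr_ae (.of_forall fun X => ?_)) (integral_re h)
  simp [cplx, mul_comm]

/-- Weak solvability of the transformed equation on the Fourier side. -/
lemma integral_pF_lagDt_mul_solF {d : ℕ} {δ : ℝ} (hδ : 0 < δ) (hδ1 : δ < 1)
    {a : Fin d → Fin d → ℝ → ℝ} (ha : IsElliptic δ a) {lam : ℝ} (hlam : 0 < lam) {G : Pt d → ℂ}
    (hG : Measurable G) (hG2 : MemLp G 2 volume) {ψ : Pt d → ℝ} (hψ : ContDiff ℝ ∞ ψ)
    (hc : HasCompactSupport ψ) :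
    ∫ X, conj (pF (cplx (lagDt ψ)) X) * solF a lam G X
      = (∫ X, conj (pF (cplx ψ) X) * (damp a lam X * solF a lam G X))
        - ∫ X, conj (pF (cplx ψ) X) * G X := by
  have hDc : HasCompactSupport (lagDt ψ) :=
    hc.of_isClosed_subset (isClosed_tsupport _) (tsupport_lagDt_subset ψ)
  have hD := (contDiff_lagDt hψ).continuous
  have m1 : MemLp (fun X => conj (pF (cplx (lagDt ψ)) X)) 2 volume := memLp_conj
    (memLp_pF (memLp_one_iff_integrable.1 (memLp_cplx_of_test hD hDc 1))
      (memLp_cplx_of_test hD hDc 2))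
  have m2 : MemLp (fun X => conj (pF (cplx ψ) X)) 2 volume := memLp_conj
    (memLp_pF (memLp_one_iff_integrable.1 (memLp_cplx_of_test hψ.continuous hc 1))
      (memLp_cplx_of_test hψ.continuous hc 2))
  have m3 : MemLp (fun X => (1 : ℂ) * solF a lam G X) 2 volume :=
    memLp_mul_solF hδ hδ1 ha hlam hG hG2 measurable_const (C := 1 / lam) fun X => by
      rw [norm_one, div_mul_eq_mul_div, one_mul, one_le_div hlam]; exact le_wt X
  simp only [one_mul] at m3
  have m4 : MemLp (fun X => (damp a lam X : ℂ) * solF a lam G X) 2 volume := by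
    refine memLp_mul_solF hδ hδ1 ha hlam hG hG2
      (Complex.measurable_ofReal.comp (measurable_damp ha lam)) (C := 4 * Real.pi ^ 2 * δ⁻¹ + 1)
      fun X => ?_
    have h0 : 0 ≤ damp a lam X :=
      (mul_nonneg hδ.le (hlam.le.trans (le_wt _))).trans (damp_lower hδ hδ1 ha hlam _)
    rw [Complex.norm_real, Real.norm_of_nonneg h0]
    exact damp_upper hδ ha hlam X
  have i1 := integrable_mul_of_memLp m1 m3
  have i2 := integrable_mul_of_memLp m2 m4
  have i3 := integrable_mul_of_memLp m2 hG2
  rw [← integral_sub i2 i3]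
  -- It is enough to argue for almost every frequency `p`. There the identity is the weak form of
  -- the scalar equation, tested against the conjugate transform of `ψ`, which is `C¹` and compactly
  -- supported in time.
  refine integral_eq_of_ae_slices i1 (i2.sub i3) ?_
  obtain ⟨R1, hR1⟩ := exists_pF_eq_zero hc
  obtain ⟨R2, hR2⟩ := exists_pF_eq_zero hDc
  filter_upwards [memLp_two_prod_left_ae hG2, Integrable.prod_left_ae i1,
    Integrable.prod_left_ae i2, Integrable.prod_left_ae i3] with p hp j1 j2 j3
  have key := (damping hδ hδ1 ha hlam p).integral_adjoint_mul_sol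
    (hG.comp measurable_prodMk_right) hp (ψ := fun t => conj (pF (cplx ψ) (t, p)))
    (ψ' := fun t => conj (pF (cplx (lagDt ψ)) (t, p)))
    (fun t => Complex.conjCLE.hasFDerivAt.comp_hasDerivAt t (hasDerivAt_pF hψ hc p t))
    (Complex.continuous_conj.comp (continuous_pF hD hDc p)) (R := max R1 R2)
    (fun t ht => by
      simp [hR1 t ((le_max_left _ _).trans ht) p, hR2 t ((le_max_right _ _).trans ht) p])
  have e : ∀ t, (conj (pF (cplx (lagDt ψ)) (t, p)) - damp a lam (t, p) * conj (pF (cplx ψ) (t, p)))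
      * Damping.sol (fun t => damp a lam (t, p)) (fun t => G (t, p)) t
      = conj (pF (cplx (lagDt ψ)) (t, p)) * solF a lam G (t, p)
        - conj (pF (cplx ψ) (t, p)) * (damp a lam (t, p) * solF a lam G (t, p)) := by
    intro t
    simp only [solF]
    ring
  have key' : ∫ t, (conj (pF (cplx (lagDt ψ)) (t, p)) * solF a lam G (t, p)
        - conj (pF (cplx ψ) (t, p)) * (damp a lam (t, p) * solF a lam G (t, p)))
      = -∫ t, conj (pF (cplx ψ) (t, p)) * G (t, p) := by
    exact (integral_congr_ae (.of_forall fun t => (e t).symm)).trans key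
  rw [integral_sub j1 j2] at key'
  rw [integral_sub j2 j3]
  linear_combination key'

/-- Existence of a solution in the moving coordinates, on the whole space. -/
lemma exists_lagrangian_solution {d : ℕ} {δ : ℝ} (hδ : 0 < δ) (hδ1 : δ < 1)
    {a : Fin d → Fin d → ℝ → ℝ} (ha : IsElliptic δ a) {lam : ℝ} (hlam : 0 < lam) {f : Pt d → ℝ}
    (hf : MemLp f 2 volume) :
    ∃ (u : Pt d → ℝ) (g : Fin d → Pt d → ℝ) (H : Fin d → Fin d → Pt d → ℝ),
      MemLp u 2 volume ∧ (∀ i, MemLp (g i) 2 volume) ∧ (∀ i j, MemLp (H i j) 2 volume) ∧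
      ∀ ψ : Pt d → ℝ, ContDiff ℝ ∞ ψ → HasCompactSupport ψ →
        (∀ i, ∫ X, u X * lagDx i ψ X = -∫ X, g i X * ψ X) ∧
        (∀ i j, ∫ X, u X * lagDx i (lagDx j ψ) X = ∫ X, H i j X * ψ X) ∧
        ∫ X, u X * lagDt ψ X
          = -∫ X, (f X + ∑ i, ∑ j, a i j X.1 * H i j X - lam * u X) * ψ X := by
  obtain ⟨hAdj, hTr⟩ := exists_parseval_pF d
  obtain ⟨G₀, hG₀, hG₀f⟩ := hTr (cplx f) (memLp_cplx hf)
  -- The solution formula integrates along lines of fixed frequency, so a measurable representative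
  -- of the transformed datum is fixed first.
  obtain ⟨G, hGs, hGG₀⟩ := hG₀.1
  have hGm := hGs.measurable
  have hG : MemLp G 2 volume := hG₀.ae_eq hGG₀
  set V := solF a lam G with hV
  have mV : MemLp V 2 volume := by
    have := memLp_mul_solF hδ hδ1 ha hlam hGm hG (b := fun _ => 1) measurable_const (C := 1 / lam)
      fun X => by
        rw [norm_one, div_mul_eq_mul_div, one_mul, one_le_div hlam]; exact le_wt X
    simpa only [one_mul] using this
  have hsm := fun i : Fin d => Complex.measurable_ofReal.comp (continuous_symb i).measurable
  have mVi : ∀ i, MemLp (fun X => (2 * Real.pi * Complex.I * symb i X) * V X) 2 volume := by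
    intro i
    refine memLp_mul_solF hδ hδ1 ha hlam hGm hG ((hsm i).const_mul _)
      (C := 2 * Real.pi * (1 / lam + 1)) fun X => ?_
    have e : ‖(2 * Real.pi * Complex.I * symb i X : ℂ)‖ = 2 * Real.pi * |symb i X| := by
      simp [abs_of_pos Real.pi_pos]
    refine e.le.trans ?_
    rw [mul_assoc (2 * Real.pi)]
    refine mul_le_mul_of_nonneg_left ?_ (by positivity)
    have h1 := sq_symb_le_wt (lam := lam) i X
    have h2 : |symb i X| ≤ 1 + symb i X ^ 2 := by
      rw [← sq_abs]; nlinarith [sq_nonneg (|symb i X| - 1)]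
    have h3 : 1 ≤ 1 / lam * wt lam X := by
      rw [div_mul_eq_mul_div, one_mul, one_le_div hlam]; exact le_wt X
    linarith
  have mVij : ∀ i j, MemLp (fun X => (-(4 * Real.pi ^ 2 * symb i X * symb j X) : ℂ) * V X) 2
      volume := by
    intro i j
    refine memLp_mul_solF hδ hδ1 ha hlam hGm hG ((((hsm i).const_mul _).mul (hsm j)).neg)
      (C := 4 * Real.pi ^ 2) fun X => ?_
    have e : ‖(-(4 * Real.pi ^ 2 * symb i X * symb j X) : ℂ)‖
        = 4 * Real.pi ^ 2 * (|symb i X| * |symb j X|) := by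
      simp [abs_of_pos Real.pi_pos, mul_assoc]
    refine e.le.trans (mul_le_mul_of_nonneg_left ?_ (by positivity))
    have h1 := sq_symb_le_wt (lam := lam) i X
    have h2 := sq_symb_le_wt (lam := lam) j X
    nlinarith [sq_nonneg (|symb i X| - |symb j X|), sq_abs (symb i X), sq_abs (symb j X)]
  -- Each of `V`, `2πi P_i V` and `-4π² P_i P_j V` is pulled back separately. That the results are
  -- weak derivatives of `U` follows by testing, since the transform of `D_i ψ` is `2πi P_i` times
  -- that of `ψ`.
  obtain ⟨U, mU, hU⟩ := hAdj V mV
  choose Ui mUi hUi using fun i => hAdj _ (mVi i)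
  choose Uij mUij hUij using fun i j => hAdj _ (mVij i j)
  have conj_cplx : ∀ (φ : Pt d → ℝ) X, conj (cplx φ X) = cplx φ X := fun φ X => Complex.conj_ofReal _
  refine ⟨fun X => (U X).re, fun i X => (Ui i X).re, fun i j X => (Uij i j X).re, memLp_re mU,
    fun i => memLp_re (mUi i), fun i j => memLp_re (mUij i j), fun ψ hψ hc => ?_⟩
  have hDxc : ∀ i {φ : Pt d → ℝ}, HasCompactSupport φ → HasCompactSupport (lagDx i φ) :=
    fun i φ h => h.of_isClosed_subset (isClosed_tsupport _) (tsupport_lagDx_subset i φ)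
  have hDtc : HasCompactSupport (lagDt ψ) :=
    hc.of_isClosed_subset (isClosed_tsupport _) (tsupport_lagDt_subset ψ)
  have test : ∀ {φ : Pt d → ℝ}, Continuous φ → HasCompactSupport φ → MemLp φ 2 volume :=
    fun h1 h2 => h1.memLp_of_hasCompactSupport h2
  have ctest : ∀ {φ : Pt d → ℝ}, Continuous φ → HasCompactSupport φ →
      Integrable (cplx φ) ∧ MemLp (cplx φ) 2 volume := fun h1 h2 =>
    ⟨memLp_one_iff_integrable.1 (memLp_cplx_of_test h1 h2 1), memLp_cplx_of_test h1 h2 2⟩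
  have pars : ∀ {φ : Pt d → ℝ} {W U : Pt d → ℂ}, (∀ ψ, Integrable ψ → MemLp ψ 2 volume →
      ∫ X, conj (ψ X) * U X = ∫ X, conj (pF ψ X) * W X) → Continuous φ → HasCompactSupport φ →
      ∫ X, cplx φ X * U X = ∫ X, conj (pF (cplx φ) X) * W X := by
    intro φ W U h h1 h2
    have := h (cplx φ) (ctest h1 h2).1 (ctest h1 h2).2
    simpa only [conj_cplx] using this
  have cψ := hψ.continuous
  refine ⟨fun i => ?_, fun i j => ?_, ?_⟩
  · have cD := (contDiff_lagDx i hψ).continuous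
    rw [integral_re_mul mU (test cD (hDxc i hc)), integral_re_mul (mUi i) (test cψ hc),
      pars hU cD (hDxc i hc), pars (hUi i) cψ hc, ← Complex.neg_re, ← integral_neg]
    congr 1
    refine integral_congr_ae (.of_forall fun X => ?_)
    simp only [pF_cplx_lagDx i hψ hc, map_mul, Complex.conj_I, Complex.conj_ofReal, map_ofNat]
    ring
  · have cD := (contDiff_lagDx i (contDiff_lagDx j hψ)).continuous
    rw [integral_re_mul mU (test cD (hDxc i (hDxc j hc))), integral_re_mul (mUij i j) (test cψ hc),
      pars hU cD (hDxc i (hDxc j hc)), pars (hUij i j) cψ hc]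
    congr 1
    refine integral_congr_ae (.of_forall fun X => ?_)
    simp only [pF_cplx_lagDx i (contDiff_lagDx j hψ) (hDxc j hc), pF_cplx_lagDx j hψ hc, map_mul,
      Complex.conj_I, Complex.conj_ofReal, map_ofNat]
    linear_combination (4 * Real.pi ^ 2 * symb i X * symb j X * conj (pF (cplx ψ) X) * V X)
      * Complex.I_sq
  · have cD := (contDiff_lagDt hψ).continuous
    rw [integral_re_mul mU (test cD hDtc), pars hU cD hDtc,
      integral_pF_lagDt_mul_solF hδ hδ1 ha hlam hGm hG hψ hc]
    obtain ⟨K, hK⟩ := ha.bounded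
    have maψ : ∀ i j (p : ℝ≥0∞), MemLp (fun X : Pt d => a i j X.1 * ψ X) p volume := fun i j p =>
      (cψ.memLp_of_hasCompactSupport hc).of_le_mul (c := K)
        (((ha.measurable i j).comp measurable_fst).aestronglyMeasurable.mul
          cψ.aestronglyMeasurable) (.of_forall fun X => by
            rw [norm_mul]
            exact mul_le_mul_of_nonneg_right (hK i j X.1) (norm_nonneg _))
    -- The coefficients depend on time only and so commute with the transform in space. The product
    -- `a^{ij} ψ` may be discontinuous in time, but Parseval's identity requires only `L¹ ∩ L²`.
    have pFa : ∀ i j X, pF (cplx fun X : Pt d => a i j X.1 * ψ X) X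
        = a i j X.1 * pF (cplx ψ) X := by
      intro i j X
      simp only [pF, cplx, ← integral_const_mul]
      refine integral_congr_ae (.of_forall fun q => ?_)
      simp only
      push_cast
      ring
    have eA : ∀ i j, ∫ X, (Uij i j X).re * (a i j X.1 * ψ X)
        = (∫ X, conj (pF (cplx fun X : Pt d => a i j X.1 * ψ X) X)
          * (-(4 * Real.pi ^ 2 * symb i X * symb j X) * V X)).re := by
      intro i j
      rw [integral_re_mul (mUij i j) (maψ i j 2), ← hUij i j _
        (memLp_one_iff_integrable.1 (memLp_cplx (maψ i j 1))) (memLp_cplx (maψ i j 2))]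
      simp only [conj_cplx]
    have mPa : ∀ i j, MemLp (fun X => conj (pF (cplx fun X : Pt d => a i j X.1 * ψ X) X)) 2
        volume := fun i j => memLp_conj (memLp_pF
          (memLp_one_iff_integrable.1 (memLp_cplx (maψ i j 1))) (memLp_cplx (maψ i j 2)))
    have mP : MemLp (fun X => conj (pF (cplx ψ) X)) 2 volume :=
      memLp_conj (memLp_pF (ctest cψ hc).1 (ctest cψ hc).2)
    have eF : ∫ X, f X * ψ X = (∫ X, conj (pF (cplx ψ) X) * G X).re := by
      have h1 := pars hG₀f cψ hc
      have h2 : ∫ X, conj (pF (cplx ψ) X) * G₀ X = ∫ X, conj (pF (cplx ψ) X) * G X := by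
        refine integral_congr_ae ?_
        filter_upwards [hGG₀] with X hX
        rw [hX]
      rw [← h2, ← h1, ← integral_re_mul (memLp_cplx hf) (test cψ hc)]
      simp [cplx]
    have eU : ∫ X, (U X).re * ψ X = (∫ X, conj (pF (cplx ψ) X) * V X).re := by
      rw [integral_re_mul mU (test cψ hc), pars hU cψ hc]
    have eD : ∫ X, conj (pF (cplx ψ) X) * (damp a lam X * V X)
        = (lam : ℂ) * (∫ X, conj (pF (cplx ψ) X) * V X)
          - ∑ i, ∑ j, ∫ X, conj (pF (cplx fun X : Pt d => a i j X.1 * ψ X) X)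
            * (-(4 * Real.pi ^ 2 * symb i X * symb j X) * V X) := by
      have ii := fun i j => integrable_mul_of_memLp (mPa i j) (mVij i j)
      have : ∀ i, ∑ j, ∫ X, conj (pF (cplx fun X : Pt d => a i j X.1 * ψ X) X)
            * (-(4 * Real.pi ^ 2 * symb i X * symb j X) * V X)
          = ∫ X, ∑ j, conj (pF (cplx fun X : Pt d => a i j X.1 * ψ X) X)
            * (-(4 * Real.pi ^ 2 * symb i X * symb j X) * V X) := fun i =>
        (integral_finsetSum _ fun j _ => ii i j).symm
      simp_rw [this]
      rw [← integral_finsetSum _ fun i _ => integrable_finsetSum _ fun j _ => ii i j,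
        ← integral_const_mul, ← integral_sub ((integrable_mul_of_memLp mP mV).const_mul _)
          (integrable_finsetSum _ fun i _ => integrable_finsetSum _ fun j _ => ii i j)]
      refine integral_congr_ae (.of_forall fun X => ?_)
      simp only [pFa, map_mul, Complex.conj_ofReal, damp]
      push_cast
      have : ∀ i j, (a i j X.1 : ℂ) * conj (pF (cplx ψ) X)
          * (-(4 * Real.pi ^ 2 * symb i X * symb j X) * V X)
          = -(4 * Real.pi ^ 2 * conj (pF (cplx ψ) X) * V X)
            * (a i j X.1 * symb i X * symb j X) := fun i j => by ring
      simp_rw [this, ← Finset.mul_sum]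
      ring
    have iR : ∀ i j, Integrable fun X => (Uij i j X).re * (a i j X.1 * ψ X) := fun i j =>
      (memLp_re (mUij i j)).integrable_mul (maψ i j 2)
    have iF : Integrable fun X => f X * ψ X := hf.integrable_mul (test cψ hc)
    have iU : Integrable fun X => (U X).re * ψ X := (memLp_re mU).integrable_mul (test cψ hc)
    have eR : ∫ X, (f X + ∑ i, ∑ j, a i j X.1 * (Uij i j X).re - lam * (U X).re) * ψ X
        = (∫ X, f X * ψ X) + (∑ i, ∑ j, ∫ X, (Uij i j X).re * (a i j X.1 * ψ X))
          - lam * ∫ X, (U X).re * ψ X := by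
      have : ∀ i, ∑ j, ∫ X, (Uij i j X).re * (a i j X.1 * ψ X)
          = ∫ X, ∑ j, (Uij i j X).re * (a i j X.1 * ψ X) := fun i =>
        (integral_finsetSum _ fun j _ => iR i j).symm
      simp_rw [this]
      have iS := integrable_finsetSum (Finset.univ : Finset (Fin d)) fun i _ =>
        integrable_finsetSum (Finset.univ : Finset (Fin d)) fun j _ => iR i j
      rw [← integral_finsetSum _ fun i _ => integrable_finsetSum _ fun j _ => iR i j,
        ← integral_add iF iS, ← integral_const_mul]
      refine Eq.trans ?_ (integral_sub (iF.add iS) (iU.const_mul _))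
      refine integral_congr_ae (.of_forall fun X => ?_)
      simp only [sub_mul, add_mul, Finset.sum_mul]
      congr 1
      · congr 1
        refine Finset.sum_congr rfl fun i _ => Finset.sum_congr rfl fun j _ => ?_
        ring
      · ring
    rw [eR, eD, eF, eU]
    simp_rw [eA]
    simp only [Complex.sub_re, Complex.re_ofReal_mul, Complex.re_sum]
    ring

/-! ### Existence on the slab. -/

lemma fderiv_eq_zero_of_isTest {d : ℕ} {G : Set (Pt d)} {φ : Pt d → ℝ} (h : IsTest G φ) {X : Pt d}
    (hX : X ∉ G) : fderiv ℝ φ X = 0 :=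
  image_eq_zero_of_notMem_tsupport fun h1 =>
    hX (h.tsupport_subset (tsupport_fderiv_subset ℝ h1))

lemma contDiff_dx {d : ℕ} (i : Fin d) {φ : Pt d → ℝ} (hφ : ContDiff ℝ ∞ φ) :
    ContDiff ℝ ∞ (dx i φ) :=
  (hφ.fderiv_right (by simp)).clm_apply contDiff_const

lemma IsTest.dx {d : ℕ} {G : Set (Pt d)} {φ : Pt d → ℝ} (h : IsTest G φ) (i : Fin d) :
    IsTest G (dx i φ) := by
  have hsub : tsupport (KFP.dx i φ) ⊆ tsupport φ := by
    refine (closure_mono fun X hX => ?_).trans (tsupport_fderiv_subset ℝ (f := φ))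
    rw [Function.mem_support] at hX ⊢
    intro h
    exact hX (by rw [KFP.dx, h]; rfl)
  exact ⟨contDiff_dx i h.contDiff,
    h.hasCompactSupport.of_isClosed_subset (isClosed_tsupport _) hsub,
    hsub.trans h.tsupport_subset⟩

lemma IsTest.eq_zero {d : ℕ} {G : Set (Pt d)} {φ : Pt d → ℝ} (h : IsTest G φ) {X : Pt d}
    (hX : X ∉ G) : φ X = 0 :=
  image_eq_zero_of_notMem_tsupport fun h1 => hX (h.tsupport_subset h1)

lemma transport_eq_zero {d : ℕ} {G : Set (Pt d)} {φ : Pt d → ℝ} (h : IsTest G φ) {X : Pt d}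
    (hX : X ∉ G) : KFP.transport φ X = 0 := by
  simp [KFP.transport, fderiv_eq_zero_of_isTest h hX]

/-- Because `φ` vanishes off the slab, the integral extends to the whole space, where `shear` is a
measure-preserving change of variables. -/
lemma setIntegral_slab_eq {d : ℕ} {T : EReal} (h φ : Pt d → ℝ) (hφ : ∀ X, X ∉ slab d T → φ X = 0) :
    ∫ X in slab d T, h X * φ X = ∫ X, (h ∘ shear) X * (φ ∘ shear) X := by
  rw [setIntegral_eq_integral_of_forall_compl_eq_zero fun X hX => by rw [hφ X hX, mul_zero]]
  exact ((measurePreserving_shear d).integral_comp (measurableEmbedding_shear d)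
    fun X => h X * φ X).symm

lemma locallyIntegrableOn_of_memLp {d : ℕ} {G : Set (Pt d)} {u : Pt d → ℝ}
    (h : MemLp u 2 (volume.restrict G)) : LocallyIntegrableOn u G :=
  locallyIntegrableOn_of_locallyIntegrable_restrict (h.locallyIntegrable (by norm_num))

/-- Existence of a solution on `slab d T`. -/
lemma exists_isSolution {d : ℕ} {δ : ℝ} (hδ : 0 < δ) (hδ1 : δ < 1)
    {a : Fin d → Fin d → ℝ → ℝ} (ha : IsElliptic δ a) {lam : ℝ} (hlam : 0 < lam) {T : EReal}
    {f : Pt d → ℝ} (hf : MemLp f 2 (volume.restrict (slab d T))) :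
    ∃ u : Pt d → ℝ, MemLp u 2 (volume.restrict (slab d T)) ∧
      ∀ v : Pt d → ℝ, v =ᵐ[volume.restrict (slab d T)] u → IsSolution a lam (slab d T) f v := by
  have hS := (isOpen_slab d T).measurableSet
  -- The datum is extended by zero past `T`; the whole-space solution is later restricted to the
  -- slab.
  have hf' : MemLp ((slab d T).indicator f) 2 volume := (memLp_indicator_iff_restrict hS).2 hf
  obtain ⟨U, g, H, mU, mg, mH, hw⟩ := exists_lagrangian_solution hδ hδ1 ha hlam
    (hf'.comp_measurePreserving (measurePreserving_shear d))
  have mp := measurePreserving_unshear d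
  have m : ∀ {h : Pt d → ℝ}, MemLp h 2 volume →
      MemLp (h ∘ unshear) 2 (volume.restrict (slab d T)) :=
    fun h => (h.comp_measurePreserving mp).restrict _
  have cs : ∀ h : Pt d → ℝ, (h ∘ unshear) ∘ shear = h := fun h => by
    ext X; simp [unshear_shear]
  have dif : ∀ {φ : Pt d → ℝ}, IsTest (slab d T) φ → Differentiable ℝ φ :=
    fun h => h.contDiff.differentiable (by simp)
  -- `Y` is the value that the equation prescribes for `∂_t U`. It is square integrable because the
  -- coefficients are bounded, and it becomes the transport derivative of the solution.
  set Y : Pt d → ℝ := fun X => ((slab d T).indicator f ∘ shear) X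
    + ∑ i, ∑ j, a i j X.1 * H i j X - lam * U X with hY
  have mY : MemLp Y 2 volume := by
    obtain ⟨K, hK⟩ := ha.bounded
    refine ((hf'.comp_measurePreserving (measurePreserving_shear d)).add
      (memLp_finsetSum _ fun i _ => memLp_finsetSum _ fun j _ => ?_)).sub (mU.const_mul lam)
    exact (mH i j).of_le_mul (c := K)
      (((ha.measurable i j).comp measurable_fst).aestronglyMeasurable.mul (mH i j).1)
      (.of_forall fun X => by
        rw [norm_mul]; exact mul_le_mul_of_nonneg_right (hK i j X.1) (norm_nonneg _))
  refine ⟨U ∘ unshear, m mU, fun v hv => ?_⟩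
  have mv : MemLp v 2 (volume.restrict (slab d T)) := (m mU).ae_eq hv.symm
  have cv : ∀ φ : Pt d → ℝ, ∫ X in slab d T, v X * φ X = ∫ X in slab d T, (U ∘ unshear) X * φ X := by
    intro φ
    refine integral_congr_ae ?_
    filter_upwards [hv] with X hX
    rw [hX]
  have hdx : ∀ i, HasWeakDx (slab d T) i v (g i ∘ unshear) := fun i =>
    { locInt := locallyIntegrableOn_of_memLp mv
      locInt_deriv := locallyIntegrableOn_of_memLp (m (mg i))
      integral_eq := fun φ hφ => by
        rw [cv, setIntegral_slab_eq _ _ fun X hX => (hφ.dx i).eq_zero hX,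
          setIntegral_slab_eq _ _ fun X hX => hφ.eq_zero hX, cs, cs, ← lagDx_comp_shear (dif hφ)]
        exact (hw _ hφ.comp_shear.contDiff hφ.comp_shear.hasCompactSupport).1 i }
  have hdxx : ∀ i j, HasWeakDxx (slab d T) i j v (H i j ∘ unshear) := fun i j =>
    { locInt := locallyIntegrableOn_of_memLp mv
      locInt_deriv := locallyIntegrableOn_of_memLp (m (mH i j))
      integral_eq := fun φ hφ => by
        rw [cv, setIntegral_slab_eq _ _ fun X hX => ((hφ.dx j).dx i).eq_zero hX,
          setIntegral_slab_eq _ _ fun X hX => hφ.eq_zero hX, cs, cs,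
          ← lagDx_comp_shear (dif (hφ.dx j)), ← lagDx_comp_shear (dif hφ)]
        exact (hw _ hφ.comp_shear.contDiff hφ.comp_shear.hasCompactSupport).2.1 i j }
  have htr : HasWeakTransport (slab d T) v (Y ∘ unshear) :=
    { locInt := locallyIntegrableOn_of_memLp mv
      locInt_deriv := locallyIntegrableOn_of_memLp (m mY)
      integral_eq := fun φ hφ => by
        rw [cv, setIntegral_slab_eq _ _ fun X hX => transport_eq_zero hφ hX,
          setIntegral_slab_eq _ _ fun X hX => hφ.eq_zero hX, cs, cs, ← lagDt_comp_shear (dif hφ)]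
        exact (hw _ hφ.comp_shear.contDiff hφ.comp_shear.hasCompactSupport).2.2 }
  refine ⟨⟨mv, fun i => ⟨_, hdx i, m (mg i)⟩, fun i j => ⟨_, hdxx i j, m (mH i j)⟩,
    ⟨_, htr, m mY⟩⟩, Y ∘ unshear, fun i j => H i j ∘ unshear, htr, hdxx, ?_⟩
  filter_upwards [hv, ae_restrict_mem hS] with X hX hXS
  have h1 : (unshear X).1 = X.1 := rfl
  simp only [hY, Function.comp_apply, hX, shear_unshear, Set.indicator_of_mem hXS, h1]
  ring

/-! ### Weak derivatives and decay in one variable. -/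

/-- A smooth compactly supported function in an open lower set whose integral vanishes has a
primitive of the same kind. -/
lemma exists_primitive_of_integral_eq_zero {J : Set ℝ} (hJ : IsLowerSet J) {w : ℝ → ℝ}
    (hw : ContDiff ℝ ∞ w) (hc : HasCompactSupport w) (hs : tsupport w ⊆ J) (h0 : ∫ t, w t = 0) :
    ∃ W : ℝ → ℝ, ContDiff ℝ ∞ W ∧ HasCompactSupport W ∧ tsupport W ⊆ J ∧ deriv W = w := by
  rcases (tsupport w).eq_empty_or_nonempty with he | hne
  · have : w = 0 := tsupport_eq_empty_iff.1 he
    exact ⟨w, hw, hc, hs, by subst this; ext t; simp⟩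
  obtain ⟨α, hα⟩ := hc.isCompact.exists_isLeast hne
  obtain ⟨β, hβ⟩ := hc.isCompact.exists_isGreatest hne
  have hαβ : α ≤ β := hα.2 hβ.1
  have hwi : Integrable w := hw.continuous.integrable_of_hasCompactSupport hc
  -- The base point lies strictly to the left of the support, so that to the right of the support
  -- the half-open interval of integration contains all of it, including its minimum `α`.
  have hd : ∀ t, HasDerivAt (fun t => ∫ s in (α - 1)..t, w s) (w t) t := fun t =>
    intervalIntegral.integral_hasDerivAt_right (hwi.intervalIntegrable)
      hw.continuous.aestronglyMeasurable.stronglyMeasurableAtFilter hw.continuous.continuousAt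
  have hderiv : deriv (fun t => ∫ s in (α - 1)..t, w s) = w := funext fun t => (hd t).deriv
  have hsub : tsupport (fun t => ∫ s in (α - 1)..t, w s) ⊆ Set.Icc (α - 1) β := by
    refine closure_minimal (fun t ht => ?_) isClosed_Icc
    by_contra hn
    apply ht
    rw [Set.mem_Icc, not_and_or, not_le, not_le] at hn
    rcases hn with h | h
    · change ∫ s in (α - 1)..t, w s = 0
      rw [intervalIntegral.integral_congr (g := fun _ => (0 : ℝ))]
      · simp
      · intro s hs'
        rw [Set.uIcc_of_ge h.le] at hs'
        refine image_eq_zero_of_notMem_tsupport fun h1 => ?_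
        linarith [hα.2 h1, hs'.2]
    · change ∫ s in (α - 1)..t, w s = 0
      rw [intervalIntegral.integral_eq_integral_of_support_subset, h0]
      intro s hs'
      have h1 := subset_tsupport _ hs'
      exact ⟨by linarith [hα.2 h1], (hβ.2 h1).trans h.le⟩
  -- The support of the primitive lies in `[α - 1, β]` with `β ∈ J`. A lower set contains this
  -- interval even though the support of `w` reaches only down to `α`.
  refine ⟨_, contDiff_infty_iff_deriv.2 ⟨fun t => (hd t).differentiableAt, by rwa [hderiv]⟩,
    isCompact_Icc.of_isClosed_subset (isClosed_tsupport _) hsub,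
    fun t ht => hJ (hsub ht).2 (hs hβ.1), hderiv⟩

lemma integrable_mul_of_hasCompactSupport {h χ : ℝ → ℝ} (hh : LocallyIntegrable h)
    (hχ : Continuous χ) (hc : HasCompactSupport χ) : Integrable fun t => h t * χ t := by
  simpa [mul_comm] using hh.integrable_smul_left_of_hasCompactSupport hχ hc

/-- The lemma of du Bois-Reymond. -/
lemma ae_eq_const_of_integral_mul_deriv_eq_zero {J : Set ℝ} (hJo : IsOpen J) (hJ : IsLowerSet J)
    {h : ℝ → ℝ} (hh : LocallyIntegrable h)
    (hz : ∀ χ : ℝ → ℝ, ContDiff ℝ ∞ χ → HasCompactSupport χ → tsupport χ ⊆ J →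
      ∫ t, h t * deriv χ t = 0) :
    ∃ c : ℝ, ∀ᵐ t, t ∈ J → h t = c := by
  rcases J.eq_empty_or_nonempty with he | ⟨t₀, ht₀⟩
  · exact ⟨0, by simp [he]⟩
  obtain ⟨r, hr, hrJ⟩ := Metric.isOpen_iff.1 hJo t₀ ht₀
  -- The outer radius `r / 2` keeps the closed support inside the ball of radius `r` contained in
  -- `J`.
  let b : ContDiffBump t₀ := ⟨r / 3, r / 2, by positivity, by linarith⟩
  set χ₀ := b.normed volume with hχ₀
  have c0 : ContDiff ℝ ∞ χ₀ := b.contDiff_normed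
  have s0 : HasCompactSupport χ₀ := b.hasCompactSupport_normed
  have j0 : tsupport χ₀ ⊆ J := by
    rw [hχ₀, b.tsupport_normed_eq]
    exact (Metric.closedBall_subset_ball (by change r / 2 < r; linarith)).trans hrJ
  have i0 : ∫ t, χ₀ t = 1 := b.integral_normed
  refine ⟨∫ t, h t * χ₀ t, ?_⟩
  have := hJo.ae_eq_zero_of_integral_contDiff_smul_eq_zero (μ := volume)
    (f := fun t => h t - ∫ t, h t * χ₀ t)
    ((hh.sub (locallyIntegrable_const _)).locallyIntegrableOn _) ?_
  · filter_upwards [this] with t ht hJt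
    linarith [ht hJt]
  intro θ hθ hcθ hsθ
  have iθ : Integrable θ := hθ.continuous.integrable_of_hasCompactSupport hcθ
  have iχ : Integrable χ₀ := c0.continuous.integrable_of_hasCompactSupport s0
  -- Since `χ₀` has integral `1`, subtracting `(∫ θ) χ₀` from `θ` leaves a function of integral
  -- zero, which is the derivative of an admissible test function.
  obtain ⟨W, hW, hWc, hWs, hWd⟩ := exists_primitive_of_integral_eq_zero hJ
    (w := fun t => θ t - (∫ t, θ t) * χ₀ t) (hθ.sub (contDiff_const.mul c0))
    (hcθ.sub (s0.mul_left))
    ((tsupport_sub _ _).trans (Set.union_subset hsθ (tsupport_mul_subset_right.trans j0)))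
    (by rw [integral_sub iθ (iχ.const_mul _), integral_const_mul, i0]; ring)
  · have h1 := hz W hW hWc hWs
    rw [hWd] at h1
    have e1 : ∀ t, h t * (θ t - (∫ t, θ t) * χ₀ t) = h t * θ t - (∫ t, θ t) * (h t * χ₀ t) :=
      fun t => by ring
    have ih := integrable_mul_of_hasCompactSupport hh hθ.continuous hcθ
    have ih0 := integrable_mul_of_hasCompactSupport hh c0.continuous s0
    simp_rw [e1] at h1
    rw [integral_sub ih (ih0.const_mul _), integral_const_mul] at h1
    have e2 : ∀ t, θ t • (h t - ∫ t, h t * χ₀ t) = h t * θ t - (∫ t, h t * χ₀ t) * θ t :=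
      fun t => by simp only [smul_eq_mul]; ring
    simp_rw [e2]
    rw [integral_sub ih (iθ.const_mul _), integral_const_mul]
    linarith

/-- The chain rule for the square of a function with a locally integrable weak derivative. -/
lemma integral_sq_mul_deriv {J : Set ℝ} (hJo : IsOpen J) (hJ : IsLowerSet J)
    {f g : ℝ → ℝ} (hf : LocallyIntegrable f) (hg : LocallyIntegrable g)
    (hw : ∀ χ : ℝ → ℝ, ContDiff ℝ ∞ χ → HasCompactSupport χ → tsupport χ ⊆ J →
      ∫ t, f t * deriv χ t = -∫ t, g t * χ t)
    {χ : ℝ → ℝ} (hχ : ContDiff ℝ ∞ χ) (hc : HasCompactSupport χ) (hs : tsupport χ ⊆ J) :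
    ∫ t, f t ^ 2 * deriv χ t = -2 * ∫ t, f t * g t * χ t := by
  have gi : ∀ a b, IntervalIntegrable g volume a b := fun a b =>
    intervalIntegrable_iff.mpr
      ((hg.integrableOn_isCompact isCompact_uIcc).mono_set Set.uIoc_subset_uIcc)
  have ac : ∀ c a b, AbsolutelyContinuousOnInterval (fun t => c + ∫ s in (0 : ℝ)..t, g s) a b := by
    intro c a b
    refine AbsolutelyContinuousOnInterval.add
      (LipschitzOnWith.absolutelyContinuousOnInterval (LipschitzWith.const c).lipschitzOnWith)
      (((gi (min (min a b) 0) (max (max a b) 0)).absolutelyContinuousOnInterval_intervalIntegral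
        (c := 0) (Set.mem_uIcc_of_le (by simp) (by simp))).mono ?_)
    rw [Set.uIcc_of_le (a := min (min a b) 0) (by simp)]
    exact Set.Icc_subset_Icc (min_le_left _ _) (le_max_left _ _)
  have cont : ∀ c, Continuous (fun t => c + ∫ s in (0 : ℝ)..t, g s) := fun c =>
    continuous_const.add (intervalIntegral.continuous_primitive gi 0)
  have hd := _root_.LocallyIntegrable.ae_hasDerivAt_integral hg
  -- integration by parts on a large interval
  have key : ∀ c (v : ℝ → ℝ), (∀ a b, AbsolutelyContinuousOnInterval v a b) →
      HasCompactSupport v →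
      ∫ t, (c + ∫ s in (0 : ℝ)..t, g s) * deriv v t = -∫ t, g t * v t := by
    intro c v hv hvc
    obtain ⟨R, hR, hsub⟩ : ∃ R : ℝ, 0 < R ∧ tsupport v ⊆ Set.Ioo (-R) R := by
      obtain ⟨R, hR, h⟩ := hvc.isCompact.isBounded.subset_ball_lt 0 0
      exact ⟨R, hR, by rwa [Real.ball_zero_eq_Ioo] at h⟩
    have h1 := (ac c (-R) R).integral_mul_deriv_eq_deriv_mul (hv (-R) R)
    have z1 : v R = 0 := image_eq_zero_of_notMem_tsupport fun h => by simpa using hsub h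
    have z2 : v (-R) = 0 := image_eq_zero_of_notMem_tsupport fun h => by simpa using hsub h
    have s1 : Function.support (fun t => (c + ∫ s in (0 : ℝ)..t, g s) * deriv v t) ⊆
        Set.Ioc (-R) R :=
      (Function.support_mul_subset_right _ _).trans (support_deriv_subset.trans
        (hsub.trans Set.Ioo_subset_Ioc_self))
    have s2 : Function.support (fun t => deriv (fun t => c + ∫ s in (0 : ℝ)..t, g s) t * v t) ⊆
        Set.Ioc (-R) R :=
      (Function.support_mul_subset_right _ _).trans ((subset_tsupport v).trans
        (hsub.trans Set.Ioo_subset_Ioc_self))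
    rw [z1, z2, intervalIntegral.integral_eq_integral_of_support_subset s1,
      intervalIntegral.integral_eq_integral_of_support_subset s2] at h1
    · rw [h1]
      simp only [mul_zero, sub_zero, zero_sub, neg_inj]
      refine integral_congr_ae ?_
      filter_upwards [hd] with t ht
      rw [((ht 0).const_add c).deriv]
  have acχ : ∀ {χ : ℝ → ℝ}, ContDiff ℝ ∞ χ → ∀ a b, AbsolutelyContinuousOnInterval χ a b :=
    fun h a b => ContDiffOn.absolutelyContinuousOnInterval (h.of_le (by simp)).contDiffOn
  -- The difference of `f` and a primitive of `g` has zero weak derivative on `J`. Hence `f` agrees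
  -- almost everywhere on `J` with an absolutely continuous function `F`.
  obtain ⟨c, hcon⟩ := ae_eq_const_of_integral_mul_deriv_eq_zero hJo hJ
    (h := fun t => f t - ∫ s in (0 : ℝ)..t, g s)
    (hf.sub (by simpa using (cont 0).locallyIntegrable)) fun χ hχ hc hs => by
      have h1 := hw χ hχ hc hs
      have h2 := key 0 χ (acχ hχ) hc
      simp only [zero_add] at h2
      have c1 : Continuous (deriv χ) := hχ.continuous_deriv (by simp)
      simp_rw [sub_mul]
      rw [integral_sub (integrable_mul_of_hasCompactSupport hf c1 hc.deriv)
        (integrable_mul_of_hasCompactSupport (by simpa using (cont 0).locallyIntegrable) c1 hc.deriv),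
        h1, h2, sub_self]
  set F : ℝ → ℝ := fun t => c + ∫ s in (0 : ℝ)..t, g s with hF
  -- Testing with `F χ` gives `∫ F (F χ)' = -∫ g F χ`. Expanding the left side as `∫ g F χ + ∫ F²
  -- χ'` yields the factor `-2`.
  have h3 := key c (fun t => F t * χ t) (fun a b => (ac c a b).mul (acχ hχ a b)) hc.mul_left
  have eF : ∀ᵐ t, t ∈ J → f t = F t := by
    filter_upwards [hcon] with t ht hJt
    simp only [hF]; linarith [ht hJt]
  have c1 : Continuous (deriv χ) := hχ.continuous_deriv (by simp)
  have i1 : Integrable fun t => g t * (F t * χ t) :=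
    integrable_mul_of_hasCompactSupport hg ((cont c).mul hχ.continuous) hc.mul_left
  have i2 : Integrable fun t => F t ^ 2 * deriv χ t :=
    integrable_mul_of_hasCompactSupport ((cont c).pow 2).locallyIntegrable c1 hc.deriv
  have h4 : ∫ t, F t * deriv (fun t => F t * χ t) t =
      ∫ t, (g t * (F t * χ t) + F t ^ 2 * deriv χ t) := by
    refine integral_congr_ae ?_
    filter_upwards [hd] with t ht
    have e : deriv (fun t => F t * χ t) t = g t * χ t + F t * deriv χ t :=
      (((ht 0).const_add c).mul (hχ.differentiable (by simp) t).hasDerivAt).deriv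
    rw [e]
    ring
  have h5 : ∫ t, F t * deriv (fun t => F t * χ t) t = -∫ t, g t * (F t * χ t) := h3
  rw [h4, integral_add i1 i2] at h5
  have h6 : ∫ t, f t ^ 2 * deriv χ t = ∫ t, F t ^ 2 * deriv χ t := by
    refine integral_congr_ae ?_
    filter_upwards [eF] with t ht
    by_cases hJt : t ∈ J
    · rw [ht hJt]
    · have : deriv χ t = 0 := by
        by_contra h
        exact hJt (hs (support_deriv_subset h))
      simp [this]
  have h7 : ∫ t, f t * g t * χ t = ∫ t, g t * (F t * χ t) := by
    refine integral_congr_ae ?_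
    filter_upwards [eF] with t ht
    by_cases hJt : t ∈ J
    · rw [ht hJt]; ring
    · simp [image_eq_zero_of_notMem_tsupport fun h => hJt (hs h)]
  rw [h6, h7]
  linarith

/-- A nonnegative integrable function with `E' ≤ -lam E` weakly on an open lower set vanishes. -/
lemma ae_eq_zero_of_decay {J : Set ℝ} (hJo : IsOpen J) (hJ : IsLowerSet J) {lam : ℝ}
    (hlam : 0 < lam) {E : ℝ → ℝ} (hE : Integrable E) (h0 : ∀ t, 0 ≤ E t)
    (hw : ∀ χ : ℝ → ℝ, ContDiff ℝ ∞ χ → HasCompactSupport χ → tsupport χ ⊆ J → (∀ t, 0 ≤ χ t) →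
      lam * ∫ t, E t * χ t ≤ ∫ t, E t * deriv χ t) :
    ∀ᵐ t, t ∈ J → E t = 0 := by
  set S := Real.smoothTransition with hS
  have cS : ContDiff ℝ ∞ S := Real.smoothTransition.contDiff (n := ⊤)
  have dS : ∀ t, HasDerivAt S (deriv S t) t := fun t =>
    (cS.differentiable (by simp) t).hasDerivAt
  have nS : ∀ t, 0 ≤ deriv S t := fun t => Real.smoothTransition.monotone.deriv_nonneg
  obtain ⟨C, hC⟩ : ∃ C, ∀ t, deriv S t ≤ C := by
    have hcs : HasCompactSupport (deriv S) := by
      refine HasCompactSupport.intro (isCompact_Icc (a := (0 : ℝ)) (b := 1)) fun t ht => ?_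
      rw [Set.mem_Icc, not_and_or, not_le, not_le] at ht
      rcases ht with h | h
      · have : S =ᶠ[nhds t] fun _ => 0 := by
          filter_upwards [gt_mem_nhds h] with s hs
          exact Real.smoothTransition.zero_of_nonpos hs.le
        rw [this.deriv_eq]; simp
      · have : S =ᶠ[nhds t] fun _ => 1 := by
          filter_upwards [lt_mem_nhds h] with s hs
          exact Real.smoothTransition.one_of_one_le hs.le
        rw [this.deriv_eq]; simp
    obtain ⟨C, hC⟩ := hcs.exists_bound_of_continuous (cS.continuous_deriv (by simp))
    exact ⟨C, fun t => (le_abs_self _).trans (hC t)⟩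
  have hC0 : 0 ≤ C := (nS 0).trans (hC 0)
  have hgt : ∀ t ∈ J, ∃ s ∈ J, t < s := by
    intro t ht
    obtain ⟨r, hr, h⟩ := Metric.isOpen_iff.1 hJo t ht
    exact ⟨t + r / 2, h (by simp [abs_of_pos hr]; linarith), by linarith⟩
  have hIE : 0 ≤ ∫ t, E t := integral_nonneg h0
  have key : ∀ τ ∈ J, ∀ n : ℕ, 0 < n →
      lam * ∫ t in Set.Icc (-(n : ℝ)) τ, E t ≤ C / n * ∫ t, E t := by
    intro τ hτ n hn
    obtain ⟨σ, hσ, hτσ⟩ := hgt τ hτ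
    have hn' : (0 : ℝ) < n := by exact_mod_cast hn
    have hσ' : 0 < σ - τ := sub_pos.2 hτσ
    -- A cutoff equal to `1` on `[-n, τ]` and supported in `[-2n, σ]`, with `σ ∈ J` slightly beyond
    -- `τ`.
    set χ : ℝ → ℝ := fun t => S (t / n + 2) * S ((σ - t) / (σ - τ)) with hχ
    have cχ : ContDiff ℝ ∞ χ := by
      refine (cS.comp ?_).mul (cS.comp ?_) <;> fun_prop
    have sχ : tsupport χ ⊆ Set.Icc (-(2 * n)) σ := by
      refine closure_minimal (fun t ht => ?_) isClosed_Icc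
      by_contra hn
      apply ht
      rw [Set.mem_Icc, not_and_or, not_le, not_le] at hn
      rcases hn with h | h
      · have : t / n + 2 ≤ 0 := by
          have : t / n ≤ -2 := by rw [div_le_iff₀ hn']; linarith
          linarith
        simp only [hχ, hS, Real.smoothTransition.zero_of_nonpos this, zero_mul]
      · have : (σ - t) / (σ - τ) ≤ 0 := div_nonpos_of_nonpos_of_nonneg (by linarith) hσ'.le
        simp only [hχ, hS, Real.smoothTransition.zero_of_nonpos this, mul_zero]
    have kχ : HasCompactSupport χ :=
      isCompact_Icc.of_isClosed_subset (isClosed_tsupport _) sχ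
    have nχ : ∀ t, 0 ≤ χ t := fun t =>
      mul_nonneg (Real.smoothTransition.nonneg _) (Real.smoothTransition.nonneg _)
    have h1 := hw χ cχ kχ (fun t ht => hJ (sχ ht).2 hσ) nχ
    -- Only an upper bound is needed. The factor falling from `τ` to `σ` contributes a nonpositive
    -- term however steep it is, and the rising factor has slope at most `C / n`.
    have dχ : ∀ t, deriv χ t ≤ C / n := by
      intro t
      have e1 : HasDerivAt (fun t : ℝ => t / n + 2) (1 / n) t :=
        ((hasDerivAt_id t).div_const (n : ℝ)).add_const 2
      have e2 : HasDerivAt (fun t : ℝ => (σ - t) / (σ - τ)) (-1 / (σ - τ)) t :=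
        ((hasDerivAt_id t).const_sub σ).div_const _
      have e3 := (((dS _).comp t e1).mul ((dS _).comp t e2)).deriv
      change deriv χ t = _ at e3
      rw [e3]
      have a1 : deriv S (t / n + 2) * (1 / n) * S ((σ - t) / (σ - τ)) ≤ C / n := by
        calc _ ≤ deriv S (t / n + 2) * (1 / n) * 1 :=
              mul_le_mul_of_nonneg_left (Real.smoothTransition.le_one _)
                (mul_nonneg (nS _) (by positivity))
          _ ≤ C / n := by
              rw [mul_one, mul_one_div]
              exact div_le_div_of_nonneg_right (hC _) hn'.le
      have a2 : S (t / n + 2) * (deriv S ((σ - t) / (σ - τ)) * (-1 / (σ - τ))) ≤ 0 :=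
        mul_nonpos_of_nonneg_of_nonpos (Real.smoothTransition.nonneg _)
          (mul_nonpos_of_nonneg_of_nonpos (nS _)
            (div_nonpos_of_nonpos_of_nonneg (by norm_num) hσ'.le))
      simp only [Function.comp_apply]
      linarith
    have iχ : Integrable fun t => E t * χ t :=
      integrable_mul_of_hasCompactSupport hE.locallyIntegrable cχ.continuous kχ
    have h2 : ∫ t in Set.Icc (-(n : ℝ)) τ, E t ≤ ∫ t, E t * χ t := by
      rw [← integral_indicator measurableSet_Icc]
      refine integral_mono (hE.indicator measurableSet_Icc) iχ fun t => ?_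
      by_cases ht : t ∈ Set.Icc (-(n : ℝ)) τ
      · have b1 : 1 ≤ t / n + 2 := by
          have : -1 ≤ t / n := by rw [le_div_iff₀ hn']; linarith [ht.1]
          linarith
        have b2 : 1 ≤ (σ - t) / (σ - τ) := by rw [le_div_iff₀ hσ']; linarith [ht.2]
        simp only [Set.indicator_of_mem ht, hχ, hS, Real.smoothTransition.one_of_one_le b1,
          Real.smoothTransition.one_of_one_le b2, mul_one, le_refl]
      · simp only [Set.indicator_of_notMem ht]
        exact mul_nonneg (h0 t) (nχ t)
    have h3 : ∫ t, E t * deriv χ t ≤ C / n * ∫ t, E t := by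
      rw [← integral_const_mul]
      refine integral_mono (integrable_mul_of_hasCompactSupport hE.locallyIntegrable
        (cχ.continuous_deriv (by simp)) kχ.deriv) (hE.const_mul _) fun t => ?_
      change E t * deriv χ t ≤ C / n * E t
      rw [mul_comm]
      exact mul_le_mul_of_nonneg_right (dχ t) (h0 t)
    exact (mul_le_mul_of_nonneg_left h2 hlam.le).trans (h1.trans h3)
  have van : ∀ τ ∈ J, ∀ m : ℕ, ∀ᵐ t, t ∈ Set.Icc (-(m : ℝ)) τ → E t = 0 := by
    intro τ hτ m
    have hle : lam * ∫ t in Set.Icc (-(m : ℝ)) τ, E t ≤ 0 := by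
      -- For `n > m` the integral over `[-m, τ]` is at most that over `[-n, τ]`, and the bound `C /
      -- n * ∫ E` tends to zero because `E` is integrable.
      refine ge_of_tendsto (f := fun n : ℕ => C / n * ∫ t, E t) (x := Filter.atTop) ?_ ?_
      · simpa using (tendsto_const_div_atTop_nhds_zero_nat C).mul_const (∫ t, E t)
      · filter_upwards [Filter.eventually_ge_atTop (m + 1)] with n hn
        refine le_trans (mul_le_mul_of_nonneg_left ?_ hlam.le) (key τ hτ n (by omega))
        refine setIntegral_mono_set hE.integrableOn (.of_forall h0)
          (LE.le.eventuallyLE (Set.Icc_subset_Icc_left ?_))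
        have : (m : ℝ) ≤ n := by exact_mod_cast (by omega : m ≤ n)
        linarith
    have hz : ∫ t in Set.Icc (-(m : ℝ)) τ, E t = 0 :=
      le_antisymm (by nlinarith) (integral_nonneg h0)
    have := (setIntegral_eq_zero_iff_of_nonneg_ae (.of_forall h0) hE.integrableOn).1 hz
    exact (ae_restrict_iff' measurableSet_Icc).1 this
  -- Rational endpoints keep the number of exceptional null sets countable.
  have all : ∀ᵐ t, ∀ (q : ℚ) (m : ℕ), (q : ℝ) ∈ J → t ∈ Set.Icc (-(m : ℝ)) q → E t = 0 := by
    rw [ae_all_iff]; intro q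
    rw [ae_all_iff]; intro m
    by_cases hq : (q : ℝ) ∈ J
    · filter_upwards [van q hq m] with t ht _ h using ht h
    · exact .of_forall fun t h => absurd h hq
  filter_upwards [all] with t ht hJt
  obtain ⟨s, hs, hts⟩ := hgt t hJt
  obtain ⟨q, hq1, hq2⟩ := exists_rat_btwn hts
  obtain ⟨m, hm⟩ := exists_nat_ge (-t)
  exact ht q m (hJ hq2.le hs) ⟨by linarith, hq1.le⟩

/-! ### Mollification in space and dissipation. -/

lemma contDiff_fderiv_apply {E : Type*} [NormedAddCommGroup E] [NormedSpace ℝ E] {ρ : E → ℝ}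
    (hρ : ContDiff ℝ ∞ ρ) (v : E) : ContDiff ℝ ∞ fun z => fderiv ℝ ρ z v :=
  (hρ.fderiv_right (by simp)).clm_apply contDiff_const

lemma fderiv_fderiv_apply {E : Type*} [NormedAddCommGroup E] [NormedSpace ℝ E] {ρ : E → ℝ}
    (hρ : ContDiff ℝ ∞ ρ) (z v w : E) :
    fderiv ℝ (fun z => fderiv ℝ ρ z v) z w = fderiv ℝ (fderiv ℝ ρ) z w v := by
  have h : DifferentiableAt ℝ (fderiv ℝ ρ) z :=
    (hρ.fderiv_right (m := ∞) (by simp)).differentiable (by simp) z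
  rw [fderiv_clm_apply h (differentiableAt_const v)]
  simp

/-- Integrated form of the nonnegativity of a quadratic form. -/
lemma sum_mul_integral_mul_nonneg {α : Type*} [MeasurableSpace α] {μ : Measure α} {d : ℕ}
    {A : Fin d → Fin d → ℝ} (hA : ∀ ξ : Fin d → ℝ, 0 ≤ ∑ i, ∑ j, A i j * ξ i * ξ j)
    {W : Fin d → α → ℝ} (hW : ∀ i, MemLp (W i) 2 μ) :
    0 ≤ ∑ i, ∑ j, A i j * ∫ q, W i q * W j q ∂μ := by
  have i1 : ∀ i j, Integrable (fun q => A i j * (W i q * W j q)) μ := fun i j =>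
    ((hW i).integrable_mul (hW j)).const_mul _
  simp_rw [← integral_const_mul]
  rw [Finset.sum_congr rfl fun i _ => (integral_finsetSum _ fun j _ => i1 i j).symm,
    ← integral_finsetSum _ fun i _ => integrable_finsetSum _ fun j _ => i1 i j]
  refine integral_nonneg fun q => (hA fun i => W i q).trans (le_of_eq ?_)
  simp_rw [mul_assoc]

section Mollification

variable {E : Type*} [NormedAddCommGroup E] [NormedSpace ℝ E] [FiniteDimensional ℝ E]
  [MeasurableSpace E] [BorelSpace E] {μ : Measure E} [μ.IsAddHaarMeasure]

/-- Convolution in the second variable with a kernel depending on the first one. -/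
def mol (μ : Measure E) (K : ℝ → E → ℝ) (F : ℝ × E → ℝ) (p : ℝ × E) : ℝ :=
  ∫ q', K p.1 (p.2 - q') * F (p.1, q') ∂μ

lemma stronglyMeasurable_mol {K : ℝ → E → ℝ} (hK : Continuous (Function.uncurry K))
    {F : ℝ × E → ℝ} (hF : StronglyMeasurable F) : StronglyMeasurable (mol μ K F) := by
  have h1 : StronglyMeasurable fun x : (ℝ × E) × E => K x.1.1 (x.1.2 - x.2) * F (x.1.1, x.2) := by
    refine StronglyMeasurable.mul ?_ (hF.comp_measurable (by fun_prop))
    exact (hK.comp (f := fun x : (ℝ × E) × E => (x.1.1, x.1.2 - x.2))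
      (by fun_prop)).stronglyMeasurable
  exact h1.integral_prod_right

/-- Young's inequality for the convolution of `L¹` and `L²`. -/
lemma lintegral_enorm_integral_sub_mul_sq_le {k G : E → ℝ} (hk : Measurable k)
    (hG : Measurable G) :
    ∫⁻ q, ‖∫ q', k (q - q') * G q' ∂μ‖ₑ ^ 2 ∂μ ≤
      (∫⁻ z, ‖k z‖ₑ ∂μ) ^ 2 * ∫⁻ q, ‖G q‖ₑ ^ 2 ∂μ := by
  have h1 : ∀ q, ‖∫ q', k (q - q') * G q' ∂μ‖ₑ ^ 2 ≤
      (∫⁻ z, ‖k z‖ₑ ∂μ) * ∫⁻ q', ‖k (q - q')‖ₑ * ‖G q'‖ₑ ^ 2 ∂μ := by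
    intro q
    have e : ∫⁻ q', ‖k (q - q')‖ₑ ∂μ = ∫⁻ z, ‖k z‖ₑ ∂μ :=
      lintegral_sub_left_eq_self (fun z => ‖k z‖ₑ) q
    rw [← e]
    -- Cauchy–Schwarz with weight `|k(q - ·)|`, whose mass does not depend on `q`; the second factor
    -- of that mass comes from Tonelli's theorem.
    refine le_trans ?_ (lintegral_mul_sq_le (by fun_prop) (by fun_prop))
    gcongr
    refine (enorm_integral_le_lintegral_enorm _).trans (le_of_eq ?_)
    simp_rw [enorm_mul]
  calc _ ≤ ∫⁻ q, (∫⁻ z, ‖k z‖ₑ ∂μ) * ∫⁻ q', ‖k (q - q')‖ₑ * ‖G q'‖ₑ ^ 2 ∂μ ∂μ :=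
        lintegral_mono h1
    _ = (∫⁻ z, ‖k z‖ₑ ∂μ) * ∫⁻ q, ∫⁻ q', ‖k (q - q')‖ₑ * ‖G q'‖ₑ ^ 2 ∂μ ∂μ :=
        lintegral_const_mul _ (Measurable.lintegral_prod_right (by fun_prop))
    _ = (∫⁻ z, ‖k z‖ₑ ∂μ) * ∫⁻ q', ∫⁻ q, ‖k (q - q')‖ₑ * ‖G q'‖ₑ ^ 2 ∂μ ∂μ := by
        rw [lintegral_lintegral_swap (by fun_prop)]
    _ = _ := by
        rw [sq, mul_assoc]
        congr 1
        rw [← lintegral_const_mul _ (by fun_prop)]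
        refine lintegral_congr fun q' => ?_
        rw [lintegral_mul_const _ (by fun_prop)]
        congr 1
        exact lintegral_sub_right_eq_self (fun z => ‖k z‖ₑ) q'

lemma memLp_integral_sub_mul {k G : E → ℝ} (hk : Continuous k) (hc : HasCompactSupport k)
    (hG : Measurable G) (hG2 : MemLp G 2 μ) : MemLp (fun q => ∫ q', k (q - q') * G q' ∂μ) 2 μ := by
  have m : StronglyMeasurable fun x : E × E => k (x.1 - x.2) * G x.2 :=
    Measurable.stronglyMeasurable (by have := hk.measurable; fun_prop)
  refine memLp_two_of_lintegral m.integral_prod_right.aestronglyMeasurable ?_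
  refine (lintegral_enorm_integral_sub_mul_sq_le hk.measurable hG).trans_lt ?_
  exact ENNReal.mul_lt_top (ENNReal.pow_lt_top (hk.integrable_of_hasCompactSupport hc).2)
    (lintegral_sq_lt_top hG2)

lemma memLp_mol {k : E → ℝ} (hk : Continuous k) (hc : HasCompactSupport k) {F : ℝ × E → ℝ}
    (hF : StronglyMeasurable F) (hF2 : MemLp F 2 (volume.prod μ)) :
    MemLp (mol μ (fun _ => k) F) 2 (volume.prod μ) := by
  have m : StronglyMeasurable (mol μ (fun _ => k) F) :=
    stronglyMeasurable_mol (K := fun _ => k) (hk.comp continuous_snd) hF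
  refine memLp_two_of_lintegral m.aestronglyMeasurable ?_
  have h2 := lintegral_sq_lt_top hF2
  rw [lintegral_prod _ (m.enorm.pow_const 2).aemeasurable]
  rw [lintegral_prod _ (hF.enorm.pow_const 2).aemeasurable] at h2
  calc _ ≤ ∫⁻ t, (∫⁻ z, ‖k z‖ₑ ∂μ) ^ 2 * ∫⁻ q, ‖F (t, q)‖ₑ ^ 2 ∂μ :=
        lintegral_mono fun t => lintegral_enorm_integral_sub_mul_sq_le hk.measurable
          (hF.measurable.comp measurable_prodMk_left)
    _ = (∫⁻ z, ‖k z‖ₑ ∂μ) ^ 2 * ∫⁻ t, ∫⁻ q, ‖F (t, q)‖ₑ ^ 2 ∂μ :=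
        lintegral_const_mul _ (hF.enorm.pow_const 2).lintegral_prod_right'
    _ < ⊤ := ENNReal.mul_lt_top (ENNReal.pow_lt_top (hk.integrable_of_hasCompactSupport hc).2) h2

lemma integral_sub_mul_eq_convolution (k G : E → ℝ) (q : E) :
    ∫ q', k (q - q') * G q' ∂μ = (convolution k G (ContinuousLinearMap.lsmul ℝ ℝ) μ) q := by
  rw [convolution_lsmul_swap]; rfl

/-- Differentiation of a convolution with a smooth kernel. -/
lemma hasFDerivAt_integral_sub_mul {ρ G : E → ℝ} (hρ : ContDiff ℝ ∞ ρ) (hc : HasCompactSupport ρ)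
    (hG : LocallyIntegrable G μ) (q v : E) :
    DifferentiableAt ℝ (fun q => ∫ q', ρ (q - q') * G q' ∂μ) q ∧
      fderiv ℝ (fun q => ∫ q', ρ (q - q') * G q' ∂μ) q v =
        ∫ q', fderiv ℝ ρ (q - q') v * G q' ∂μ := by
  have h := hc.hasFDerivAt_convolution_left (ContinuousLinearMap.lsmul ℝ ℝ) (μ := μ)
    (hρ.of_le (by simp)) hG q
  have e : (fun q => ∫ q', ρ (q - q') * G q' ∂μ) =
      convolution ρ G (ContinuousLinearMap.lsmul ℝ ℝ) μ :=
    funext fun q => integral_sub_mul_eq_convolution ρ G q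
  rw [e]
  refine ⟨h.differentiableAt, ?_⟩
  rw [h.fderiv, convolution_eq_swap, ContinuousLinearMap.integral_apply]
  · rfl
  · have h1 : ConvolutionExists (fderiv ℝ ρ) G
        ((ContinuousLinearMap.lsmul ℝ ℝ).precompL E) μ :=
      hc.fderiv ℝ |>.convolutionExists_left _ (hρ.continuous_fderiv (by simp)) hG
    exact (h1 q).integrable_swap

/-- Integration by parts for mollified functions. -/
lemma integral_mul_second_derivative {ρ G : E → ℝ} (hρ : ContDiff ℝ ∞ ρ)
    (hc : HasCompactSupport ρ) (hG : Measurable G) (hG2 : MemLp G 2 μ) (v w : E) :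
    ∫ q, (∫ q', ρ (q - q') * G q' ∂μ) *
        (∫ q', fderiv ℝ (fderiv ℝ ρ) (q - q') w v * G q' ∂μ) ∂μ =
      -∫ q, (∫ q', fderiv ℝ ρ (q - q') w * G q' ∂μ) *
        (∫ q', fderiv ℝ ρ (q - q') v * G q' ∂μ) ∂μ := by
  have hl : LocallyIntegrable G μ := hG2.locallyIntegrable (by norm_num)
  have cv := contDiff_fderiv_apply hρ v
  have cw := contDiff_fderiv_apply hρ w
  have sv := hc.fderiv_apply ℝ v
  have sw := hc.fderiv_apply ℝ w
  have cvw := contDiff_fderiv_apply cv w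
  have svw := sv.fderiv_apply ℝ w
  have m0 := memLp_integral_sub_mul hρ.continuous hc hG hG2
  have mv := memLp_integral_sub_mul cv.continuous sv hG hG2
  have mw := memLp_integral_sub_mul cw.continuous sw hG hG2
  have mvw := memLp_integral_sub_mul cvw.continuous svw hG hG2
  have d0 := fun q => hasFDerivAt_integral_sub_mul hρ hc hl q w
  have dv := fun q => hasFDerivAt_integral_sub_mul cv sv hl q w
  simp_rw [← fderiv_fderiv_apply hρ]
  have h := integral_mul_fderiv_eq_neg_fderiv_mul_of_integrable (μ := μ) (𝕜 := ℝ)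
    (f := fun q => ∫ q', ρ (q - q') * G q' ∂μ)
    (g := fun q => ∫ q', fderiv ℝ ρ (q - q') v * G q' ∂μ) (v := w)
  simp_rw [fun q => (d0 q).2, fun q => (dv q).2] at h
  exact h (mw.integrable_mul mv) (m0.integrable_mul mvw) (m0.integrable_mul mv)
    (fun q _ => (d0 q).1) (fun q _ => (dv q).1)

/-- A nonnegative quadratic form in the derivatives is dissipative. -/
lemma sum_mul_integral_second_derivative_nonpos {d : ℕ} {A : Fin d → Fin d → ℝ}
    (hA : ∀ ξ : Fin d → ℝ, 0 ≤ ∑ i, ∑ j, A i j * ξ i * ξ j) (e : Fin d → E) {ρ G : E → ℝ}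
    (hρ : ContDiff ℝ ∞ ρ) (hc : HasCompactSupport ρ) (hG : Measurable G) (hG2 : MemLp G 2 μ) :
    ∑ i, ∑ j, A i j * ∫ q, (∫ q', ρ (q - q') * G q' ∂μ) *
      (∫ q', fderiv ℝ (fderiv ℝ ρ) (q - q') (e i) (e j) * G q' ∂μ) ∂μ ≤ 0 := by
  have m : ∀ i, MemLp (fun q => ∫ q', fderiv ℝ ρ (q - q') (e i) * G q' ∂μ) 2 μ := fun i =>
    memLp_integral_sub_mul (contDiff_fderiv_apply hρ (e i)).continuous
      (hc.fderiv_apply ℝ (e i)) hG hG2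
  -- One integration by parts turns the sum into minus the quadratic form evaluated on the first
  -- derivatives of the mollified function. No boundary term appears, since all the products are
  -- integrable.
  simp_rw [integral_mul_second_derivative hρ hc hG hG2, mul_neg, Finset.sum_neg_distrib]
  rw [neg_nonpos]
  exact sum_mul_integral_mul_nonneg hA m

end Mollification

lemma hasCompactSupport_mul_comp_sub {E : Type*} [NormedAddCommGroup E] {K : ℝ → E → ℝ} {B : Set E}
    (hB : IsCompact B) (hKB : ∀ t z, z ∉ B → K t z = 0) {c : ℝ → ℝ} (hc : HasCompactSupport c)
    (q : E) : HasCompactSupport fun p : ℝ × E => c p.1 * K p.1 (q - p.2) := by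
  refine HasCompactSupport.intro (hc.isCompact.prod (hB.image (continuous_const.sub continuous_id)
    : IsCompact ((fun z => q - z) '' B))) fun p hp => ?_
  rw [Set.mem_prod, not_and_or] at hp
  rcases hp with h | h
  · rw [image_eq_zero_of_notMem_tsupport h, zero_mul]
  · rw [hKB _ _ fun h1 => h ⟨q - p.2, h1, by simp⟩, mul_zero]

/-- By Fubini's theorem, testing `F` against `c(t) K(t, q - q')` on space-time is the same as
testing its mollification at the point `q` against `c` in time alone. -/
lemma integral_mul_kernel_eq {E : Type*} [NormedAddCommGroup E] [MeasurableSpace E] {μ : Measure E}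
    [SFinite μ] {K : ℝ → E → ℝ} {F : ℝ × E → ℝ} {c : ℝ → ℝ} {q : E}
    (h : Integrable (fun p : ℝ × E => F p * (c p.1 * K p.1 (q - p.2))) (volume.prod μ)) :
    ∫ p, F p * (c p.1 * K p.1 (q - p.2)) ∂(volume.prod μ) = ∫ t, mol μ K F (t, q) * c t := by
  rw [integral_prod _ h]
  refine integral_congr_ae (.of_forall fun t => ?_)
  simp only [mol]
  rw [← integral_mul_const]
  refine integral_congr_ae (.of_forall fun q' => ?_)
  simp only; ring

/-- The kernel of the second derivative of a mollification along moving directions. -/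
lemma continuous_second_derivative_kernel {E : Type*} [NormedAddCommGroup E]
    [NormedSpace ℝ E] {ρ : E → ℝ} (hρ : ContDiff ℝ ∞ ρ) {v w : ℝ → E}
    (hv : Continuous v) (hw : Continuous w) :
    Continuous (Function.uncurry fun t z => fderiv ℝ (fderiv ℝ ρ) z (v t) (w t)) := by
  have h : Continuous (fderiv ℝ (fderiv ℝ ρ)) :=
    (hρ.fderiv_right (m := ∞) (by simp)).continuous_fderiv (by simp)
  exact ((h.comp continuous_snd).clm_apply (hv.comp continuous_fst)).clm_apply
    (hw.comp continuous_fst)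

lemma fderiv_fderiv_eq_zero {E : Type*} [NormedAddCommGroup E] [NormedSpace ℝ E] {ρ : E → ℝ} {z : E} (hz : z ∉ tsupport ρ) :
    fderiv ℝ (fderiv ℝ ρ) z = 0 :=
  image_eq_zero_of_notMem_tsupport fun h =>
    hz (tsupport_fderiv_subset ℝ (tsupport_fderiv_subset ℝ h))

lemma memLp_sum_coeff {β : Type*} [MeasurableSpace β] {ν : Measure (ℝ × β)} {d : ℕ}
    {a : Fin d → Fin d → ℝ → ℝ} (ma : ∀ i j, Measurable (a i j))
    {C : ℝ} (ba : ∀ i j t, |a i j t| ≤ C) {H : Fin d → Fin d → ℝ × β → ℝ}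
    (hH : ∀ i j, MemLp (H i j) 2 ν) :
    MemLp (fun p => ∑ i, ∑ j, a i j p.1 * H i j p) 2 ν := by
  refine memLp_finsetSum _ fun i _ => memLp_finsetSum _ fun j _ => ?_
  exact (hH i j).of_le_mul (c := C)
    (((ma i j).comp measurable_fst).aestronglyMeasurable.mul (hH i j).1)
    (.of_forall fun X => by
      rw [norm_mul]; exact mul_le_mul_of_nonneg_right (ba i j X.1) (norm_nonneg _))

lemma stronglyMeasurable_sum_coeff {β : Type*} [MeasurableSpace β] {d : ℕ}
    {a : Fin d → Fin d → ℝ → ℝ} (ma : ∀ i j, Measurable (a i j))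
    {H : Fin d → Fin d → ℝ × β → ℝ} (mH : ∀ i j, StronglyMeasurable (H i j)) :
    StronglyMeasurable fun p => ∑ i, ∑ j, a i j p.1 * H i j p :=
  Finset.stronglyMeasurable_fun_sum _ fun i _ => Finset.stronglyMeasurable_fun_sum _ fun j _ =>
    ((ma i j).comp measurable_fst).stronglyMeasurable.mul (mH i j)

lemma integral_mul_sum_sub_le {α : Type*} [MeasurableSpace α] {μ : Measure α} {d : ℕ}
    {A : Fin d → Fin d → ℝ} {lam : ℝ} {w : α → ℝ} {h : Fin d → Fin d → α → ℝ}
    (hw : MemLp w 2 μ) (hh : ∀ i j, MemLp (h i j) 2 μ)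
    (hle : ∑ i, ∑ j, A i j * ∫ q, w q * h i j q ∂μ ≤ 0) :
    ∫ q, w q * (∑ i, ∑ j, A i j * h i j q - lam * w q) ∂μ ≤ -lam * ∫ q, w q ^ 2 ∂μ := by
  have i1 : ∀ i j, Integrable (fun q => A i j * (w q * h i j q)) μ := fun i j =>
    (hw.integrable_mul (hh i j)).const_mul _
  have e1 : ∀ q, w q * (∑ i, ∑ j, A i j * h i j q - lam * w q) =
      ∑ i, ∑ j, A i j * (w q * h i j q) - lam * w q ^ 2 := by
    intro q
    simp only [mul_sub, Finset.mul_sum]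
    congr 1
    · refine Finset.sum_congr rfl fun i _ => Finset.sum_congr rfl fun j _ => by ring
    · ring
  simp_rw [e1]
  rw [integral_sub (integrable_finsetSum _ fun i _ => integrable_finsetSum _ fun j _ => i1 i j)
    (hw.integrable_sq.const_mul _), integral_const_mul,
    integral_finsetSum _ fun i _ => integrable_finsetSum _ fun j _ => i1 i j]
  have e2 : ∀ i, ∫ q, ∑ j, A i j * (w q * h i j q) ∂μ = ∑ j, A i j * ∫ q, w q * h i j q ∂μ := by
    intro i
    rw [integral_finsetSum _ fun j _ => i1 i j]
    simp_rw [integral_const_mul]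
  simp_rw [e2]
  linarith

/-- The energy identity for a family of functions with weak time derivatives. -/
lemma integral_energy_mul_deriv {β : Type*} [MeasurableSpace β] {μ : Measure β} [SFinite μ]
    {J : Set ℝ} (hJo : IsOpen J) (hJ : IsLowerSet J) {V Z : ℝ × β → ℝ}
    (hV : MemLp V 2 (volume.prod μ)) (hZ : MemLp Z 2 (volume.prod μ))
    (lV : ∀ q, LocallyIntegrable fun t => V (t, q)) (lZ : ∀ q, LocallyIntegrable fun t => Z (t, q))
    (hw : ∀ q (χ : ℝ → ℝ), ContDiff ℝ ∞ χ → HasCompactSupport χ → tsupport χ ⊆ J →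
      ∫ t, V (t, q) * deriv χ t = -∫ t, Z (t, q) * χ t)
    {χ : ℝ → ℝ} (hχ : ContDiff ℝ ∞ χ) (hc : HasCompactSupport χ) (hs : tsupport χ ⊆ J) :
    ∫ t, (∫ q, V (t, q) ^ 2 ∂μ) * deriv χ t = -2 * ∫ t, (∫ q, V (t, q) * Z (t, q) ∂μ) * χ t := by
  have mulb : ∀ {F : ℝ × β → ℝ} {c : ℝ → ℝ}, Integrable F (volume.prod μ) → Continuous c →
      HasCompactSupport c → Integrable (fun p => F p * c p.1) (volume.prod μ) := by
    intro F c hF hcc hcs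
    obtain ⟨M, hM⟩ := hcs.exists_bound_of_continuous hcc
    exact hF.mul_bdd (c := M) (hcc.measurable.comp measurable_fst).aestronglyMeasurable
      (.of_forall fun p => hM p.1)
  have i1 := mulb hV.integrable_sq (hχ.continuous_deriv (by simp)) hc.deriv
  have i2 := mulb (hV.integrable_mul hZ) hχ.continuous hc
  calc _ = ∫ t, ∫ q, V (t, q) ^ 2 * deriv χ t ∂μ := by simp_rw [integral_mul_const]
    _ = ∫ q, (∫ t, V (t, q) ^ 2 * deriv χ t) ∂μ := integral_integral_swap i1
    _ = ∫ q, (-2 * ∫ t, V (t, q) * Z (t, q) * χ t) ∂μ := by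
        simp_rw [fun q => integral_sq_mul_deriv hJo hJ (lV q) (lZ q) (hw q) hχ hc hs]
    _ = -2 * ∫ q, (∫ t, V (t, q) * Z (t, q) * χ t) ∂μ := integral_const_mul _ _
    _ = -2 * ∫ t, ∫ q, V (t, q) * Z (t, q) * χ t ∂μ := by
        rw [integral_integral_swap (f := fun t q => V (t, q) * Z (t, q) * χ t) i2]
    _ = _ := by simp_rw [integral_mul_const]

/-! ### Energy decay for mollified solutions. -/

section Uniqueness

variable {E : Type*} [NormedAddCommGroup E] [NormedSpace ℝ E] [FiniteDimensional ℝ E]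
  [MeasurableSpace E] [BorelSpace E] {μ : Measure E} [μ.IsAddHaarMeasure]

lemma integrable_mul_kernel {K : ℝ → E → ℝ} (hK : Continuous (Function.uncurry K)) {B : Set E}
    (hB : IsCompact B) (hKB : ∀ t z, z ∉ B → K t z = 0) {F : ℝ × E → ℝ}
    (hF2 : MemLp F 2 (volume.prod μ)) {c : ℝ → ℝ} (hc : Continuous c) (hcs : HasCompactSupport c)
    (q : E) : Integrable (fun p : ℝ × E => F p * (c p.1 * K p.1 (q - p.2))) (volume.prod μ) := by
  have h1 : Continuous fun p : ℝ × E => c p.1 * K p.1 (q - p.2) :=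
    (hc.comp continuous_fst).mul
      (hK.comp (f := fun p : ℝ × E => (p.1, q - p.2)) (by fun_prop))
  have h2 := (hF2.locallyIntegrable (by norm_num)).integrable_smul_left_of_hasCompactSupport h1
    (hasCompactSupport_mul_comp_sub hB hKB hcs q)
  simpa [mul_comm] using h2

/-- This holds for every `q`, not only for almost every one: `F` is locally integrable on space-time
and the kernel is continuous with support in a fixed compact set. The scalar lemmas can therefore be
applied at each point. -/
lemma locallyIntegrable_mol {K : ℝ → E → ℝ} (hK : Continuous (Function.uncurry K)) {B : Set E}
    (hB : IsCompact B) (hKB : ∀ t z, z ∉ B → K t z = 0) {F : ℝ × E → ℝ}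
    (hF2 : MemLp F 2 (volume.prod μ)) (q : E) : LocallyIntegrable fun t => mol μ K F (t, q) := by
  intro t₀
  let b : ContDiffBump t₀ := ⟨1, 2, by norm_num, by norm_num⟩
  have h := (integrable_mul_kernel hK hB hKB hF2 b.continuous b.hasCompactSupport q).integral_prod_left
  refine ⟨Metric.closedBall t₀ 1, Metric.closedBall_mem_nhds _ one_pos, ?_⟩
  refine (h.integrableOn (s := Metric.closedBall t₀ 1)).congr_fun (fun t ht => ?_)
    Metric.isClosed_closedBall.measurableSet
  simp only [mol, b.one_of_mem_closedBall ht, one_mul]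
  refine integral_congr_ae (.of_forall fun q' => ?_)
  simp only; ring

/-- Weak second derivatives of mollified functions are classical. -/
lemma ae_mol_second_derivative_eq {J : Set ℝ} (hJo : IsOpen J) {ρ : E → ℝ} (hρ : ContDiff ℝ ∞ ρ)
    (hc : HasCompactSupport ρ) {v w : ℝ → E} (hv : Continuous v) (hw : Continuous w)
    {U H : ℝ × E → ℝ} (mU : StronglyMeasurable U) (mH : StronglyMeasurable H)
    (hU : MemLp U 2 (volume.prod μ)) (hH : MemLp H 2 (volume.prod μ))
    (hw2 : ∀ (χ : ℝ → ℝ) (q : E), ContDiff ℝ ∞ χ → HasCompactSupport χ → tsupport χ ⊆ J →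
      ∫ p, U p * (χ p.1 * fderiv ℝ (fderiv ℝ ρ) (q - p.2) (v p.1) (w p.1)) ∂(volume.prod μ) =
        ∫ p, H p * (χ p.1 * ρ (q - p.2)) ∂(volume.prod μ)) :
    ∀ᵐ t, t ∈ J → ∀ᵐ q ∂μ,
      mol μ (fun t z => fderiv ℝ (fderiv ℝ ρ) z (v t) (w t)) U (t, q) =
        mol μ (fun _ => ρ) H (t, q) := by
  set K : ℝ → E → ℝ := fun t z => fderiv ℝ (fderiv ℝ ρ) z (v t) (w t) with hK
  have cK : Continuous (Function.uncurry K) := continuous_second_derivative_kernel hρ hv hw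
  have cρ : Continuous (Function.uncurry fun (_ : ℝ) => ρ) := hρ.continuous.comp continuous_snd
  have bK : ∀ t z, z ∉ tsupport ρ → K t z = 0 := fun t z hz => by
    simp [hK, fderiv_fderiv_eq_zero hz]
  have bρ : ∀ (t : ℝ) z, z ∉ tsupport ρ → (fun (_ : ℝ) => ρ) t z = 0 := fun t z hz =>
    image_eq_zero_of_notMem_tsupport hz
  have h1 : ∀ q, ∀ᵐ t, t ∈ J → mol μ K U (t, q) - mol μ (fun _ => ρ) H (t, q) = 0 := by
    intro q
    have lU := locallyIntegrable_mol cK hc.isCompact bK hU q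
    have lH := locallyIntegrable_mol cρ hc.isCompact bρ hH q
    refine hJo.ae_eq_zero_of_integral_contDiff_smul_eq_zero
      ((lU.sub lH).locallyIntegrableOn _) fun χ hχ hχc hχs => ?_
    have e1 := hw2 χ q hχ hχc hχs
    have e2 := integral_mul_kernel_eq
      (integrable_mul_kernel cK hc.isCompact bK hU hχ.continuous hχc q)
    have e3 := integral_mul_kernel_eq (K := fun _ => ρ)
      (integrable_mul_kernel cρ hc.isCompact bρ hH hχ.continuous hχc q)
    have e4 : ∫ t, mol μ K U (t, q) * χ t = ∫ t, mol μ (fun _ => ρ) H (t, q) * χ t :=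
      e2.symm.trans (e1.trans e3)
    have e5 : ∀ t, χ t • (mol μ K U (t, q) - mol μ (fun _ => ρ) H (t, q)) =
        mol μ K U (t, q) * χ t - mol μ (fun _ => ρ) H (t, q) * χ t := fun t => by
      simp only [smul_eq_mul]; ring
    calc _ = ∫ t, (mol μ K U (t, q) * χ t - mol μ (fun _ => ρ) H (t, q) * χ t) :=
          integral_congr_ae (.of_forall e5)
      _ = 0 := by
          rw [integral_sub (integrable_mul_of_hasCompactSupport lU hχ.continuous hχc)
            (integrable_mul_of_hasCompactSupport lH hχ.continuous hχc), e4, sub_self]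
  have m1 : StronglyMeasurable (mol μ K U) := stronglyMeasurable_mol cK mU
  have m2 : StronglyMeasurable (mol μ (fun _ => ρ) H) := stronglyMeasurable_mol cρ mH
  have ms : MeasurableSet {x : ℝ × E | x.1 ∈ J →
      mol μ K U (x.1, x.2) - mol μ (fun _ => ρ) H (x.1, x.2) = 0} := by
    have := (hJo.measurableSet.preimage measurable_fst).imp
      (measurableSet_eq_fun (m1.measurable.sub m2.measurable) (measurable_const (a := (0 : ℝ))))
    exact this
  -- At each `q` the exceptional set of times depends on `q`. Joint measurability allows the two
  -- quantifiers to be exchanged, as the energy argument works on time slices.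
  have h2 := (Measure.ae_ae_comm (μ := volume) (ν := μ) ms).2 (.of_forall h1)
  filter_upwards [h2] with t ht hJt
  filter_upwards [ht] with q hq
  linarith [hq hJt]

/-- The dissipation inequality on a time slice. -/
lemma integral_mul_mollified_le {d : ℕ} {A : Fin d → Fin d → ℝ} {lam : ℝ}
    (hA : ∀ ξ : Fin d → ℝ, 0 ≤ ∑ i, ∑ j, A i j * ξ i * ξ j) {e : Fin d → E} {ρ G : E → ℝ}
    (hρ : ContDiff ℝ ∞ ρ) (hc : HasCompactSupport ρ) (mG : Measurable G) (hG : MemLp G 2 μ)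
    {H : Fin d → Fin d → E → ℝ} (mH : ∀ i j, Measurable (H i j)) (hH : ∀ i j, MemLp (H i j) 2 μ)
    (hD : ∀ i j, ∀ᵐ q ∂μ, ∫ q', fderiv ℝ (fderiv ℝ ρ) (q - q') (e i) (e j) * G q' ∂μ =
      ∫ q', ρ (q - q') * H i j q' ∂μ) :
    ∫ q, (∫ q', ρ (q - q') * G q' ∂μ) *
        (∫ q', ρ (q - q') * (∑ i, ∑ j, A i j * H i j q' - lam * G q') ∂μ) ∂μ ≤
      -lam * ∫ q, (∫ q', ρ (q - q') * G q' ∂μ) ^ 2 ∂μ := by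
  have ii : ∀ {F : E → ℝ}, MemLp F 2 μ → ∀ q, Integrable (fun q' => ρ (q - q') * F q') μ := by
    intro F hF q
    exact (hF.locallyIntegrable (by norm_num)).integrable_smul_left_of_hasCompactSupport
      (hρ.continuous.comp (continuous_const.sub continuous_id))
      (hc.comp_homeomorph (Homeomorph.subLeft q))
  have lin : ∀ q, ∫ q', ρ (q - q') * (∑ i, ∑ j, A i j * H i j q' - lam * G q') ∂μ =
      ∑ i, ∑ j, A i j * ∫ q', ρ (q - q') * H i j q' ∂μ - lam * ∫ q', ρ (q - q') * G q' ∂μ := by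
    intro q
    have e1 : ∀ q', ρ (q - q') * (∑ i, ∑ j, A i j * H i j q' - lam * G q') =
        ∑ i, ∑ j, A i j * (ρ (q - q') * H i j q') - lam * (ρ (q - q') * G q') := by
      intro q'
      simp only [mul_sub, Finset.mul_sum]
      congr 1
      · refine Finset.sum_congr rfl fun i _ => Finset.sum_congr rfl fun j _ => by ring
      · ring
    have j1 : ∀ i j, Integrable (fun q' => A i j * (ρ (q - q') * H i j q')) μ :=
      fun i j => (ii (hH i j) q).const_mul _
    simp_rw [e1]
    rw [integral_sub (integrable_finsetSum _ fun i _ => integrable_finsetSum _ fun j _ => j1 i j)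
      ((ii hG q).const_mul _), integral_const_mul,
      integral_finsetSum _ fun i _ => integrable_finsetSum _ fun j _ => j1 i j]
    congr 1
    refine Finset.sum_congr rfl fun i _ => ?_
    rw [integral_finsetSum _ fun j _ => j1 i j]
    refine Finset.sum_congr rfl fun j _ => integral_const_mul _ _
  have diss := sum_mul_integral_second_derivative_nonpos hA e hρ hc mG hG
  have m0 := memLp_integral_sub_mul hρ.continuous hc mG hG
  have mm := fun i j => memLp_integral_sub_mul hρ.continuous hc (mH i j) (hH i j)
  have e2 : ∀ i j, ∫ q, (∫ q', ρ (q - q') * G q' ∂μ) *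
      (∫ q', fderiv ℝ (fderiv ℝ ρ) (q - q') (e i) (e j) * G q' ∂μ) ∂μ =
      ∫ q, (∫ q', ρ (q - q') * G q' ∂μ) * (∫ q', ρ (q - q') * H i j q' ∂μ) ∂μ := by
    intro i j
    refine integral_congr_ae ?_
    filter_upwards [hD i j] with q hq
    rw [hq]
  simp_rw [e2] at diss
  simp_rw [lin]
  exact integral_mul_sum_sub_le m0 mm diss

/-- The energy of a mollified solution decays weakly. -/
lemma mol_eq_zero_of_weak_equation {d : ℕ} {J : Set ℝ} (hJo : IsOpen J) (hJ : IsLowerSet J)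
    {lam : ℝ} (hlam : 0 < lam) {a : Fin d → Fin d → ℝ → ℝ} (ma : ∀ i j, Measurable (a i j))
    {C : ℝ} (ba : ∀ i j t, |a i j t| ≤ C)
    (ha : ∀ t (ξ : Fin d → ℝ), 0 ≤ ∑ i, ∑ j, a i j t * ξ i * ξ j)
    {e : Fin d → ℝ → E} (he : ∀ i, Continuous (e i))
    {ρ : E → ℝ} (hρ : ContDiff ℝ ∞ ρ) (hc : HasCompactSupport ρ)
    {U : ℝ × E → ℝ} {H : Fin d → Fin d → ℝ × E → ℝ} (mU : StronglyMeasurable U)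
    (mH : ∀ i j, StronglyMeasurable (H i j))
    (hU : MemLp U 2 (volume.prod μ)) (hH : ∀ i j, MemLp (H i j) 2 (volume.prod μ))
    (hw2 : ∀ i j (χ : ℝ → ℝ) (q : E), ContDiff ℝ ∞ χ → HasCompactSupport χ → tsupport χ ⊆ J →
      ∫ p, U p * (χ p.1 * fderiv ℝ (fderiv ℝ ρ) (q - p.2) (e i p.1) (e j p.1)) ∂(volume.prod μ) =
        ∫ p, H i j p * (χ p.1 * ρ (q - p.2)) ∂(volume.prod μ))
    (hw1 : ∀ (χ : ℝ → ℝ) (q : E), ContDiff ℝ ∞ χ → HasCompactSupport χ → tsupport χ ⊆ J →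
      ∫ p, U p * (deriv χ p.1 * ρ (q - p.2)) ∂(volume.prod μ) =
        -∫ p, (∑ i, ∑ j, a i j p.1 * H i j p - lam * U p) * (χ p.1 * ρ (q - p.2)) ∂(volume.prod μ)) :
    ∀ᵐ t, t ∈ J → ∀ᵐ q ∂μ, mol μ (fun _ => ρ) U (t, q) = 0 := by
  have cρ : Continuous (Function.uncurry fun (_ : ℝ) => ρ) := hρ.continuous.comp continuous_snd
  have bρ : ∀ (t : ℝ) z, z ∉ tsupport ρ → (fun (_ : ℝ) => ρ) t z = 0 := fun t z hz =>
    image_eq_zero_of_notMem_tsupport hz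
  -- `Y` is the weak time derivative of `U`, and its mollification is the time derivative of the
  -- mollified `U` at every point `q`.
  obtain ⟨Y, hY⟩ : ∃ Y : ℝ × E → ℝ,
      Y = fun p => ∑ i, ∑ j, a i j p.1 * H i j p - lam * U p := ⟨_, rfl⟩
  have mY : StronglyMeasurable Y := by
    rw [hY]; exact (stronglyMeasurable_sum_coeff ma mH).sub (mU.const_mul lam)
  have hYL : MemLp Y 2 (volume.prod μ) := by
    rw [hY]; exact (memLp_sum_coeff ma ba hH).sub (hU.const_mul lam)
  -- the dissipation inequality
  have diss : ∀ᵐ t, t ∈ J → ∫ q, mol μ (fun _ => ρ) U (t, q) * mol μ (fun _ => ρ) Y (t, q) ∂μ ≤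
      -lam * ∫ q, mol μ (fun _ => ρ) U (t, q) ^ 2 ∂μ := by
    have hD : ∀ᵐ t, ∀ i j, t ∈ J → ∀ᵐ q ∂μ,
        mol μ (fun t z => fderiv ℝ (fderiv ℝ ρ) z (e i t) (e j t)) U (t, q) =
          mol μ (fun _ => ρ) (H i j) (t, q) := by
      rw [ae_all_iff]; intro i
      rw [ae_all_iff]; intro j
      exact ae_mol_second_derivative_eq hJo hρ hc (he i) (he j) mU (mH i j) hU (hH i j) (hw2 i j)
    have hHs : ∀ᵐ t, ∀ i j, MemLp (fun q => H i j (t, q)) 2 μ := by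
      rw [ae_all_iff]; intro i
      rw [ae_all_iff]; intro j
      exact memLp_two_prod_right_ae (hH i j)
    filter_upwards [hD, hHs, memLp_two_prod_right_ae hU] with t h1 h2 h3 hJt
    have := integral_mul_mollified_le (lam := lam) (ha t) (e := fun i => e i t) hρ hc
      (mU.measurable.comp measurable_prodMk_left) h3
      (fun i j => (mH i j).measurable.comp measurable_prodMk_left) h2 (fun i j => h1 i j hJt)
    rw [hY]
    exact this
  have V2 : MemLp (mol μ (fun _ => ρ) U) 2 (volume.prod μ) := memLp_mol hρ.continuous hc mU hU
  have Z2 : MemLp (mol μ (fun _ => ρ) Y) 2 (volume.prod μ) := memLp_mol hρ.continuous hc mY hYL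
  have lV := locallyIntegrable_mol cρ hc.isCompact bρ hU
  have lZ := locallyIntegrable_mol cρ hc.isCompact bρ hYL
  have hw : ∀ q (χ : ℝ → ℝ), ContDiff ℝ ∞ χ → HasCompactSupport χ → tsupport χ ⊆ J →
      ∫ t, mol μ (fun _ => ρ) U (t, q) * deriv χ t =
        -∫ t, mol μ (fun _ => ρ) Y (t, q) * χ t := by
    intro q χ hχ hχc hχs
    have e1 := integral_mul_kernel_eq (K := fun _ => ρ) (integrable_mul_kernel cρ hc.isCompact bρ hU
      (hχ.continuous_deriv (by simp)) hχc.deriv q)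
    have e2 := integral_mul_kernel_eq (K := fun _ => ρ) (integrable_mul_kernel cρ hc.isCompact bρ hYL
      hχ.continuous hχc q)
    rw [← e1, ← e2, hY]
    exact hw1 χ q hχ hχc hχs
  have energy := fun (χ : ℝ → ℝ) (h1 : ContDiff ℝ ∞ χ) (h2 : HasCompactSupport χ)
    (h3 : tsupport χ ⊆ J) => integral_energy_mul_deriv hJo hJ V2 Z2 lV lZ hw h1 h2 h3
  generalize mol μ (fun _ => ρ) U = V at *
  generalize mol μ (fun _ => ρ) Y = Z at *
  have hVsq : Integrable (fun p => V p ^ 2) (volume.prod μ) := V2.integrable_sq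
  have hVZ : Integrable (fun p => V p * Z p) (volume.prod μ) := V2.integrable_mul Z2
  -- The rate is `2 * lam` since the energy is a square: its weak derivative is `2 ∫ V Z`, and
  -- dissipation bounds `∫ V Z` by `-lam ∫ V²`.
  have hz := ae_eq_zero_of_decay hJo hJ (lam := 2 * lam) (by positivity)
    (E := fun t => ∫ q, V (t, q) ^ 2 ∂μ) hVsq.integral_prod_left
    (fun t => integral_nonneg fun q => sq_nonneg _) ?_
  · filter_upwards [hz, memLp_two_prod_right_ae V2] with t ht hVt hJt
    have h1 := (integral_eq_zero_iff_of_nonneg (fun q => sq_nonneg (V (t, q)))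
      hVt.integrable_sq).1 (ht hJt)
    filter_upwards [h1] with q hq
    simpa using hq
  · intro χ hχ hχc hχs hχ0
    rw [energy χ hχ hχc hχs, ← integral_const_mul, ← integral_const_mul]
    have b1 : ∀ {k : ℝ → ℝ}, Integrable k → Integrable fun t => k t * χ t := fun hk =>
      integrable_mul_of_hasCompactSupport hk.locallyIntegrable hχ.continuous hχc
    refine integral_mono_ae ((b1 hVsq.integral_prod_left).const_mul _)
      ((b1 hVZ.integral_prod_left).const_mul _) ?_
    filter_upwards [diss] with t ht
    by_cases hJt : t ∈ J
    · nlinarith [mul_le_mul_of_nonneg_right (ht hJt) (hχ0 t)]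
    · simp [image_eq_zero_of_notMem_tsupport fun h => hJt (hχs h)]

end Uniqueness

/-- A function all of whose mollifications vanish is zero. -/
lemma ae_eq_zero_of_forall_mol {E : Type*} [NormedAddCommGroup E] [NormedSpace ℝ E]
    [FiniteDimensional ℝ E] [MeasurableSpace E] [BorelSpace E] {μ : Measure E}
    [μ.IsAddHaarMeasure] {J : Set ℝ} {U : ℝ × E → ℝ} (hU : MemLp U 2 (volume.prod μ))
    (h : ∀ ρ : E → ℝ, ContDiff ℝ ∞ ρ → HasCompactSupport ρ →
      ∀ᵐ t, t ∈ J → ∀ᵐ q ∂μ, mol μ (fun _ => ρ) U (t, q) = 0) :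
    ∀ᵐ t, t ∈ J → ∀ᵐ q ∂μ, U (t, q) = 0 := by
  have hp : ∀ n : ℕ, (0 : ℝ) < 1 / (n + 1) := fun n => Nat.one_div_pos_of_nat
  -- Outer and inner radii keep the fixed ratio `2`, as required for almost everywhere convergence
  -- at Lebesgue points. A sequence of bumps keeps the exceptional sets countable.
  let φ : ℕ → ContDiffBump (0 : E) := fun n =>
    ⟨1 / (n + 1), 2 * (1 / (n + 1)), hp n, by linarith [hp n]⟩
  have h1 : ∀ᵐ t, ∀ n, t ∈ J → ∀ᵐ q ∂μ, mol μ (fun _ => (φ n).normed μ) U (t, q) = 0 :=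
    ae_all_iff.2 fun n => h _ (φ n).contDiff_normed (φ n).hasCompactSupport_normed
  have hr : Filter.Tendsto (fun n => (φ n).rOut) Filter.atTop (nhds 0) := by
    have h2 := (tendsto_one_div_add_atTop_nhds_zero_nat (𝕜 := ℝ)).const_mul 2
    rw [mul_zero] at h2
    exact h2
  filter_upwards [h1, memLp_two_prod_right_ae hU] with t ht hUt hJt
  have h2 := ContDiffBump.ae_convolution_tendsto_right_of_locallyIntegrable (μ := μ) (K := 2) hr
    (.of_forall fun n => le_rfl) (hUt.locallyIntegrable (by norm_num))
  have h3 : ∀ᵐ q ∂μ, ∀ n, mol μ (fun _ => (φ n).normed μ) U (t, q) = 0 :=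
    ae_all_iff.2 fun n => ht n hJt
  filter_upwards [h2, h3] with q hq2 hq3
  refine tendsto_nhds_unique hq2 ?_
  have : ∀ n, (convolution ((φ n).normed μ) (fun q => U (t, q))
      (ContinuousLinearMap.lsmul ℝ ℝ) μ) q = 0 := fun n => by
    rw [← integral_sub_mul_eq_convolution]; exact hq3 n
  simp_rw [this]
  exact tendsto_const_nhds

/-! ### Product test functions and uniqueness in the moving coordinates. -/

lemma fderiv_apply_zero_right {E : Type*} [NormedAddCommGroup E] [NormedSpace ℝ E]
    {f : ℝ × E → ℝ} {X : ℝ × E} (hf : DifferentiableAt ℝ f X) (v : E) :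
    fderiv ℝ f X (0, v) = fderiv ℝ (fun q => f (X.1, q)) X.2 v := by
  have h := (hf.hasFDerivAt.comp X.2 (hasFDerivAt_prodMk_right (𝕜 := ℝ) X.1 X.2)).fderiv
  have e : (f ∘ fun q => (X.1, q)) = fun q => f (X.1, q) := rfl
  rw [e] at h
  rw [h]
  simp

lemma fderiv_apply_one_zero {E : Type*} [NormedAddCommGroup E] [NormedSpace ℝ E]
    {f : ℝ × E → ℝ} {X : ℝ × E} (hf : DifferentiableAt ℝ f X) :
    fderiv ℝ f X (1, 0) = deriv (fun t => f (t, X.2)) X.1 := by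
  have h := (hf.hasFDerivAt.comp X.1 (hasFDerivAt_prodMk_left (𝕜 := ℝ) X.1 X.2)).hasDerivAt.deriv
  have e : (f ∘ fun t => (t, X.2)) = fun t => f (t, X.2) := rfl
  rw [e] at h
  rw [h]
  simp

lemma fderiv_const_mul_comp_sub {E : Type*} [NormedAddCommGroup E] [NormedSpace ℝ E]
    {g : E → ℝ} (hg : Differentiable ℝ g) (c : ℝ) (q q' v : E) :
    fderiv ℝ (fun q' => c * g (q - q')) q' v = -c * fderiv ℝ g (q - q') v := by
  have h : HasFDerivAt (fun q' => c * g (q - q')) _ q' :=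
    ((hg (q - q')).hasFDerivAt.comp q' ((hasFDerivAt_id q').const_sub q)).const_mul c
  rw [h.fderiv]
  simp

/-- The test function `χ(t) ρ(q - q')`. -/
def prodTest {d : ℕ} (χ : ℝ → ℝ) (ρ : Sp d → ℝ) (q : Sp d) (X : Pt d) : ℝ :=
  χ X.1 * ρ (q - X.2)

lemma contDiff_prodTest {d : ℕ} {χ : ℝ → ℝ} {ρ : Sp d → ℝ} (hχ : ContDiff ℝ ∞ χ)
    (hρ : ContDiff ℝ ∞ ρ) (q : Sp d) : ContDiff ℝ ∞ (prodTest χ ρ q) :=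
  (hχ.comp contDiff_fst).mul (hρ.comp (contDiff_const.sub contDiff_snd))

lemma isTest_prodTest {d : ℕ} {T : EReal} {χ : ℝ → ℝ} {ρ : Sp d → ℝ} (hχ : ContDiff ℝ ∞ χ)
    (hχc : HasCompactSupport χ) (hχs : tsupport χ ⊆ {t : ℝ | (t : EReal) < T})
    (hρ : ContDiff ℝ ∞ ρ) (hρc : HasCompactSupport ρ) (q : Sp d) :
    IsTest (slab d T) (prodTest χ ρ q) where
  contDiff := contDiff_prodTest hχ hρ q
  hasCompactSupport := hasCompactSupport_mul_comp_sub (K := fun _ => ρ) hρc.isCompact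
    (fun _ _ hz => image_eq_zero_of_notMem_tsupport hz) hχc q
  tsupport_subset := by
    intro X hX
    have h1 : X.1 ∈ tsupport χ := by
      refine closure_minimal (s := Function.support (prodTest χ ρ q))
        (t := Prod.fst ⁻¹' tsupport χ) (fun Y hY => ?_)
        ((isClosed_tsupport χ).preimage continuous_fst) hX
      refine subset_tsupport χ fun h0 => hY ?_
      rw [prodTest, h0, zero_mul]
    exact hχs h1

lemma lagDt_prodTest {d : ℕ} {χ : ℝ → ℝ} {ρ : Sp d → ℝ} (hχ : ContDiff ℝ ∞ χ)
    (hρ : ContDiff ℝ ∞ ρ) (q : Sp d) (X : Pt d) :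
    lagDt (prodTest χ ρ q) X = deriv χ X.1 * ρ (q - X.2) := by
  rw [lagDt, fderiv_apply_one_zero ((contDiff_prodTest hχ hρ q).differentiable (by simp) X)]
  simp only [prodTest]
  exact ((hχ.differentiable (by simp) X.1).hasDerivAt.mul_const _).deriv

lemma lagDx_prodTest {d : ℕ} {χ : ℝ → ℝ} {ρ : Sp d → ℝ} (hχ : ContDiff ℝ ∞ χ)
    (hρ : ContDiff ℝ ∞ ρ) (q : Sp d) (j : Fin d) (X : Pt d) :
    lagDx j (prodTest χ ρ q) X = -χ X.1 * fderiv ℝ ρ (q - X.2) (lagVec X.1 j) := by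
  rw [lagDx, fderiv_apply_zero_right ((contDiff_prodTest hχ hρ q).differentiable (by simp) X)]
  simp only [prodTest]
  exact fderiv_const_mul_comp_sub (hρ.differentiable (by simp)) _ _ _ _

/-- The two signs from differentiating `ρ(q - q')` cancel. The direction `lagVec` depends on time
only, and the derivative is taken along a time slice, so the direction is not differentiated. -/
lemma lagDx_lagDx_prodTest {d : ℕ} {χ : ℝ → ℝ} {ρ : Sp d → ℝ} (hχ : ContDiff ℝ ∞ χ)
    (hρ : ContDiff ℝ ∞ ρ) (q : Sp d) (i j : Fin d) (X : Pt d) :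
    lagDx i (lagDx j (prodTest χ ρ q)) X =
      χ X.1 * fderiv ℝ (fderiv ℝ ρ) (q - X.2) (lagVec X.1 i) (lagVec X.1 j) := by
  have hd : ContDiff ℝ ∞ (lagDx j (prodTest χ ρ q)) := contDiff_lagDx j (contDiff_prodTest hχ hρ q)
  rw [lagDx, fderiv_apply_zero_right (hd.differentiable (by simp) X)]
  simp_rw [lagDx_prodTest hχ hρ q j]
  rw [fderiv_const_mul_comp_sub (g := fun z => fderiv ℝ ρ z (lagVec X.1 j))
    ((contDiff_fderiv_apply hρ _).differentiable (by simp)), fderiv_fderiv_apply hρ, neg_neg]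

lemma continuous_lagVec {d : ℕ} (i : Fin d) : Continuous fun t => lagVec (d := d) t i := by
  unfold lagVec; fun_prop

/-- Uniqueness for the equation in the coordinates moving with the transport field. -/
lemma lagrangian_unique {d : ℕ} {δ : ℝ} (hδ : 0 < δ) {a : Fin d → Fin d → ℝ → ℝ}
    (ha : IsElliptic δ a) {lam : ℝ} (hlam : 0 < lam) {T : EReal}
    {U : Pt d → ℝ} {H : Fin d → Fin d → Pt d → ℝ} (hU : MemLp U 2 volume)
    (hH : ∀ i j, MemLp (H i j) 2 volume)
    (h2 : ∀ i j ψ, IsTest (slab d T) ψ →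
      ∫ X, U X * lagDx i (lagDx j ψ) X = ∫ X, H i j X * ψ X)
    (h1 : ∀ ψ, IsTest (slab d T) ψ →
      ∫ X, U X * lagDt ψ X = -∫ X, (∑ i, ∑ j, a i j X.1 * H i j X - lam * U X) * ψ X) :
    ∀ᵐ X, X ∈ slab d T → U X = 0 := by
  -- Mollifications and slices at fixed `q` call for functions that are measurable everywhere, so
  -- representatives are chosen. The weak identities are unaffected by this change.
  obtain ⟨U', mU, eU⟩ : ∃ U', StronglyMeasurable U' ∧ U =ᵐ[volume] U' := hU.1
  have : ∀ i j, ∃ H', StronglyMeasurable H' ∧ H i j =ᵐ[volume] H' := fun i j => (hH i j).1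
  choose H' mH eH using this
  obtain ⟨C, hC⟩ := ha.bounded
  have eall : ∀ᵐ X, ∀ i j, H i j X = H' i j X := by
    rw [ae_all_iff]; intro i; rw [ae_all_iff]; exact eH i
  have hJo : IsOpen {t : ℝ | (t : EReal) < T} := isOpen_Iio.preimage continuous_coe_real_ereal
  have hJ : IsLowerSet {t : ℝ | (t : EReal) < T} := fun s t hts hs =>
    lt_of_le_of_lt (EReal.coe_le_coe_iff.2 hts) hs
  have key := ae_eq_zero_of_forall_mol (E := Sp d) (μ := volume)
    (J := {t : ℝ | (t : EReal) < T}) (U := U') (hU.ae_eq eU) fun ρ hρ hρc =>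
    mol_eq_zero_of_weak_equation (μ := volume) hJo hJ hlam ha.measurable hC
      (fun t ξ => ?_) (e := fun i t => lagVec t i) continuous_lagVec hρ hρc mU mH
      (hU.ae_eq eU) (fun i j => (hH i j).ae_eq (eH i j))
      (fun i j χ q hχ hχc hχs => ?_) (fun χ q hχ hχc hχs => ?_)
  · have ms : MeasurableSet {X : Pt d | X ∈ slab d T → U' X = 0} :=
      (isOpen_slab d T).measurableSet.imp
        (measurableSet_eq_fun mU.measurable (measurable_const (a := (0 : ℝ))))
    have h3 : ∀ᵐ X : Pt d, X ∈ slab d T → U' X = 0 := by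
      refine (Measure.ae_prod_iff_ae_ae ms).2 ?_
      filter_upwards [key] with t ht
      by_cases hJt : (t : EReal) < T
      · filter_upwards [ht hJt] with q hq _ using hq
      · exact .of_forall fun q h => absurd h hJt
    filter_upwards [h3, eU] with X h4 h5 h6
    rw [h5, h4 h6]
  · exact le_trans (by positivity) (ha.lower t (WithLp.toLp 2 ξ))
  · have h := h2 i j _ (isTest_prodTest hχ hχc hχs hρ hρc q)
    simp_rw [lagDx_lagDx_prodTest hχ hρ] at h
    refine Eq.trans (integral_congr_ae ?_) (h.trans (integral_congr_ae ?_))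
    · filter_upwards [eU] with X hX
      rw [hX]
    · filter_upwards [eH i j] with X hX
      rw [hX]; rfl
  · have h := h1 _ (isTest_prodTest hχ hχc hχs hρ hρc q)
    simp_rw [lagDt_prodTest hχ hρ] at h
    refine Eq.trans (integral_congr_ae ?_) (h.trans (congrArg Neg.neg (integral_congr_ae ?_)))
    · filter_upwards [eU] with X hX
      rw [hX]
    · filter_upwards [eU, eall] with X hX hX2
      simp_rw [hX, hX2]; rfl

/-! ### Uniqueness on the slab. -/

/-- Weak second derivatives are unique. -/
lemma HasWeakDxx.ae_eq {d : ℕ} {G : Set (Pt d)} (hG : IsOpen G) {i j : Fin d} {u g₁ g₂ : Pt d → ℝ}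
    (h₁ : HasWeakDxx G i j u g₁) (h₂ : HasWeakDxx G i j u g₂) :
    g₁ =ᵐ[volume.restrict G] g₂ := by
  have h := hG.ae_eq_zero_of_integral_contDiff_smul_eq_zero (μ := volume)
    (f := fun X => g₁ X - g₂ X) (h₁.locInt_deriv.sub h₂.locInt_deriv) fun φ hφ hc hs => ?_
  · rw [Filter.EventuallyEq, ae_restrict_iff' hG.measurableSet]
    filter_upwards [h] with X hX hXG
    linarith [hX hXG]
  have ht : IsTest G φ := ⟨hφ, hc, hs⟩
  have ii : ∀ {g : Pt d → ℝ}, LocallyIntegrableOn g G volume →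
      Integrable (fun X => g X * φ X) (volume.restrict G) := by
    intro g hg
    have h1 : IntegrableOn (fun X => φ X • g X) (tsupport φ) volume :=
      (hg.integrableOn_compact_subset hs hc.isCompact).continuousOn_smul
        hφ.continuous.continuousOn hc.isCompact
    have h2 : Integrable (fun X => φ X • g X) volume :=
      (integrableOn_iff_integrable_of_support_subset fun X hX => subset_tsupport φ fun h0 =>
        hX (by simp [h0])).1 h1
    simpa [mul_comm] using h2.restrict (s := G)
  have e1 : ∫ X, φ X • (g₁ X - g₂ X) = ∫ X in G, φ X • (g₁ X - g₂ X) :=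
    (setIntegral_eq_integral_of_forall_compl_eq_zero fun X hX => by
      rw [ht.eq_zero hX, zero_smul]).symm
  have e2 : ∀ X, φ X • (g₁ X - g₂ X) = g₁ X * φ X - g₂ X * φ X := fun X => by
    simp only [smul_eq_mul]; ring
  rw [e1]
  simp_rw [e2]
  rw [integral_sub (ii h₁.locInt_deriv) (ii h₂.locInt_deriv), ← h₁.integral_eq φ ht,
    ← h₂.integral_eq φ ht, sub_self]

/-- The weak formulation of the equation, with square integrable second derivatives. -/
lemma IsSolution.exists_weak {d : ℕ} {a : Fin d → Fin d → ℝ → ℝ} {lam : ℝ} {G : Set (Pt d)}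
    (hG : IsOpen G) {f u : Pt d → ℝ} (h : IsSolution a lam G f u) :
    MemLp u 2 (volume.restrict G) ∧ ∃ H : Fin d → Fin d → Pt d → ℝ,
      (∀ i j, MemLp (H i j) 2 (volume.restrict G)) ∧
      (∀ i j φ, IsTest G φ → ∫ X in G, u X * dx i (dx j φ) X = ∫ X in G, H i j X * φ X) ∧
      ∀ φ, IsTest G φ → ∫ X in G, u X * transport φ X =
        -∫ X in G, (f X + ∑ i, ∑ j, a i j X.1 * H i j X - lam * u X) * φ X := by
  obtain ⟨hS, Y, H, hY, hH, heq⟩ := h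
  choose g hg mg using hS.hess
  refine ⟨hS.memLp, g, mg, fun i j => (hg i j).integral_eq, fun φ hφ => ?_⟩
  rw [hY.integral_eq φ hφ]
  congr 1
  refine integral_congr_ae ?_
  -- The second derivatives appearing in the equation are not assumed square integrable, while those
  -- supplied by `MemS` are. Uniqueness of weak derivatives identifies the two.
  have hall : ∀ᵐ X ∂(volume.restrict G), ∀ i j, H i j X = g i j X := by
    rw [ae_all_iff]; intro i; rw [ae_all_iff]; intro j
    exact (hH i j).ae_eq hG (hg i j)
  filter_upwards [heq, hall] with X h1 h2
  simp_rw [h2] at h1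
  rw [← h1]
  ring

lemma IsTest.memLp {d : ℕ} {G : Set (Pt d)} {φ : Pt d → ℝ} (h : IsTest G φ) :
    MemLp φ 2 (volume.restrict G) :=
  (h.contDiff.continuous.memLp_of_hasCompactSupport h.hasCompactSupport).restrict _

lemma IsTest.transport {d : ℕ} {G : Set (Pt d)} {φ : Pt d → ℝ} (h : IsTest G φ) :
    IsTest G (transport φ) := by
  have hsub : tsupport (KFP.transport φ) ⊆ tsupport φ := by
    refine (closure_mono fun X hX => ?_).trans (tsupport_fderiv_subset ℝ (f := φ))
    rw [Function.mem_support] at hX ⊢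
    intro h
    exact hX (by simp [KFP.transport, h])
  have c : ContDiff ℝ ∞ (fderiv ℝ φ) := h.contDiff.fderiv_right (by simp)
  refine ⟨?_, h.hasCompactSupport.of_isClosed_subset (isClosed_tsupport _) hsub,
    hsub.trans h.tsupport_subset⟩
  refine ((c.clm_apply contDiff_const).sub (c.clm_apply ?_)).sub (c.clm_apply ?_) <;> fun_prop

/-- Solutions of the equation on `slab d T` are unique. -/
lemma IsSolution.ae_eq {d : ℕ} {δ : ℝ} (hδ : 0 < δ) {a : Fin d → Fin d → ℝ → ℝ}
    (ha : IsElliptic δ a) {lam : ℝ} (hlam : 0 < lam) {T : EReal} {f u₁ u₂ : Pt d → ℝ}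
    (hf : MemLp f 2 (volume.restrict (slab d T)))
    (h₁ : IsSolution a lam (slab d T) f u₁) (h₂ : IsSolution a lam (slab d T) f u₂) :
    u₁ =ᵐ[volume.restrict (slab d T)] u₂ := by
  have hS := isOpen_slab d T
  obtain ⟨m₁, H₁, mH₁, hx₁, ht₁⟩ := h₁.exists_weak hS
  obtain ⟨m₂, H₂, mH₂, hx₂, ht₂⟩ := h₂.exists_weak hS
  obtain ⟨K, hK⟩ := ha.bounded
  have lift : ∀ {h : Pt d → ℝ}, MemLp h 2 (volume.restrict (slab d T)) →
      MemLp ((slab d T).indicator h ∘ shear) 2 volume := fun hh =>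
    ((memLp_indicator_iff_restrict hS.measurableSet).2 hh).comp_measurePreserving
      (measurePreserving_shear d)
  have uns : ∀ ψ : Pt d → ℝ, (ψ ∘ unshear) ∘ shear = ψ := fun ψ => by
    ext X; simp [unshear_shear]
  have dif : ∀ {φ : Pt d → ℝ}, IsTest (slab d T) φ → Differentiable ℝ φ :=
    fun h => h.contDiff.differentiable (by simp)
  have push : ∀ (h : Pt d → ℝ) {φ : Pt d → ℝ}, IsTest (slab d T) φ →
      ∫ X, ((slab d T).indicator h ∘ shear) X * (φ ∘ shear) X = ∫ X in slab d T, h X * φ X := by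
    intro h φ hφ
    rw [← setIntegral_slab_eq _ _ fun X hX => hφ.eq_zero hX]
    refine setIntegral_congr_fun hS.measurableSet fun X hX => ?_
    simp only [Set.indicator_of_mem hX]
  have sub : ∀ {g₁ g₂ φ : Pt d → ℝ}, MemLp g₁ 2 (volume.restrict (slab d T)) →
      MemLp g₂ 2 (volume.restrict (slab d T)) → IsTest (slab d T) φ →
      ∫ X in slab d T, (g₁ X - g₂ X) * φ X =
        (∫ X in slab d T, g₁ X * φ X) - ∫ X in slab d T, g₂ X * φ X := by
    intro g₁ g₂ φ i₁ i₂ hφ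
    simp_rw [sub_mul]
    exact integral_sub (i₁.integrable_mul hφ.memLp) (i₂.integrable_mul hφ.memLp)
  -- The differences are extended by zero past `T` and moved to the new coordinates. The extension
  -- need not solve anything beyond `T`, because only test functions supported in the slab are used.
  have hz := lagrangian_unique hδ ha hlam (T := T)
    (U := (slab d T).indicator (fun X => u₁ X - u₂ X) ∘ shear)
    (H := fun i j => (slab d T).indicator (fun X => H₁ i j X - H₂ i j X) ∘ shear)
    (lift (m₁.sub m₂)) (fun i j => lift ((mH₁ i j).sub (mH₂ i j)))
    (fun i j ψ hψ => ?_) (fun ψ hψ => ?_)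
  · have hz' := (measurePreserving_unshear d).quasiMeasurePreserving.ae hz
    rw [Filter.EventuallyEq, ae_restrict_iff' hS.measurableSet]
    filter_upwards [hz'] with X hX hXS
    have := hX hXS
    simp only [Function.comp_apply, shear_unshear, Set.indicator_of_mem hXS] at this
    linarith
  · have hφ := hψ.comp_unshear
    rw [← uns ψ, lagDx_comp_shear (dif hφ), lagDx_comp_shear (dif (hφ.dx j)),
      push _ ((hφ.dx j).dx i), push _ hφ, sub m₁ m₂ ((hφ.dx j).dx i),
      sub (mH₁ i j) (mH₂ i j) hφ, hx₁ i j _ hφ, hx₂ i j _ hφ]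
  · have hφ := hψ.comp_unshear
    -- The homogeneous right-hand side is written as a difference of the two inhomogeneous ones, in
    -- which `f` cancels, to match the weak equations of `u₁` and `u₂`.
    have e : ∀ X : Pt d, (∑ i, ∑ j, a i j X.1 *
        ((slab d T).indicator (fun X => H₁ i j X - H₂ i j X) ∘ shear) X -
          lam * ((slab d T).indicator (fun X => u₁ X - u₂ X) ∘ shear) X) =
        ((slab d T).indicator (fun X => (f X + ∑ i, ∑ j, a i j X.1 * H₁ i j X - lam * u₁ X) -
          (f X + ∑ i, ∑ j, a i j X.1 * H₂ i j X - lam * u₂ X)) ∘ shear) X := by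
      intro X
      by_cases hX : shear X ∈ slab d T
      · have h1 : (shear X).1 = X.1 := rfl
        simp only [Function.comp_apply, Set.indicator_of_mem hX, h1, mul_sub,
          Finset.sum_sub_distrib]
        ring
      · simp [Set.indicator_of_notMem hX]
    have mY : ∀ {u : Pt d → ℝ} {H : Fin d → Fin d → Pt d → ℝ},
        MemLp u 2 (volume.restrict (slab d T)) →
        (∀ i j, MemLp (H i j) 2 (volume.restrict (slab d T))) →
        MemLp (fun X => f X + ∑ i, ∑ j, a i j X.1 * H i j X - lam * u X) 2
          (volume.restrict (slab d T)) := fun mu mH =>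
      (hf.add (memLp_sum_coeff ha.measurable hK mH)).sub (mu.const_mul lam)
    simp_rw [e]
    rw [← uns ψ, lagDt_comp_shear (dif hφ), push _ hφ.transport, push _ hφ,
      sub m₁ m₂ hφ.transport, sub (mY m₁ mH₁) (mY m₂ mH₂) hφ, ht₁ _ hφ, ht₂ _ hφ]
    ring

end KFP

end

theorem theorem2p2 (d : ℕ) (δ : ℝ) (hδ : 0 < δ) (hδ1 : δ < 1)
    (a : Fin d → Fin d → ℝ → ℝ) (ha : KFP.IsElliptic δ a)
    (lam : ℝ) (hlam : 0 < lam) (T : EReal) (hT : ⊥ < T)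
    (f : Lp ℝ 2 (volume.restrict (KFP.slab d T))) :
    ∃! u : Lp ℝ 2 (volume.restrict (KFP.slab d T)),
      KFP.IsSolution a lam (KFP.slab d T) f u := by
  have hf := Lp.memLp f
  -- `hsol` covers every function equal almost everywhere to `u`, in particular the representative
  -- carried by its class in `Lp`.
  obtain ⟨u, hu, hsol⟩ := KFP.exists_isSolution hδ hδ1 ha hlam hf
  refine ⟨hu.toLp u, hsol _ hu.coeFn_toLp, fun v hv => Lp.ext ?_⟩
  exact KFP.IsSolution.ae_eq hδ ha hlam hf hv (hsol _ hu.coeFn_toLp)
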